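/- Let $N\ge 2$ be even and let $\tau$ be purely imaginary with $\operatorname{Im}\tau>0$. Put $q=e^{i\pi\tau}$ and let $$\theta_1(u)=2\sum_{n\ge0}(-1)^nq^{(n+\frac12)^2}\sin[(2n+1)\pi u],\qquad \theta_2(u)=2\sum_{n\ge0}q^{(n+\frac12)^2}\cos[(2n+1)\pi u],$$ $$\theta_3(u)=1+2\sum_{n\ge1}q^{n^2}\cos(2n\pi u),\qquad \theta_4(u)=1+2\sum_{n\ge1}(-1)^nq^{n^2}\cos(2n\pi u).$$ On $(\mathbb C^2)^{\otimes N}$ consider the periodic XY Hamiltonian $$H_{XY}=\sum_{n=1}^N\bigl(J_x\sigma_n^x\sigma_{n+1}^x+J_y\sigma_n^y\sigma_{n+1}^y\bigr),\quad \sigma^\alpha_{N+1}=\sigma^\alpha_1,\qquad J_x=\frac{\theta_3(0)}{\theta_4(0)},\quad J_y=\frac{\theta_4(0)}{\theta_3(0)}.$$ For $\kappa=\pm1$ and integers $1\le n_1<\dots<n_M\le N$ define the chiral (kink) state $$|\kappa;n_1,\dots,n_M\rangle=(-i)^{n_1+\dots+n_M}\bigotimes_{l=1}^{N}\psi\bigl(l-2k_l-\kappa\bigr),\qquad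 k_l=\#\{j: n_j<l\},\qquad \psi(k)=\frac1{\sqrt2}\binom{1}{i^{k}}.$$ Call $M$ admissible if $0\le M\le N$ and $M\equiv N/2 \pmod 2$. Let $D$ be the union of the two rectangles $\{-\frac12<\operatorname{Re}u\le0,\ -\frac{\operatorname{Im}\tau}2<\operatorname{Im}u\le\frac{\operatorname{Im}\tau}2\}$ and $\{0<\operatorname{Re}u\le\frac12,\ -\frac{\operatorname{Im}\tau}2\le\operatorname{Im}u<\frac{\operatorname{Im}\tau}2\}$. For $\xi\in\{0,1\}$, the Bethe roots of sector $\xi$ are the solutions $u\in D$ of $$\left[\frac{\theta_1(u+\frac14)}{\theta_1(u-\frac14)}\right]^N=(-1)^{\xi+1}.$$ Fix any strict total order on $\mathbb C$. For $\xi\in\{0,1\}$, admissible $M$ and Bethe roots $u_1<\dots<u_M$ of sector $\xi$ (increasing in this order), put $\boldsymbol u=(u_1,\dots,u_M)$ and $$|\Psi_M(\boldsymbol u)\rangle=\sum_{1\le n_1<\dots<n_M\le N}\ \sum_{\kappa=\pm1}\chi_{\boldsymbol n}(\boldsymbol u)\,\kappa^\xi\,|\kappa;\boldsymbol n\rangle,\qquad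 \chi_{\boldsymbol n}(\boldsymbol u)=\frac1{\sqrt{2N^M}}\det_{j,l=1,\dots,M}\bigl\{\mathcal A_{n_j}(u_l)\bigr\},$$ $$\mathcal A_n(u)=\left[\frac{\theta_1(u+\frac14)}{\theta_1(u-\frac14)}\right]^n\left[\frac{\theta_3(u+\frac{\epsilon_n}4)}{\theta_3(u-\frac{\epsilon_n}4)}\right]^{1/2},\qquad\epsilon_n=(-1)^n,$$ with the principal square root. (For $M=0$ the determinant is $1$.) Then the states $|\Psi_M(\boldsymbol u)\rangle$, for all $\xi$, all admissible $M$ and all such $\boldsymbol u$, form a complete set of mutually orthogonal, normalized eigenstates of $H_{XY}$, that is, they are orthonormal and span $(\mathbb C^2)^{\otimes N}$; and $H_{XY}|\Psi_M(\boldsymbol u)\rangle=E(\boldsymbol u)|\Psi_M(\boldsymbol u)\rangle$ with $$E(\boldsymbol u)=2\,\frac{\theta_2(0)}{\theta_1'(0)}\sum_{j=1}^M\left[\frac{\theta_1'(u_j-\frac14)}{\theta_1(u_j-\frac14)}-\frac{\theta_1'(u_j+\frac14)}{\theta_1(u_j+\frac14)}\right].$$ -/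

import Mathlib

namespace XYChain

/-! ### Jacobi theta functions with nome `q = exp (i π τ)`, argument rescaled by `π` -/

/-- `q ^ a = exp (i π τ a)`, for the nome `q = exp (i π τ)`. -/
noncomputable def nomePow (τ a : ℂ) : ℂ := Complex.exp (Complex.I * Real.pi * τ * a)

/-- `θ₁(u) = 2 ∑_{n ≥ 0} (-1)ⁿ q^{(n+1/2)²} sin((2n+1)πu)` -/
noncomputable def theta1 (τ u : ℂ) : ℂ :=
  2 * ∑' n : ℕ, (-1) ^ n * nomePow τ (((n : ℂ) + 1 / 2) ^ 2) *
    Complex.sin ((2 * (n : ℂ) + 1) * Real.pi * u)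

/-- `θ₂(u) = 2 ∑_{n ≥ 0} q^{(n+1/2)²} cos((2n+1)πu)` -/
noncomputable def theta2 (τ u : ℂ) : ℂ :=
  2 * ∑' n : ℕ, nomePow τ (((n : ℂ) + 1 / 2) ^ 2) *
    Complex.cos ((2 * (n : ℂ) + 1) * Real.pi * u)

/-- `θ₃(u) = 1 + 2 ∑_{n ≥ 1} q^{n²} cos(2nπu)` -/
noncomputable def theta3 (τ u : ℂ) : ℂ :=
  1 + 2 * ∑' n : ℕ, nomePow τ (((n : ℂ) + 1) ^ 2) *
    Complex.cos (2 * ((n : ℂ) + 1) * Real.pi * u)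

/-- `θ₄(u) = 1 + 2 ∑_{n ≥ 1} (-1)ⁿ q^{n²} cos(2nπu)` -/
noncomputable def theta4 (τ u : ℂ) : ℂ :=
  1 + 2 * ∑' n : ℕ, (-1) ^ (n + 1) * nomePow τ (((n : ℂ) + 1) ^ 2) *
    Complex.cos (2 * ((n : ℂ) + 1) * Real.pi * u)

/-! ### The space of states and the Hamiltonian -/

/-- The space of states `(ℂ²)^{⊗N}` with its standard inner product, in the product basis:
a vector is a function of `s : Fin N → Fin 2`, where `s n = 0` means spin up and `s n = 1`
means spin down at the site with number `n + 1`. -/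
abbrev StateSpace (N : ℕ) : Type := EuclideanSpace ℂ (Fin N → Fin 2)

/-- The Pauli matrix `σˣ`. -/
def pauliX : Matrix (Fin 2) (Fin 2) ℂ := !![0, 1; 1, 0]

/-- The Pauli matrix `σʸ`. -/
def pauliY : Matrix (Fin 2) (Fin 2) ℂ := !![0, -Complex.I; Complex.I, 0]

/-- The operator acting as the matrix `A` on the tensor factor `n`, and as the identity on
the others. -/
noncomputable def siteOp {N : ℕ} (A : Matrix (Fin 2) (Fin 2) ℂ) (n : Fin N) :
    StateSpace N →ₗ[ℂ] StateSpace N where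
  toFun v := WithLp.toLp 2 fun s => ∑ t : Fin 2, A (s n) t * v (Function.update s n t)
  map_add' v w := by
    ext s
    simp only [PiLp.add_apply, mul_add, Finset.sum_add_distrib]
  map_smul' c v := by
    ext s
    simp only [PiLp.smul_apply, smul_eq_mul, RingHom.id_apply, Finset.mul_sum]
    exact Finset.sum_congr rfl fun t _ => by ring

/-- The pure tensor `φ₁ ⊗ ⋯ ⊗ φ_N`. -/
noncomputable def pureTensor {N : ℕ} (φ : Fin N → Fin 2 → ℂ) : StateSpace N :=
  WithLp.toLp 2 fun s => ∏ l : Fin N, φ l (s l)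

/-- The periodic XY Hamiltonian `∑ₙ (Jx σₙˣ σₙ₊₁ˣ + Jy σₙʸ σₙ₊₁ʸ)`; `finRotate N n` is the
cyclic successor of the site `n`. -/
noncomputable def hamiltonianXY (N : ℕ) (Jx Jy : ℂ) : StateSpace N →ₗ[ℂ] StateSpace N :=
  ∑ n : Fin N,
    (Jx • (siteOp pauliX n ∘ₗ siteOp pauliX (finRotate N n)) +
      Jy • (siteOp pauliY n ∘ₗ siteOp pauliY (finRotate N n)))

/-- `Jx = θ₃(0) / θ₄(0)` -/
noncomputable def couplingX (τ : ℂ) : ℂ := theta3 τ 0 / theta4 τ 0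

/-- `Jy = θ₄(0) / θ₃(0)` -/
noncomputable def couplingY (τ : ℂ) : ℂ := theta4 τ 0 / theta3 τ 0

/-! ### The chiral basis -/

/-- The qubit state `ψ(k) = (1, iᵏ) / √2`. -/
noncomputable def qubit (k : ℤ) : Fin 2 → ℂ :=
  ![1 / (Real.sqrt 2 : ℂ), Complex.I ^ k / (Real.sqrt 2 : ℂ)]

/-- The number of the site `i`, in `1, …, N`. -/
def siteNumber {N : ℕ} (i : Fin N) : ℕ := (i : ℕ) + 1

/-- The number of kinks (at the sites `n 0 < n 1 < ⋯`) strictly to the left of site `l`. -/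
def kinksBefore {N M : ℕ} (n : Fin M → Fin N) (l : Fin N) : ℕ :=
  (Finset.univ.filter fun j : Fin M => n j < l).card

/-- The chiral basis state `|κ; n₁, …, n_M⟩`: the qubit at site number `l` with
`n_k < l ≤ n_{k+1}` is `ψ(l - 2k - κ)`, and the phase is `(-i)^{n₁ + ⋯ + n_M}`. -/
noncomputable def chiralState {N M : ℕ} (κ : ℤ) (n : Fin M → Fin N) : StateSpace N :=
  (-Complex.I) ^ (∑ j : Fin M, siteNumber (n j)) •
    pureTensor fun l : Fin N => qubit ((siteNumber l : ℤ) - 2 * (kinksBefore n l : ℤ) - κ)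

/-! ### Bethe roots and Bethe states -/

/-- `θ₁(u + 1/4) / θ₁(u - 1/4)` -/
noncomputable def thetaRatio (τ u : ℂ) : ℂ := theta1 τ (u + 1 / 4) / theta1 τ (u - 1 / 4)

/-- The one-kink amplitude `𝒜ₙ(u)`, with the principal square root. -/
noncomputable def kinkAmplitude (τ : ℂ) (n : ℕ) (u : ℂ) : ℂ :=
  thetaRatio τ u ^ n *
    (theta3 τ (u + (-1) ^ n / 4) / theta3 τ (u - (-1) ^ n / 4)) ^ (1 / 2 : ℂ)

/-- The amplitude `χₙ(u) = det {𝒜_{n_j}(u_l)} / √(2 N^M)`. -/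
noncomputable def chiralAmplitude {N M : ℕ} (τ : ℂ) (u : Fin M → ℂ) (n : Fin M → Fin N) : ℂ :=
  1 / (Real.sqrt (2 * (N : ℝ) ^ M) : ℂ) *
    (Matrix.of fun j l : Fin M => kinkAmplitude τ (siteNumber (n j)) (u l)).det

open Classical in
/-- The chiral Bethe state `|Ψ_M(u)⟩ = ∑_{n₁ < ⋯ < n_M} ∑_{κ = ±1} χₙ(u) κ^ξ |κ; n⟩`. -/
noncomputable def betheState {N M : ℕ} (τ : ℂ) (ξ : ℕ) (u : Fin M → ℂ) : StateSpace N :=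
  ∑ n : Fin M → Fin N with StrictMono n, ∑ κ ∈ ({1, -1} : Finset ℤ),
    (chiralAmplitude τ u n * (κ : ℂ) ^ ξ) • chiralState κ n

/-- The energy
`E(u) = 2 θ₂(0)/θ₁'(0) ∑_j [θ₁'(u_j - 1/4)/θ₁(u_j - 1/4) - θ₁'(u_j + 1/4)/θ₁(u_j + 1/4)]`. -/
noncomputable def betheEnergy {M : ℕ} (τ : ℂ) (u : Fin M → ℂ) : ℂ :=
  2 * (theta2 τ 0 / deriv (theta1 τ) 0) *
    ∑ j : Fin M, (deriv (theta1 τ) (u j - 1 / 4) / theta1 τ (u j - 1 / 4) -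
      deriv (theta1 τ) (u j + 1 / 4) / theta1 τ (u j + 1 / 4))

/-- The two rectangles to which Bethe roots are restricted; together they form a fundamental
domain for the translations by `1` and by `τ`. -/
def rootDomain (τ : ℂ) : Set ℂ :=
  {u | (-(1 / 2) < u.re ∧ u.re ≤ 0 ∧ -(τ.im / 2) < u.im ∧ u.im ≤ τ.im / 2) ∨
    (0 < u.re ∧ u.re ≤ 1 / 2 ∧ -(τ.im / 2) ≤ u.im ∧ u.im < τ.im / 2)}

/-- Admissible numbers of kinks: `0 ≤ M ≤ N` with `M` of the same parity as `N / 2`. -/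
def Admissible (N M : ℕ) : Prop := M ≤ N ∧ M % 2 = (N / 2) % 2

/-- The labels of the Bethe states: an admissible number `M` of kinks, a sector `ξ ∈ {0, 1}`,
and an `M`-tuple of pairwise distinct Bethe roots of that sector, listed in increasing order
with respect to a fixed strict total order `lt` (so that each set of roots occurs once). -/
structure BetheLabel (N : ℕ) (τ : ℂ) (lt : ℂ → ℂ → Prop) where
  /-- the number of kinks -/
  M : ℕ
  /-- the sector, `0` or `1` -/
  ξ : Fin 2
  /-- the Bethe roots -/
  u : Fin M → ℂ
  admissible : Admissible N M
  ordered : ∀ i j : Fin M, i < j → lt (u i) (u j)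
  mem_domain : ∀ j, u j ∈ rootDomain τ
  bethe_eq : ∀ j, thetaRatio τ (u j) ^ N = (-1) ^ ((ξ : ℕ) + 1)

end XYChain

namespace XYChain

open Complex
open scoped ComplexConjugate

/-! ### Theta functions as bilateral series -/

/-! In the chiral basis the XY chain is a gas of free kinks on a ring. Since `ψ(k)` depends only on
`k` mod 4, `σˣ` fixes `ψ(k)` up to a phase for even `k` and turns it into `ψ(k + 2)` for odd `k`;
`σʸ` does the opposite. The labels along a chiral state alternate in parity, so each term of a bond
reverses exactly one of its two qubits (`bond_qubitProduct`). The qubit at `m` is reversed by its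
two bonds, and these contributions cancel unless exactly one of the sites `m - 1`, `m` carries a
kink; the reversal then moves that kink to the other site (`flip_coefficient`). Hence `H` preserves
the number of kinks, which hop between neighbours with alternating amplitudes `2 Jx`, `2 Jy`. A kink
crossing the boundary changes `κ` to `-κ`, permutes the kinks cyclically and produces `i ^ N`; these
signs combine to `(-1) ^ (ξ + 1)`, which is the Bethe equation (`hop_down`, `hop_up`). Slater
determinants of one-kink solutions are therefore eigenvectors with additive energies
(`sum_det_updateRow_mul`, `inner_chiralState_hamiltonianXY`).

The one-kink equation is a theta identity. With `x = u + 1/4` it becomes a linear relation between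
squares of theta functions (`theta_quadratic_three`, `theta_quadratic_four`), and `theta_wronskian`
turns the resulting energy into logarithmic derivatives. All these identities come from the
duplication formulas, which express products at modulus `τ` by theta functions at `2τ`; the same
formulas reduce the determination of the zeros of `θ₁` to large `Im τ`.

A Bethe root has `|θ₁(u + 1/4) / θ₁(u - 1/4)| = 1`, which forces `Re u ∈ {0, 1/2}`. On these two
segments the ratio is a bijection onto the unit circle (`thetaRatio_injOn`, `exists_thetaRatio_eq`),
so each sector has `N` roots. One-kink amplitudes of one sector are orthogonal
(`sum_conj_kinkAmplitude_mul`), Cauchy–Binet carries this over to determinants, and the sum over `κ`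
separates the sectors. Choosing subsets of roots of admissible size gives `2 * 2 ^ (N - 1) = 2 ^ N`
orthonormal vectors, the full dimension. -/

lemma theta3_eq_jacobi {τ : ℂ} (hτ : 0 < τ.im) (u : ℂ) : theta3 τ u = jacobiTheta₂ u τ := by
  have h := (hasSum_jacobiTheta₂_term u hτ).nat_add_neg
  -- Pairing `n` with `-n` counts the constant term twice; the pair at `n = 0` is split off, leaving
  -- the series over `n ≥ 1`.
  have h2 := (hasSum_nat_add_iff' 1).mpr h
  have h3 : ∀ n : ℕ, nomePow τ (((n : ℂ) + 1) ^ 2) * Complex.cos (2 * ((n : ℂ) + 1) * Real.pi * u)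
      = (1 / 2) * (jacobiTheta₂_term ((n + 1 : ℕ) : ℤ) u τ
        + jacobiTheta₂_term (-((n + 1 : ℕ) : ℤ)) u τ) := by
    intro n
    rw [Complex.cos, nomePow, jacobiTheta₂_term, jacobiTheta₂_term, div_eq_mul_inv, ← mul_assoc,
      mul_add, ← Complex.exp_add, ← Complex.exp_add, mul_comm, ← one_div]
    push_cast
    congr 3 <;> ring
  rw [theta3, tsum_congr h3, tsum_mul_left, h2.tsum_eq]
  simp [jacobiTheta₂_term]

lemma theta4_eq_theta3 (τ u : ℂ) : theta4 τ u = theta3 τ (u + 1 / 2) := by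
  rw [theta3, theta4]
  congr 3
  ext n
  have : Complex.cos (2 * ((n : ℂ) + 1) * Real.pi * (u + 1 / 2))
      = (-1) ^ (n + 1) * Complex.cos (2 * ((n : ℂ) + 1) * Real.pi * u) := by
    rw [show 2 * ((n : ℂ) + 1) * Real.pi * (u + 1 / 2)
      = 2 * ((n : ℂ) + 1) * Real.pi * u + ((n + 1 : ℕ) : ℂ) * Real.pi by push_cast; ring,
      Complex.cos_antiperiodic.add_nat_mul_eq]
  rw [this]; ring

lemma theta1_eq_theta2 (τ u : ℂ) : theta1 τ u = theta2 τ (u - 1 / 2) := by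
  rw [theta1, theta2]
  congr 2
  ext n
  have : Complex.cos ((2 * (n : ℂ) + 1) * Real.pi * (u - 1 / 2))
      = (-1) ^ n * Complex.sin ((2 * (n : ℂ) + 1) * Real.pi * u) := by
    rw [show (2 * (n : ℂ) + 1) * Real.pi * (u - 1 / 2)
      = (2 * (n : ℂ) + 1) * Real.pi * u - Real.pi / 2 - (n : ℂ) * Real.pi by ring,
      Complex.cos_antiperiodic.sub_nat_mul_eq, Complex.cos_sub_pi_div_two]
  rw [this]; ring

/-- `θ₂` as a bilateral series. -/
lemma hasSum_theta2 {τ : ℂ} (hτ : 0 < τ.im) (u : ℂ) :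
    HasSum (fun n : ℤ => cexp (Real.pi * I * τ * ((n : ℂ) + 1 / 2) ^ 2
      + Real.pi * I * (2 * (n : ℂ) + 1) * u)) (theta2 τ u) := by
  have h0 := (hasSum_jacobiTheta₂_term (u + τ / 2) hτ).mul_left
    (cexp (Real.pi * I * τ / 4 + Real.pi * I * u))
  have h1 : ∀ n : ℤ, cexp (Real.pi * I * τ / 4 + Real.pi * I * u)
      * jacobiTheta₂_term n (u + τ / 2) τ = cexp (Real.pi * I * τ * ((n : ℂ) + 1 / 2) ^ 2
      + Real.pi * I * (2 * (n : ℂ) + 1) * u) := by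
    intro n
    rw [jacobiTheta₂_term, ← Complex.exp_add]
    congr 1; ring
  simp only [h1] at h0
  have h := h0.nat_add_neg_add_one
  have h3 : ∀ n : ℕ, nomePow τ (((n : ℂ) + 1 / 2) ^ 2) *
      Complex.cos ((2 * (n : ℂ) + 1) * Real.pi * u)
      = (1 / 2) * (cexp (Real.pi * I * τ * (((n : ℤ) : ℂ) + 1 / 2) ^ 2
      + Real.pi * I * (2 * ((n : ℤ) : ℂ) + 1) * u)
        + cexp (Real.pi * I * τ * (((-(n + 1 : ℤ) : ℤ) : ℂ) + 1 / 2) ^ 2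
      + Real.pi * I * (2 * ((-(n + 1 : ℤ) : ℤ) : ℂ) + 1) * u)) := by
    intro n
    rw [Complex.cos, nomePow, mul_div_assoc', mul_add, ← Complex.exp_add, ← Complex.exp_add,
      div_eq_inv_mul, one_div (2 : ℂ)]
    push_cast
    congr 3 <;> ring
  have h4 : theta2 τ u = cexp (Real.pi * I * τ / 4 + Real.pi * I * u) *
      jacobiTheta₂ (u + τ / 2) τ := by
    rw [theta2, tsum_congr h3, tsum_mul_left, h.tsum_eq]
    ring
  rw [h4]
  exact h0

lemma theta2_eq_jacobi {τ : ℂ} (hτ : 0 < τ.im) (u : ℂ) :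
    theta2 τ u = cexp (Real.pi * I * τ / 4 + Real.pi * I * u) * jacobiTheta₂ (u + τ / 2) τ := by
  refine (hasSum_theta2 hτ u).unique ?_
  refine ((hasSum_jacobiTheta₂_term (u + τ / 2) hτ).mul_left
    (cexp (Real.pi * I * τ / 4 + Real.pi * I * u))).congr_fun fun n => ?_
  rw [jacobiTheta₂_term, ← Complex.exp_add]
  congr 1; ring

/-- The duplication identity `θ₃(a) θ₃(b) = Θ₃(a+b) Θ₃(a-b) + Θ₂(a+b) Θ₂(a-b)`, the right hand
side with the modulus `2τ`. -/
lemma theta3_mul_theta3 {τ : ℂ} (hτ : 0 < τ.im) (a b : ℂ) :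
    theta3 τ a * theta3 τ b = theta3 (2 * τ) (a + b) * theta3 (2 * τ) (a - b)
      + theta2 (2 * τ) (a + b) * theta2 (2 * τ) (a - b) := by
  have hτ2 : 0 < (2 * τ).im := by simpa using hτ
  have key {f g : ℤ → ℂ} {x y : ℂ} (hf : HasSum f x) (hg : HasSum g y) :
      HasSum (fun p : ℤ × ℤ => f p.1 * g p.2) (x * y) := by
    have := summable_mul_of_summable_norm hf.summable.norm hg.summable.norm
    rw [← hf.tsum_eq, ← hg.tsum_eq,
      tsum_mul_tsum_of_summable_norm hf.summable.norm hg.summable.norm]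
    exact this.hasSum
  have h3 := key (hasSum_jacobiTheta₂_term (a + b) hτ2) (hasSum_jacobiTheta₂_term (a - b) hτ2)
  have h2 := key (hasSum_theta2 hτ2 (a + b)) (hasSum_theta2 hτ2 (a - b))
  have h := key (hasSum_jacobiTheta₂_term a hτ) (hasSum_jacobiTheta₂_term b hτ)
  -- The lattice `ℤ²` splits according to the parity of `m + n`. In the rotated coordinates `m² +
  -- n²` is `2 (j² + k²)` on the even part and `2 ((j + 1/2)² + (k + 1/2)²)` on the odd part, which
  -- are the exponents of `θ₃` and `θ₂` at `2τ`.
  let e0 : ℤ × ℤ → ℤ × ℤ := fun p => (p.1 + p.2, p.1 - p.2)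
  let e1 : ℤ × ℤ → ℤ × ℤ := fun p => (p.1 + p.2 + 1, p.1 - p.2)
  have i0 : Function.Injective e0 := by
    rintro ⟨j, k⟩ ⟨j', k'⟩ hh
    simp only [e0, Prod.mk.injEq] at hh ⊢; omega
  have i1 : Function.Injective e1 := by
    rintro ⟨j, k⟩ ⟨j', k'⟩ hh
    simp only [e1, Prod.mk.injEq] at hh ⊢; omega
  have hc : IsCompl (Set.range e0) (Set.range e1) := by
    refine ⟨Set.disjoint_left.mpr ?_, codisjoint_iff.mpr (Set.eq_univ_iff_forall.mpr ?_)⟩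
    · rintro ⟨m, n⟩ ⟨⟨j, k⟩, h1⟩ ⟨⟨j', k'⟩, h2⟩
      simp only [e0, e1, Prod.mk.injEq] at h1 h2
      omega
    · rintro ⟨m, n⟩
      rcases Int.even_or_odd (m + n) with ⟨c, hc⟩ | ⟨c, hc⟩
      · left; refine ⟨(c, m - c), ?_⟩
        simp only [e0, Prod.mk.injEq]; omega
      · right; refine ⟨(c, m - c - 1), ?_⟩
        simp only [e1, Prod.mk.injEq]; omega
  rw [theta3_eq_jacobi hτ, theta3_eq_jacobi hτ, theta3_eq_jacobi hτ2, theta3_eq_jacobi hτ2]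
  have hA : HasSum ((fun p : ℤ × ℤ => jacobiTheta₂_term p.1 a τ * jacobiTheta₂_term p.2 b τ) ∘ e0)
      (jacobiTheta₂ (a + b) (2 * τ) * jacobiTheta₂ (a - b) (2 * τ)) := by
    refine h3.congr_fun fun p => ?_
    simp only [e0, jacobiTheta₂_term, ← Complex.exp_add, Function.comp]
    congr 1; push_cast; ring
  have hB : HasSum ((fun p : ℤ × ℤ => jacobiTheta₂_term p.1 a τ * jacobiTheta₂_term p.2 b τ) ∘ e1)
      (theta2 (2 * τ) (a + b) * theta2 (2 * τ) (a - b)) := by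
    refine h2.congr_fun fun p => ?_
    simp only [e1, jacobiTheta₂_term, ← Complex.exp_add, Function.comp]
    congr 1; push_cast; ring
  exact h.unique (HasSum.add_isCompl hc (i0.hasSum_range_iff.mpr hA) (i1.hasSum_range_iff.mpr hB))

/-! ### Symmetries and quasi-periodicity -/

lemma theta3_add_one (τ u : ℂ) : theta3 τ (u + 1) = theta3 τ u := by
  rw [theta3, theta3]
  congr 3
  ext n
  rw [show 2 * ((n : ℂ) + 1) * Real.pi * (u + 1)
      = 2 * ((n : ℂ) + 1) * Real.pi * u + ((n + 1 : ℕ) : ℂ) * (2 * Real.pi) by push_cast; ring,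
      Complex.cos_periodic.nat_mul (n + 1) _]

lemma theta3_neg (τ u : ℂ) : theta3 τ (-u) = theta3 τ u := by
  simp [theta3]

lemma theta1_neg (τ u : ℂ) : theta1 τ (-u) = -theta1 τ u := by
  simp [theta1, tsum_neg]

lemma theta1_zero (τ : ℂ) : theta1 τ 0 = 0 := by
  simp [theta1]

lemma theta4_neg (τ u : ℂ) : theta4 τ (-u) = theta4 τ u := by
  simp [theta4]

lemma theta2_add_one (τ u : ℂ) : theta2 τ (u + 1) = -theta2 τ u := by
  rw [theta2, theta2, ← mul_neg, ← tsum_neg]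
  congr 2
  ext n
  rw [show (2 * (n : ℂ) + 1) * Real.pi * (u + 1)
      = (2 * (n : ℂ) + 1) * Real.pi * u + ((2 * n + 1 : ℕ) : ℂ) * Real.pi by push_cast; ring,
      Complex.cos_antiperiodic.add_nat_mul_eq, Odd.neg_one_pow ⟨n, rfl⟩]
  ring

lemma theta2_add_half (τ u : ℂ) : theta2 τ (u + 1 / 2) = -theta1 τ u := by
  rw [theta1_eq_theta2, ← theta2_add_one]; congr 1; ring

lemma theta2_sub_half (τ u : ℂ) : theta2 τ (u - 1 / 2) = theta1 τ u := (theta1_eq_theta2 τ u).symm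

lemma theta1_add_half (τ u : ℂ) : theta1 τ (u + 1 / 2) = theta2 τ u := by
  rw [theta1_eq_theta2]; congr 1; ring

lemma theta1_sub_half (τ u : ℂ) : theta1 τ (u - 1 / 2) = -theta2 τ u := by
  rw [theta1_eq_theta2, ← neg_eq_iff_eq_neg.mpr (theta2_add_one τ (u - 1 / 2 - 1 / 2))]
  congr 2; ring

lemma theta1_add_one (τ u : ℂ) : theta1 τ (u + 1) = -theta1 τ u := by
  rw [theta1_eq_theta2, theta1_eq_theta2, ← theta2_add_one]; congr 1; ring

lemma theta3_add_half (τ u : ℂ) : theta3 τ (u + 1 / 2) = theta4 τ u := (theta4_eq_theta3 τ u).symm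

lemma theta3_sub_half (τ u : ℂ) : theta3 τ (u - 1 / 2) = theta4 τ u := by
  rw [theta4_eq_theta3, ← theta3_add_one τ (u - 1 / 2)]; congr 1; ring

lemma theta4_add_half (τ u : ℂ) : theta4 τ (u + 1 / 2) = theta3 τ u := by
  rw [theta4_eq_theta3, ← theta3_add_one τ u]; congr 1; ring

section quasi
variable {τ : ℂ} (hτ : 0 < τ.im)
include hτ

lemma theta3_add_half_tau (u : ℂ) :
    theta3 τ (u + τ / 2) = cexp (-(Real.pi * I * τ / 4) - Real.pi * I * u) * theta2 τ u := by
  rw [theta2_eq_jacobi hτ, theta3_eq_jacobi hτ, ← mul_assoc, ← Complex.exp_add]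
  ring_nf; simp

lemma theta2_add_half_tau (u : ℂ) :
    theta2 τ (u + τ / 2) = cexp (-(Real.pi * I * τ / 4) - Real.pi * I * u) * theta3 τ u := by
  rw [theta2_eq_jacobi hτ, theta3_eq_jacobi hτ, show u + τ / 2 + τ / 2 = u + τ by ring,
    jacobiTheta₂_add_left', ← mul_assoc, ← Complex.exp_add]
  congr 2; ring

lemma theta1_add_half_tau (u : ℂ) : theta1 τ (u + τ / 2)
    = cexp (-(Real.pi * I * τ / 4) - Real.pi * I * (u - 1 / 2)) * theta4 τ u := by
  rw [theta1_eq_theta2, ← theta3_sub_half, ← theta2_add_half_tau hτ]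
  congr 1; ring

lemma theta4_add_half_tau (u : ℂ) : theta4 τ (u + τ / 2)
    = cexp (-(Real.pi * I * τ / 4) - Real.pi * I * (u - 1 / 2)) * theta1 τ u := by
  rw [← theta3_sub_half, ← theta2_sub_half, ← theta3_add_half_tau hτ]
  congr 1; ring

lemma theta1_add_tau (u : ℂ) : ∃ c : ℂ, c ≠ 0 ∧ theta1 τ (u + τ) = c * theta1 τ u := by
  have h := theta1_add_half_tau hτ (u + τ / 2)
  rw [theta4_add_half_tau hτ, ← mul_assoc, add_assoc, add_halves] at h
  exact ⟨_, mul_ne_zero (exp_ne_zero _) (exp_ne_zero _), h⟩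

/-! ### Duplication identities -/

/-- Shifting both arguments by `τ/2` turns `θ₃` into `θ₂` on the left; the sum of the arguments
moves by `τ`, a half period of the modulus `2τ`, which swaps `θ₂` and `θ₃` in the first factors on
the right. -/
lemma theta2_mul_theta2 (a b : ℂ) :
    theta2 τ a * theta2 τ b = theta2 (2 * τ) (a + b) * theta3 (2 * τ) (a - b)
      + theta3 (2 * τ) (a + b) * theta2 (2 * τ) (a - b) := by
  have hτ2 : 0 < (2 * τ).im := by simpa using hτ
  have h := theta3_mul_theta3 hτ (a + τ / 2) (b + τ / 2)
  rw [theta3_add_half_tau hτ, theta3_add_half_tau hτ,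
    show a + τ / 2 + (b + τ / 2) = a + b + 2 * τ / 2 by ring,
    show a + τ / 2 - (b + τ / 2) = a - b by ring,
    theta3_add_half_tau hτ2, theta2_add_half_tau hτ2] at h
  have e : cexp (-(Real.pi * I * τ / 4) - Real.pi * I * a)
      * cexp (-(Real.pi * I * τ / 4) - Real.pi * I * b)
      = cexp (-(Real.pi * I * (2 * τ) / 4) - Real.pi * I * (a + b)) := by
    rw [← Complex.exp_add]; congr 1; ring
  apply mul_left_cancel₀ (exp_ne_zero (-(Real.pi * I * (2 * τ) / 4) - Real.pi * I * (a + b)))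
  linear_combination h - theta2 τ a * theta2 τ b * e

lemma theta1_mul_theta2 (a b : ℂ) :
    theta1 τ a * theta2 τ b = theta1 (2 * τ) (a + b) * theta4 (2 * τ) (a - b)
      + theta4 (2 * τ) (a + b) * theta1 (2 * τ) (a - b) := by
  rw [theta1_eq_theta2, theta2_mul_theta2 hτ, show a - 1 / 2 + b = a + b - 1 / 2 by ring,
    show a - 1 / 2 - b = a - b - 1 / 2 by ring]
  simp only [theta2_sub_half, theta3_sub_half]

lemma theta1_mul_theta1 (a b : ℂ) :
    theta1 τ a * theta1 τ b = theta3 (2 * τ) (a + b) * theta2 (2 * τ) (a - b)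
      - theta2 (2 * τ) (a + b) * theta3 (2 * τ) (a - b) := by
  rw [theta1_eq_theta2, theta1_eq_theta2, theta2_mul_theta2 hτ,
    show a - 1 / 2 + (b - 1 / 2) = a + b - 1 / 2 - 1 / 2 by ring,
    show a - 1 / 2 - (b - 1 / 2) = a - b by ring]
  simp only [theta2_sub_half, theta3_sub_half, theta1_sub_half]
  rw [← theta3_add_half, sub_add_cancel]; ring

lemma theta3_mul_theta4 (a b : ℂ) :
    theta3 τ a * theta4 τ b = theta4 (2 * τ) (a + b) * theta4 (2 * τ) (a - b)
      - theta1 (2 * τ) (a + b) * theta1 (2 * τ) (a - b) := by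
  rw [theta4_eq_theta3, theta3_mul_theta3 hτ, ← add_assoc, ← sub_sub]
  simp only [theta2_sub_half, theta3_sub_half, theta2_add_half, theta3_add_half]
  ring

lemma theta4_mul_theta4 (a b : ℂ) :
    theta4 τ a * theta4 τ b = theta3 (2 * τ) (a + b) * theta3 (2 * τ) (a - b)
      - theta2 (2 * τ) (a + b) * theta2 (2 * τ) (a - b) := by
  rw [theta4_eq_theta3, theta4_eq_theta3, theta3_mul_theta3 hτ,
    show a + 1 / 2 + (b + 1 / 2) = a + b + 1 by ring, add_sub_add_right_eq_sub,
    theta3_add_one, theta2_add_one]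
  ring

/-! ### Zeros -/

lemma theta1_add_int_mul_tau_eq_zero_iff (u : ℂ) (b : ℤ) :
    theta1 τ (u + b * τ) = 0 ↔ theta1 τ u = 0 := by
  have step : ∀ v, theta1 τ (v + τ) = 0 ↔ theta1 τ v = 0 := by
    intro v
    obtain ⟨c, hc, h⟩ := theta1_add_tau hτ v
    rw [h, mul_eq_zero, or_iff_right hc]
  induction b using Int.induction_on with
  | zero => simp
  | succ i ih =>
    refine Iff.trans ?_ ih
    rw [← step (u + ((i : ℤ) : ℂ) * τ), add_assoc, ← add_one_mul]; push_cast; rfl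
  | pred i ih =>
    refine Iff.trans ?_ ih
    rw [← step, add_assoc, ← add_one_mul]; push_cast; rw [sub_add_cancel]

end quasi

lemma norm_cos_le_exp_abs_im (z : ℂ) : ‖Complex.cos z‖ ≤ Real.exp |z.im| := by
  rw [Complex.cos, norm_div, Complex.norm_ofNat, div_le_iff₀ two_pos]
  refine (norm_add_le _ _).trans ?_
  rw [Complex.norm_exp, Complex.norm_exp, mul_two]
  gcongr <;> simp [neg_le_abs, le_abs_self]

/-- The factor `‖sin z‖` is what matters: every term of the series of `θ₁` is then bounded by a
multiple of the first term, even near its zeros. The recursion is `sin((2n+3)z) = sin((2n+1)z) + 2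
cos((2n+2)z) sin z`. -/
lemma norm_sin_odd_mul_le (z : ℂ) (n : ℕ) :
    ‖Complex.sin ((2 * n + 1) * z)‖ ≤ ‖Complex.sin z‖ * ((2 * n + 1) * Real.exp (2 * n * |z.im|)) := by
  induction n with
  | zero => simp
  | succ n ih =>
    have h : Complex.sin ((2 * ((n + 1 : ℕ) : ℂ) + 1) * z) = Complex.sin ((2 * n + 1) * z)
        + 2 * Complex.cos ((2 * (n + 1)) * z) * Complex.sin z := by
      rw [show (2 * ((n + 1 : ℕ) : ℂ) + 1) * z = (2 * (n + 1)) * z + z by push_cast; ring,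
        show (2 * (n : ℂ) + 1) * z = (2 * (n + 1)) * z - z by ring, Complex.sin_add,
        Complex.sin_sub]
      ring
    have hc : ‖Complex.cos ((2 * ((n : ℂ) + 1)) * z)‖ ≤ Real.exp (2 * (n + 1) * |z.im|) := by
      refine (norm_cos_le_exp_abs_im _).trans (Real.exp_le_exp.mpr (le_of_eq ?_))
      have : ((2 * ((n : ℂ) + 1)) * z).im = (2 * (n + 1)) * z.im := by
        simp
      rw [this, abs_mul, abs_of_nonneg (by positivity)]
    have he : Real.exp (2 * n * |z.im|) ≤ Real.exp (2 * (n + 1) * |z.im|) := by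
      gcongr; linarith
    rw [h]
    refine (norm_add_le _ _).trans ?_
    rw [norm_mul, norm_mul, Complex.norm_ofNat]
    push_cast
    have := norm_nonneg (Complex.sin z)
    have h1 : ‖Complex.sin z‖ * ((2 * n + 1) * Real.exp (2 * n * |z.im|)) ≤
       ‖Complex.sin z‖ * ((2 * n + 1) * Real.exp (2 * (n + 1) * |z.im|)) := by gcongr
    have h2 : 2 * ‖Complex.cos ((2 * ((n : ℂ) + 1)) * z)‖ * ‖Complex.sin z‖ ≤
      2 * Real.exp (2 * (n + 1) * |z.im|) * ‖Complex.sin z‖ := by gcongr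
    linarith

/-- For `r < 1/2` the tail is at most `‖f 0‖ r / (1 - r)`, which is smaller than a nonzero first
term and cannot cancel it. -/
lemma eq_zero_of_tsum_eq_zero_of_geometric_bound {f : ℕ → ℂ} {r : ℝ} (hr0 : 0 ≤ r) (hr : r < 1 / 2)
    (hf : ∀ n, ‖f n‖ ≤ ‖f 0‖ * r ^ n) (h : ∑' n, f n = 0) : f 0 = 0 := by
  have hg := (hasSum_geometric_of_lt_one hr0 (by linarith)).mul_left ‖f 0‖
  have hs : Summable f := Summable.of_norm_bounded hg.summable hf
  rw [hs.tsum_eq_zero_add] at h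
  have hb : ‖∑' n, f (n + 1)‖ ≤ ‖f 0‖ * r * (1 - r)⁻¹ := by
    refine tsum_of_norm_bounded
      ((hasSum_geometric_of_lt_one hr0 (by linarith)).mul_left (‖f 0‖ * r)) fun n => ?_
    refine (hf _).trans (le_of_eq ?_); ring
  rw [eq_neg_of_add_eq_zero_right h, norm_neg] at hb
  by_contra hne
  have hp : 0 < ‖f 0‖ := norm_pos_iff.mpr hne
  have : r * (1 - r)⁻¹ < 1 := by
    rw [← div_eq_mul_inv, div_lt_one (by linarith)]; linarith
  nlinarith

/-- Relative to the first term, the `n`-th term carries `exp(-π Im τ (n² + n))`, against a growth of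
at most `(2n + 1) exp(n π Im τ)` in the strip. With `2n + 1 ≤ 3 ^ n` and `n ≤ n²`, the first term
dominates geometrically with ratio `3 exp(-π Im τ)`, so `sin(πw)` must vanish. -/
lemma theta1_eq_zero_of_strip {τ : ℂ} (hτ : 1 ≤ τ.im) {w : ℂ} (hw : |w.im| ≤ τ.im / 2)
    (h : theta1 τ w = 0) : ∃ a : ℤ, w = a := by
  have hz : nomePow τ (((0 : ℕ) + 1 / 2 : ℂ) ^ 2) * Complex.sin (Real.pi * w) = 0 := by
    have hr : 3 * Real.exp (-(Real.pi * τ.im)) < 1 / 2 := by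
      have h1 : (8 : ℝ) ≤ Real.exp (Real.pi * τ.im) := by
        have : (2 : ℝ) ≤ Real.exp 1 := by
          have := Real.add_one_le_exp (1 : ℝ); linarith
        calc (8 : ℝ) = 2 ^ 3 := by norm_num
          _ ≤ Real.exp 1 ^ 3 := by gcongr
          _ = Real.exp 3 := by rw [← Real.exp_nat_mul]; norm_num
          _ ≤ _ := by gcongr; nlinarith [Real.pi_gt_three]
      rw [Real.exp_neg]
      have : (Real.exp (Real.pi * τ.im))⁻¹ ≤ 8⁻¹ := by gcongr
      linarith
    have := eq_zero_of_tsum_eq_zero_of_geometric_bound (f := fun n : ℕ => (-1) ^ n * nomePow τ (((n : ℂ) + 1 / 2) ^ 2) *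
      Complex.sin ((2 * (n : ℂ) + 1) * Real.pi * w)) (by positivity) hr ?_ ?_
    · simpa using this
    · intro n
      have hn : ‖nomePow τ (((n : ℂ) + 1 / 2) ^ 2)‖
          = ‖nomePow τ ((((0 : ℕ) : ℂ) + 1 / 2) ^ 2)‖ * Real.exp (-(Real.pi * τ.im * (n ^ 2 + n))) := by
        rw [nomePow, nomePow, Complex.norm_exp, Complex.norm_exp, ← Real.exp_add]
        congr 1
        have e1 : ∀ y : ℝ, (I * Real.pi * τ * ((y : ℂ) + 1 / 2) ^ 2).re
            = -(Real.pi * τ.im * (y + 1 / 2) ^ 2) := by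
          intro y
          rw [show I * Real.pi * τ * ((y : ℂ) + 1 / 2) ^ 2
            = ((Real.pi * (y + 1 / 2) ^ 2 : ℝ) : ℂ) * (I * τ) by push_cast; ring,
            Complex.re_ofReal_mul]
          simp; ring
        have e2 := e1 n
        have e3 := e1 0
        push_cast at e2 e3 ⊢
        rw [e2, e3]; ring
      have hs := norm_sin_odd_mul_le (Real.pi * w) n
      have him : |(Real.pi * w : ℂ).im| ≤ Real.pi * (τ.im / 2) := by
        rw [Complex.im_ofReal_mul, abs_mul, abs_of_pos Real.pi_pos]
        gcongr
      have hb : (2 * n + 1 : ℝ) ≤ 3 ^ n := by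
        have := one_add_mul_le_pow (a := (2 : ℝ)) (by norm_num) n
        norm_num at this; linarith
      have hexp : Real.exp (-(Real.pi * τ.im * (n ^ 2 + n))) *
          Real.exp (2 * n * |(Real.pi * w : ℂ).im|) ≤ Real.exp (-(Real.pi * τ.im)) ^ n := by
        rw [← Real.exp_add, ← Real.exp_nat_mul, Real.exp_le_exp]
        have : (n : ℝ) ≤ n ^ 2 := by exact_mod_cast Nat.le_self_pow two_ne_zero n
        have h2 : 2 * n * |(Real.pi * w : ℂ).im| ≤ 2 * n * (Real.pi * (τ.im / 2)) := by gcongr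
        have h3 : 0 < Real.pi * τ.im := by have := Real.pi_pos; positivity
        nlinarith
      simp only [norm_mul, norm_pow, norm_neg, norm_one, one_pow, one_mul]
      rw [hn]
      simp only [Nat.cast_zero, mul_zero, zero_add, one_mul, mul_assoc] at hs ⊢
      calc _ ≤ ‖nomePow τ ((1 / 2) ^ 2)‖ * (Real.exp (-(Real.pi * (τ.im * (n ^ 2 + n)))) *
            (‖Complex.sin (Real.pi * w)‖ * ((2 * n + 1) * Real.exp (2 * (n * |(Real.pi * w : ℂ).im|))))) := by
              gcongr
        _ = ‖nomePow τ ((1 / 2) ^ 2)‖ * (‖Complex.sin (Real.pi * w)‖ * ((2 * n + 1) *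
             (Real.exp (-(Real.pi * τ.im * (n ^ 2 + n))) * Real.exp (2 * n * |(Real.pi * w : ℂ).im|)))) := by
              simp only [mul_assoc]; ring
        _ ≤ ‖nomePow τ ((1 / 2) ^ 2)‖ * (‖Complex.sin (Real.pi * w)‖ * (3 ^ n *
             Real.exp (-(Real.pi * τ.im)) ^ n)) := by gcongr
        _ = _ := by rw [mul_pow]
    · rw [theta1] at h
      simpa using h
  rw [mul_eq_zero, or_iff_right (by exact exp_ne_zero _), Complex.sin_eq_zero_iff] at hz
  obtain ⟨k, hk⟩ := hz
  refine ⟨k, ?_⟩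
  have : (Real.pi : ℂ) ≠ 0 := by exact_mod_cast Real.pi_ne_zero
  apply mul_left_cancel₀ this
  rw [hk]; ring

lemma exists_int_of_theta1_eq_zero_of_one_le {τ : ℂ} (hτ : 1 ≤ τ.im) {w : ℂ}
    (h : theta1 τ w = 0) : ∃ a b : ℤ, w = a + b * τ := by
  have hτ0 : 0 < τ.im := by linarith
  set b := round (w.im / τ.im) with hb
  have h1 : |w.im / τ.im - b| ≤ 1 / 2 := abs_sub_round _
  obtain ⟨a, ha⟩ := theta1_eq_zero_of_strip hτ (w := w - b * τ) (by
    have : (w - b * τ).im = (w.im / τ.im - b) * τ.im := by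
      simp; field_simp
    rw [this, abs_mul, abs_of_pos hτ0]
    nlinarith) (by
    rw [← theta1_add_int_mul_tau_eq_zero_iff hτ0 _ b, sub_add_cancel]; exact h)
  exact ⟨a, b, by rw [← ha]; ring⟩

lemma int_add_int_mul_tau_inj {τ : ℂ} (hτ : 0 < τ.im) {a b c d : ℝ}
    (h : (a : ℂ) + b * τ = c + d * τ) : a = c ∧ b = d := by
  have hi := congrArg Complex.im h
  have hr := congrArg Complex.re h
  simp at hi hr
  have : b = d := by rcases hi with h | h; exacts [h, absurd h hτ.ne']
  subst this
  exact ⟨by linarith, rfl⟩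

/-- The zeros of `θ₁` are the points of the lattice `ℤ + ℤ τ`. -/
lemma exists_int_of_theta1_eq_zero {τ : ℂ} (hτ : 0 < τ.im) {w : ℂ}
    (h : theta1 τ w = 0) : ∃ a b : ℤ, w = a + b * τ := by
  -- Induction on the number of doublings of the modulus that bring its imaginary part up to `1`.
  have key : ∀ k : ℕ, ∀ σ : ℂ, 0 < σ.im → 1 ≤ 2 ^ k * σ.im → ∀ w, theta1 σ w = 0 →
      ∃ a b : ℤ, w = a + b * σ := by
    intro k
    induction k with
    | zero => intro σ _ h1 w hw; exact exists_int_of_theta1_eq_zero_of_one_le (by simpa using h1) hw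
    | succ k ih =>
      intro σ hσ h1 w hw
      have hσ2 : 0 < (2 * σ).im := by simpa using hσ
      replace ih := ih (2 * σ) hσ2 (by rw [pow_succ] at h1; simp; linarith)
      have half : ∀ a b : ℤ, (1 / 2 : ℂ) ≠ a + b * (2 * σ) := by
        intro a b hab
        have := (int_add_int_mul_tau_inj hσ (a := 1 / 2) (b := 0) (c := a) (d := 2 * b)
          (by push_cast; rw [hab]; ring)).1
        have h2 : ((2 * a : ℤ) : ℝ) = ((1 : ℤ) : ℝ) := by push_cast; linarith
        have := Int.cast_injective h2
        omega
      have tau : ∀ (c : ℝ) (a b : ℤ), c + σ ≠ a + b * (2 * σ) := by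
        intro c a b hab
        have := (int_add_int_mul_tau_inj hσ (a := c) (b := 1) (c := a) (d := 2 * b)
          (by push_cast; rw [one_mul, hab]; ring)).2
        have h2 : ((2 * b : ℤ) : ℝ) = ((1 : ℤ) : ℝ) := by push_cast; linarith
        have := Int.cast_injective h2
        omega
      have h40 : theta4 (2 * σ) 0 ≠ 0 := by
        intro h0
        have := theta1_add_half_tau hσ2 0
        rw [h0, mul_zero] at this
        obtain ⟨a, b, hab⟩ := ih _ this
        exact tau 0 a b (by rw [← hab]; push_cast; ring)
      have h20 : theta2 (2 * σ) 0 ≠ 0 := by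
        intro h0
        rw [← theta1_add_half] at h0
        obtain ⟨a, b, hab⟩ := ih _ h0
        exact half a b (by rw [← hab]; ring)
      have h30 : theta3 (2 * σ) 0 ≠ 0 := by
        intro h0
        have := theta2_add_half_tau hσ2 0
        rw [h0, mul_zero, ← theta1_add_half] at this
        obtain ⟨a, b, hab⟩ := ih _ this
        exact tau (1 / 2) a b (by rw [← hab]; push_cast; ring)
      have h20' : theta2 σ 0 ≠ 0 := by
        intro h0
        have := theta2_mul_theta2 hσ 0 0
        rw [h0] at this
        simp only [add_zero, sub_zero, zero_mul] at this
        have h3 := mul_ne_zero h20 h30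
        apply h3
        linear_combination -(1 / 2 : ℂ) * this
      -- Duplication reads `θ₁(w) θ₂(w) = θ₁(2w | 2σ) θ₄(0 | 2σ)`, so `2w` is a zero at modulus
      -- `2σ`. This gives `w = a/2 + bσ`; odd `a` belongs to the zeros of `θ₂` and is excluded
      -- because `θ₁(1/2) = θ₂(0) ≠ 0`.
      have hd := theta1_mul_theta2 hσ w w
      rw [hw, sub_self, theta1_zero, zero_mul, mul_zero, add_zero, eq_comm, mul_eq_zero,
        or_iff_left h40] at hd
      obtain ⟨a, b, hab⟩ := ih _ hd
      rcases Int.even_or_odd' a with ⟨c, rfl | rfl⟩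
      · exact ⟨c, b, by push_cast at hab; linear_combination hab / 2⟩
      · exfalso
        have e : w = ((1 / 2 : ℂ) + c) + b * σ := by push_cast at hab; linear_combination hab / 2
        rw [e, theta1_add_int_mul_tau_eq_zero_iff hσ] at hw
        have step : ∀ v, theta1 σ (v + 1) = 0 ↔ theta1 σ v = 0 := fun v => by
          rw [theta1_add_one, neg_eq_zero]
        have : ∀ c : ℤ, theta1 σ (1 / 2 + c) = 0 → theta1 σ (1 / 2) = 0 := by
          intro c
          induction c using Int.induction_on with
          | zero => simp
          | succ i ih => intro h; apply ih; rw [← step]; rw [← h]; push_cast; ring_nf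
          | pred i ih => intro h; apply ih; rw [← step] at h; rw [← h]; push_cast; ring_nf
        have := this c hw
        rw [← zero_add (1 / 2 : ℂ), theta1_add_half] at this
        exact h20' this
  obtain ⟨k, hk⟩ := pow_unbounded_of_one_lt (1 / τ.im) one_lt_two
  refine key k τ hτ ?_ w h
  rw [div_lt_iff₀ hτ] at hk
  exact hk.le

lemma exists_int_of_theta2_eq_zero {τ : ℂ} (hτ : 0 < τ.im) {w : ℂ}
    (h : theta2 τ w = 0) : ∃ a b : ℤ, w = a + 1 / 2 + b * τ := by
  rw [← theta1_add_half] at h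
  obtain ⟨a, b, hab⟩ := exists_int_of_theta1_eq_zero hτ h
  exact ⟨a - 1, b, by push_cast; linear_combination hab⟩

lemma exists_int_of_theta4_eq_zero {τ : ℂ} (hτ : 0 < τ.im) {w : ℂ}
    (h : theta4 τ w = 0) : ∃ a b : ℤ, w = a + (b + 1 / 2) * τ := by
  have h1 := theta1_add_half_tau hτ w
  rw [h, mul_zero] at h1
  obtain ⟨a, b, hab⟩ := exists_int_of_theta1_eq_zero hτ h1
  exact ⟨a, b - 1, by push_cast; linear_combination hab⟩

lemma exists_int_of_theta3_eq_zero {τ : ℂ} (hτ : 0 < τ.im) {w : ℂ}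
    (h : theta3 τ w = 0) : ∃ a b : ℤ, w = a + 1 / 2 + (b + 1 / 2) * τ := by
  rw [← theta4_add_half] at h
  obtain ⟨a, b, hab⟩ := exists_int_of_theta4_eq_zero hτ h
  exact ⟨a - 1, b, by push_cast; linear_combination hab⟩

/-! ### Quadratic identities and the Wronskian -/

section quadratic
variable {τ : ℂ} (hτ : 0 < τ.im)
include hτ

lemma theta3_zero_ne_zero : theta3 τ 0 ≠ 0 := fun h => by
  obtain ⟨a, b, hab⟩ := exists_int_of_theta3_eq_zero hτ h
  have := (int_add_int_mul_tau_inj hτ (a := 0) (b := 0) (c := a + 1 / 2) (d := b + 1 / 2)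
    (by push_cast; rw [← hab]; ring)).2
  have h2 : ((2 * b + 1 : ℤ) : ℝ) = ((0 : ℤ) : ℝ) := by push_cast; linarith
  have := Int.cast_injective h2
  omega

lemma theta4_zero_ne_zero : theta4 τ 0 ≠ 0 := fun h => by
  obtain ⟨a, b, hab⟩ := exists_int_of_theta4_eq_zero hτ h
  have := (int_add_int_mul_tau_inj hτ (a := 0) (b := 0) (c := a) (d := b + 1 / 2)
    (by push_cast; rw [← hab]; ring)).2
  have h2 : ((2 * b + 1 : ℤ) : ℝ) = ((0 : ℤ) : ℝ) := by push_cast; linarith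
  have := Int.cast_injective h2
  omega

lemma theta2_zero_ne_zero : theta2 τ 0 ≠ 0 := fun h => by
  obtain ⟨a, b, hab⟩ := exists_int_of_theta2_eq_zero hτ h
  have := (int_add_int_mul_tau_inj hτ (a := 0) (b := 0) (c := a + 1 / 2) (d := b)
    (by push_cast; rw [← hab]; ring)).1
  have h2 : ((2 * a + 1 : ℤ) : ℝ) = ((0 : ℤ) : ℝ) := by push_cast; linarith
  have := Int.cast_injective h2
  omega

/-- By duplication each square at `x` is a combination of `θ₂(2x | 2τ)` and `θ₃(2x | 2τ)`, with
coefficients `θ₂(0 | 2τ)` and `θ₃(0 | 2τ)`. The squares at `x` thus lie in a two-dimensional space,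
and the relation is checked there. -/
lemma theta_quadratic_three (x : ℂ) :
    theta3 τ 0 ^ 2 * theta2 τ x ^ 2 + theta4 τ 0 ^ 2 * theta1 τ x ^ 2
      = theta2 τ 0 ^ 2 * theta3 τ x ^ 2 := by
  simp only [sq, theta3_mul_theta3 hτ, theta2_mul_theta2 hτ, theta1_mul_theta1 hτ,
    theta4_mul_theta4 hτ, sub_self, add_zero]
  ring

lemma theta_quadratic_four (x : ℂ) :
    theta4 τ 0 ^ 2 * theta2 τ x ^ 2 + theta3 τ 0 ^ 2 * theta1 τ x ^ 2
      = theta2 τ 0 ^ 2 * theta4 τ x ^ 2 := by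
  simp only [sq, theta3_mul_theta3 hτ, theta2_mul_theta2 hτ, theta1_mul_theta1 hτ,
    theta4_mul_theta4 hτ, sub_self, add_zero]
  ring

lemma theta1_theta2_antisymm (x y : ℂ) :
    theta1 τ x * theta2 τ y - theta1 τ y * theta2 τ x
      = 2 * theta4 (2 * τ) (x + y) * theta1 (2 * τ) (x - y) := by
  rw [theta1_mul_theta2 hτ, theta1_mul_theta2 hτ, add_comm y x, ← neg_sub x y, theta1_neg,
    theta4_neg]
  ring

lemma differentiable_theta3 : Differentiable ℂ (theta3 τ) := by
  rw [funext (theta3_eq_jacobi hτ)]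
  exact fun z => differentiableAt_jacobiTheta₂_fst z hτ

lemma differentiable_theta2 : Differentiable ℂ (theta2 τ) := by
  rw [funext (theta2_eq_jacobi hτ)]
  have : Differentiable ℂ (fun z => jacobiTheta₂ z τ) :=
    fun z => differentiableAt_jacobiTheta₂_fst z hτ
  fun_prop

lemma differentiable_theta1 : Differentiable ℂ (theta1 τ) := by
  rw [funext (theta1_eq_theta2 τ)]
  have := differentiable_theta2 hτ
  fun_prop

/-- Infinitesimal form of `theta1_theta2_antisymm`: take the arguments `x + h`, `x - h` and
differentiate at `h = 0`. -/
lemma theta_wronskian_two_mul (x : ℂ) :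
    deriv (theta1 τ) x * theta2 τ x - theta1 τ x * deriv (theta2 τ) x
      = 2 * theta4 (2 * τ) (2 * x) * deriv (theta1 (2 * τ)) 0 := by
  have hτ2 : 0 < (2 * τ).im := by simpa using hτ
  have d1 : ∀ z, HasDerivAt (theta1 τ) (deriv (theta1 τ) z) z :=
    fun z => (differentiable_theta1 hτ z).hasDerivAt
  have d2 : ∀ z, HasDerivAt (theta2 τ) (deriv (theta2 τ) z) z :=
    fun z => (differentiable_theta2 hτ z).hasDerivAt
  have d3 : HasDerivAt (theta1 (2 * τ)) (deriv (theta1 (2 * τ)) 0) (2 * 0) := by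
    rw [mul_zero]; exact (differentiable_theta1 hτ2 0).hasDerivAt
  have p : ∀ (f : ℂ → ℂ) (f' : ℂ), HasDerivAt f f' x → HasDerivAt (fun h => f (x + h)) f' 0 :=
    fun f f' hf => HasDerivAt.comp_const_add x 0 (by rwa [add_zero])
  have m : ∀ (f : ℂ → ℂ) (f' : ℂ), HasDerivAt f f' x → HasDerivAt (fun h => f (x - h)) (-f') 0 :=
    fun f f' hf => HasDerivAt.comp_const_sub x 0 (by rwa [sub_zero])
  have l := ((p _ _ (d1 x)).mul (m _ _ (d2 x))).sub ((m _ _ (d1 x)).mul (p _ _ (d2 x)))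
  have r : HasDerivAt (fun h : ℂ => 2 * theta4 (2 * τ) (2 * x) * theta1 (2 * τ) (2 * h))
      (2 * theta4 (2 * τ) (2 * x) * (deriv (theta1 (2 * τ)) 0 * (2 * 1))) 0 :=
    (HasDerivAt.comp (h₂ := theta1 (2 * τ)) (0 : ℂ) d3 ((hasDerivAt_id (0 : ℂ)).const_mul 2)).const_mul _
  have e : (fun h : ℂ => 2 * theta4 (2 * τ) (2 * x) * theta1 (2 * τ) (2 * h))
      = fun h => theta1 τ (x + h) * theta2 τ (x - h) - theta1 τ (x - h) * theta2 τ (x + h) := by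
    ext h
    rw [theta1_theta2_antisymm hτ]; ring_nf
  rw [e] at r
  have u := l.unique r
  simp only [add_zero, sub_zero] at u
  linear_combination u / 2

lemma theta3_mul_theta4_self (x : ℂ) :
    theta3 τ x * theta4 τ x = theta4 (2 * τ) (2 * x) * theta4 (2 * τ) 0 := by
  rw [theta3_mul_theta4 hτ, sub_self, theta1_zero, mul_zero, sub_zero, two_mul x]

/-- The Wronskian of `θ₁`, `θ₂` and the product `θ₃ θ₄` are both constant multiples of `θ₄(2x |
2τ)`; comparison with `x = 0` fixes the constants. -/
lemma theta_wronskian (x : ℂ) :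
    (deriv (theta1 τ) x * theta2 τ x - theta1 τ x * deriv (theta2 τ) x)
      * (theta3 τ 0 * theta4 τ 0) = deriv (theta1 τ) 0 * theta2 τ 0 * (theta3 τ x * theta4 τ x) := by
  have h0 := theta_wronskian_two_mul hτ 0
  rw [theta1_zero, zero_mul, sub_zero] at h0
  rw [theta_wronskian_two_mul hτ, theta3_mul_theta4_self hτ, theta3_mul_theta4_self hτ, h0]
  simp only [mul_zero]
  ring

/-- Otherwise the Wronskian vanishes identically and `θ₁ / θ₂` is constant on `(-1/2, 1/2)`. Its
value at `0` is `0`, so `θ₁(1/4) = 0`, and `1/4` is not a lattice point. -/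
lemma deriv_theta1_zero_ne_zero : deriv (theta1 τ) 0 ≠ 0 := by
  intro h
  have hW : ∀ x, deriv (theta1 τ) x * theta2 τ x - theta1 τ x * deriv (theta2 τ) x = 0 := by
    intro x
    have := theta_wronskian hτ x
    rw [h, zero_mul, zero_mul, mul_eq_zero] at this
    exact this.resolve_right (mul_ne_zero (theta3_zero_ne_zero hτ) (theta4_zero_ne_zero hτ))
  have hne : ∀ y : ℝ, |y| < 1 / 2 → theta2 τ y ≠ 0 := by
    intro y hy h
    obtain ⟨a, b, hab⟩ := exists_int_of_theta2_eq_zero hτ h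
    have := (int_add_int_mul_tau_inj hτ (a := y) (b := 0) (c := a + 1 / 2) (d := b)
      (by push_cast; rw [hab]; ring)).1
    rw [this, abs_lt] at hy
    have h1 : ((-1 : ℤ) : ℝ) < a := by push_cast; linarith [hy.1]
    have h2 : (a : ℝ) < ((0 : ℤ) : ℝ) := by push_cast; linarith [hy.2]
    rw [Int.cast_lt] at h1 h2
    omega
  have hd : ∀ y ∈ Set.Ioo (-(1 / 2) : ℝ) (1 / 2),
      HasDerivAt (fun y : ℝ => theta1 τ y / theta2 τ y) 0 y := by
    intro y hy
    have h2 := hne y (abs_lt.mpr hy)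
    have := ((differentiable_theta1 hτ y).hasDerivAt.div
      (differentiable_theta2 hτ y).hasDerivAt h2).comp_ofReal
    rw [hW, zero_div] at this
    exact this
  have hc := (convex_Ioo (-(1 / 2) : ℝ) (1 / 2)).is_const_of_fderivWithin_eq_zero (𝕜 := ℝ)
    (f := fun y : ℝ => theta1 τ y / theta2 τ y)
    (fun y hy => (hd y hy).differentiableAt.differentiableWithinAt)
    (fun y hy => by
      have := (hd y hy).hasFDerivAt.hasFDerivWithinAt (s := Set.Ioo (-(1 / 2) : ℝ) (1 / 2))
      rw [this.fderivWithin (isOpen_Ioo.uniqueDiffWithinAt hy)]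
      ext; simp)
    (x := 0) (y := 1 / 4) ⟨by norm_num, by norm_num⟩ ⟨by norm_num, by norm_num⟩
  simp only [Complex.ofReal_zero, theta1_zero, zero_div] at hc
  rw [eq_comm, div_eq_zero_iff, or_iff_left (hne _ (by rw [abs_lt]; norm_num))] at hc
  obtain ⟨a, b, hab⟩ := exists_int_of_theta1_eq_zero hτ hc
  have := (int_add_int_mul_tau_inj hτ (a := 1 / 4) (b := 0) (c := a) (d := b)
      (by push_cast; push_cast at hab; rw [← hab]; ring)).1
  have h2 : ((4 * a : ℤ) : ℝ) = ((1 : ℤ) : ℝ) := by push_cast; linarith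
  have := Int.cast_injective h2
  omega

/-! ### One-particle energies -/

omit hτ in
lemma thetaRatio_eq (u : ℂ) :
    thetaRatio τ u = -(theta1 τ (u + 1 / 4) / theta2 τ (u + 1 / 4)) := by
  rw [thetaRatio, show u - 1 / 4 = u + 1 / 4 - 1 / 2 by ring, theta1_sub_half, div_neg]

omit hτ in
lemma theta3_quotient_eq (u : ℂ) :
    theta3 τ (u + 1 / 4) / theta3 τ (u - 1 / 4) = theta3 τ (u + 1 / 4) / theta4 τ (u + 1 / 4) := by
  rw [show u - 1 / 4 = u + 1 / 4 - 1 / 2 by ring, theta3_sub_half]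

/-- The contribution of one Bethe root to the energy. -/
noncomputable def rootEnergy (τ u : ℂ) : ℂ :=
  2 * (theta2 τ 0 / deriv (theta1 τ) 0) *
    (deriv (theta1 τ) (u - 1 / 4) / theta1 τ (u - 1 / 4) -
      deriv (theta1 τ) (u + 1 / 4) / theta1 τ (u + 1 / 4))

/-- As `θ₁(u - 1/4) = -θ₂(u + 1/4)`, the difference of logarithmic derivatives is minus the
Wronskian over `θ₁ θ₂` at `u + 1/4`. -/
lemma rootEnergy_eq {u : ℂ} (h1 : theta1 τ (u + 1 / 4) ≠ 0) (h2 : theta2 τ (u + 1 / 4) ≠ 0) :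
    rootEnergy τ u = -2 * theta2 τ 0 ^ 2 / (theta3 τ 0 * theta4 τ 0) *
      (theta3 τ (u + 1 / 4) * theta4 τ (u + 1 / 4) / (theta1 τ (u + 1 / 4) * theta2 τ (u + 1 / 4))) := by
  have hd : deriv (theta1 τ) (u + 1 / 4 - 1 / 2) = -deriv (theta2 τ) (u + 1 / 4) := by
    rw [← deriv_comp_sub_const, funext (theta1_sub_half τ), deriv.fun_neg]
  have h := theta_wronskian hτ (u + 1 / 4)
  rw [rootEnergy, show u - 1 / 4 = u + 1 / 4 - 1 / 2 by ring, hd, theta1_sub_half]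
  generalize u + 1 / 4 = x at *
  have := deriv_theta1_zero_ne_zero hτ
  have := theta3_zero_ne_zero hτ
  have := theta4_zero_ne_zero hτ
  field_simp
  linear_combination -theta2 τ 0 * h

/-- With `r` the theta ratio and `s² = θ₃/θ₄`, the amplitude is `rⁿ s` at even sites and `rⁿ s⁻¹` at
odd sites. This is the one-kink equation at an even site, divided by `rⁿ s⁻¹`. -/
lemma hopping_even {u : ℂ} (h1 : theta1 τ (u + 1 / 4) ≠ 0) (h2 : theta2 τ (u + 1 / 4) ≠ 0)
    (h4 : theta4 τ (u + 1 / 4) ≠ 0) :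
    2 * (couplingX τ * (thetaRatio τ u)⁻¹ + couplingY τ * thetaRatio τ u)
      = rootEnergy τ u * (theta3 τ (u + 1 / 4) / theta4 τ (u + 1 / 4)) := by
  rw [rootEnergy_eq hτ h1 h2, thetaRatio_eq, couplingX, couplingY]
  have h := theta_quadratic_three hτ (u + 1 / 4)
  generalize u + 1 / 4 = x at *
  have := theta3_zero_ne_zero hτ
  have := theta4_zero_ne_zero hτ
  field_simp
  linear_combination (-1 : ℂ) * h

lemma hopping_odd {u : ℂ} (h1 : theta1 τ (u + 1 / 4) ≠ 0) (h2 : theta2 τ (u + 1 / 4) ≠ 0)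
    (h3 : theta3 τ (u + 1 / 4) ≠ 0) :
    2 * (couplingY τ * (thetaRatio τ u)⁻¹ + couplingX τ * thetaRatio τ u)
      = rootEnergy τ u * (theta3 τ (u + 1 / 4) / theta4 τ (u + 1 / 4))⁻¹ := by
  rw [rootEnergy_eq hτ h1 h2, thetaRatio_eq, couplingX, couplingY]
  have h := theta_quadratic_four hτ (u + 1 / 4)
  generalize u + 1 / 4 = x at *
  have := theta3_zero_ne_zero hτ
  have := theta4_zero_ne_zero hτ
  field_simp
  linear_combination (-1 : ℂ) * h

end quadratic
/-! ### Location of the Bethe roots -/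

/-- The reflection `u ↦ 1/2 - u` exchanges the lines `Re u = 0` and `Re u = 1/2`. It negates the
ratio while leaving the `θ₃` quotient unchanged. -/
lemma thetaRatio_half_sub (τ u : ℂ) : thetaRatio τ (1 / 2 - u) = -thetaRatio τ u := by
  rw [thetaRatio, thetaRatio, show 1 / 2 - u + 1 / 4 = -(u + 1 / 4) + 1 by ring,
    show 1 / 2 - u - 1 / 4 = -(u - 1 / 4) by ring, theta1_add_one, theta1_neg, theta1_neg, neg_neg,
    div_neg]

lemma theta3_quotient_half_sub (τ u : ℂ) :
    theta3 τ (1 / 2 - u + 1 / 4) / theta3 τ (1 / 2 - u - 1 / 4)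
      = theta3 τ (u + 1 / 4) / theta3 τ (u - 1 / 4) := by
  rw [show 1 / 2 - u + 1 / 4 = -(u + 1 / 4) + 1 by ring,
    show 1 / 2 - u - 1 / 4 = -(u - 1 / 4) by ring, theta3_add_one, theta3_neg, theta3_neg]

/-- The part of the fundamental domain on the lines `Re u = 0` and `Re u = 1/2`. -/
def rootLines (τ : ℂ) : Set ℂ := {u | u ∈ rootDomain τ ∧ (u.re = 0 ∨ u.re = 1 / 2)}

lemma mem_rootLines_iff {τ u : ℂ} : u ∈ rootLines τ ↔
    (u.re = 0 ∧ -(τ.im / 2) < u.im ∧ u.im ≤ τ.im / 2) ∨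
    (u.re = 1 / 2 ∧ -(τ.im / 2) ≤ u.im ∧ u.im < τ.im / 2) := by
  rw [rootLines, rootDomain]
  simp only [Set.mem_ofPred_eq]
  constructor
  · rintro ⟨h1 | h1, h2 | h2⟩
    · exact Or.inl ⟨h2, h1.2.2⟩
    · linarith [h1.2.1]
    · linarith [h1.1]
    · exact Or.inr ⟨h2, h1.2.2⟩
  · rintro (⟨h, h1⟩ | ⟨h, h1⟩)
    · refine ⟨Or.inl ⟨by linarith, by linarith, h1⟩, Or.inl h⟩
    · refine ⟨Or.inr ⟨by linarith, by linarith, h1⟩, Or.inr h⟩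

lemma half_sub_mem_rootLines {τ u : ℂ} (h : u ∈ rootLines τ) : 1 / 2 - u ∈ rootLines τ := by
  rw [mem_rootLines_iff] at h ⊢
  have hr : (1 / 2 - u).re = 1 / 2 - u.re := by simp
  have hi : (1 / 2 - u).im = -u.im := by simp
  rw [hr, hi]
  rcases h with ⟨h, h1, h2⟩ | ⟨h, h1, h2⟩
  · exact Or.inr ⟨by linarith, by linarith, by linarith⟩
  · exact Or.inl ⟨by linarith, by linarith, by linarith⟩

section imaginary
variable {τ : ℂ} (hre : τ.re = 0) (hτ : 0 < τ.im)
include hre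

lemma theta2_conj (u : ℂ) : theta2 τ (conj u) = conj (theta2 τ u) := by
  rw [theta2, theta2, map_mul, conj_tsum, Complex.conj_ofNat]
  congr 2
  ext n
  have h : conj (I * Real.pi * τ) = I * Real.pi * τ := by
    apply Complex.ext <;> simp [hre]
  rw [map_mul, nomePow, ← Complex.exp_conj, map_mul, h, ← Complex.cos_conj]
  simp [Complex.conj_ofNat]

lemma theta1_conj (u : ℂ) : theta1 τ (conj u) = conj (theta1 τ u) := by
  rw [theta1_eq_theta2, theta1_eq_theta2, ← theta2_conj hre]
  simp [Complex.conj_ofNat]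

include hτ in
lemma theta3_conj (u : ℂ) : theta3 τ (conj u) = conj (theta3 τ u) := by
  have h : -conj τ = τ := by apply Complex.ext <;> simp [hre]
  rw [theta3_eq_jacobi hτ, theta3_eq_jacobi hτ, jacobiTheta₂_conj, h]

include hτ

lemma theta_ne_zero_of_re {u : ℂ} (hu : u.re = 0 ∨ u.re = 1 / 2) :
    theta1 τ (u + 1 / 4) ≠ 0 ∧ theta2 τ (u + 1 / 4) ≠ 0 ∧ theta3 τ (u + 1 / 4) ≠ 0 ∧
      theta4 τ (u + 1 / 4) ≠ 0 := by
  obtain ⟨m, hm⟩ : ∃ m : ℤ, u.re = m / 2 := by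
    rcases hu with h | h
    · exact ⟨0, by rw [h]; simp⟩
    · exact ⟨1, by rw [h]; simp⟩
  have key : ∀ k : ℤ, ∀ z : ℂ, u + 1 / 4 = z → 2 * z.re = k → False := by
    intro k z hz hk
    rw [← hz] at hk
    simp [hm] at hk
    have h2 : ((2 * m + 1 : ℤ) : ℝ) = ((2 * k : ℤ) : ℝ) := by push_cast; linarith
    have := Int.cast_injective h2
    omega
  refine ⟨fun h => ?_, fun h => ?_, fun h => ?_, fun h => ?_⟩
  · obtain ⟨a, b, hab⟩ := exists_int_of_theta1_eq_zero hτ h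
    exact key (2 * a) _ hab (by simp [hre])
  · obtain ⟨a, b, hab⟩ := exists_int_of_theta2_eq_zero hτ h
    exact key (2 * a + 1) _ hab (by simp [hre]; ring)
  · obtain ⟨a, b, hab⟩ := exists_int_of_theta3_eq_zero hτ h
    exact key (2 * a + 1) _ hab (by simp [hre]; ring)
  · obtain ⟨a, b, hab⟩ := exists_int_of_theta4_eq_zero hτ h
    exact key (2 * a) _ hab (by simp [hre])

/-- For imaginary `τ`, conjugation commutes with the theta functions, so with `x = u + 1/4` the
hypothesis is `θ₁(x) θ₁(x̄) = θ₂(x) θ₂(x̄)`. By duplication this is `θ₂(x + x̄ | 2τ) θ₃(x - x̄ | 2τ)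
= 0`. The second factor has an imaginary argument and is nonzero; the zeros of the first give `2 Re
u ∈ ℤ`. -/
lemma mem_rootLines_of_norm_eq_one {u : ℂ} (hu : u ∈ rootDomain τ) (h : ‖thetaRatio τ u‖ = 1) :
    u ∈ rootLines τ := by
  have hτ2 : 0 < (2 * τ).im := by simpa using hτ
  refine ⟨hu, ?_⟩
  set x := u + 1 / 4 with hx
  -- At a pole the ratio takes the default value `0`, so its norm is not `1`.
  have h2 : theta2 τ x ≠ 0 := by
    intro h0
    rw [thetaRatio_eq, ← hx, h0] at h
    simp at h
  have hn : ‖theta1 τ x‖ = ‖theta2 τ x‖ := by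
    rw [thetaRatio_eq, ← hx, norm_neg, norm_div, div_eq_one_iff_eq (norm_ne_zero_iff.mpr h2)] at h
    exact h
  have e : theta1 τ x * theta1 τ (conj x) = theta2 τ x * theta2 τ (conj x) := by
    rw [theta1_conj hre, theta2_conj hre, Complex.mul_conj, Complex.mul_conj,
      Complex.normSq_eq_norm_sq, Complex.normSq_eq_norm_sq, hn]
  rw [theta1_mul_theta1 hτ, theta2_mul_theta2 hτ] at e
  have e2 : theta2 (2 * τ) (x + conj x) * theta3 (2 * τ) (x - conj x) = 0 := by
    linear_combination (-1 / 2 : ℂ) * e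
  rcases mul_eq_zero.mp e2 with h0 | h0
  · obtain ⟨a, b, hab⟩ := exists_int_of_theta2_eq_zero hτ2 h0
    have := congrArg Complex.re hab
    simp [hx, hre] at this
    have h3 : 2 * u.re = a := by linarith
    have h4 : -1 < 2 * u.re ∧ 2 * u.re ≤ 1 := by
      rcases hu with hu | hu
      · exact ⟨by linarith [hu.1], by linarith [hu.2.1]⟩
      · exact ⟨by linarith [hu.1], by linarith [hu.2.1]⟩
    rw [h3] at h4
    have h5 : (-1 : ℤ) < a := by exact_mod_cast h4.1
    have h6 : a ≤ (1 : ℤ) := by exact_mod_cast h4.2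
    obtain rfl | rfl : a = 0 ∨ a = 1 := by omega
    · left; push_cast at h3; linarith
    · right; push_cast at h3; linarith
  · exfalso
    obtain ⟨a, b, hab⟩ := exists_int_of_theta3_eq_zero hτ2 h0
    have := congrArg Complex.re hab
    simp [hx, hre] at this
    have h2 : ((2 * a + 1 : ℤ) : ℝ) = ((0 : ℤ) : ℝ) := by push_cast; linarith
    have := Int.cast_injective h2
    omega

/-- By `theta1_theta2_antisymm`, equal ratios force `θ₄(u + v + 1/2 | 2τ) = 0` or `θ₁(u - v | 2τ) =
0`. The second gives `u = v`. The first needs `u` and `v` on different lines with `Im u + Im v` an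
odd multiple of `Im τ`; the opposite half-open ends of the two segments exclude this. -/
lemma thetaRatio_injOn : Set.InjOn (thetaRatio τ) (rootLines τ) := by
  have hτ2 : 0 < (2 * τ).im := by simpa using hτ
  intro u hu v hv huv
  obtain ⟨-, hu2, -⟩ := theta_ne_zero_of_re hre hτ hu.2
  obtain ⟨-, hv2, -⟩ := theta_ne_zero_of_re hre hτ hv.2
  rw [thetaRatio_eq, thetaRatio_eq, neg_inj, div_eq_div_iff hu2 hv2] at huv
  have h := theta1_theta2_antisymm hτ (u + 1 / 4) (v + 1 / 4)
  rw [huv, sub_self, eq_comm, mul_assoc, mul_eq_zero, or_iff_right two_ne_zero, mul_eq_zero] at h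
  rw [mem_rootLines_iff] at hu hv
  rcases h with h | h
  · exfalso
    obtain ⟨a, b, hab⟩ := exists_int_of_theta4_eq_zero hτ2 h
    have h1 := congrArg Complex.re hab
    have h2 := congrArg Complex.im hab
    simp [hre] at h1 h2
    have h3 : u.im + v.im = (2 * b + 1 : ℤ) * τ.im := by push_cast; linarith
    have h5 : u.re + v.re = 1 / 2 → -τ.im < u.im + v.im ∧ u.im + v.im < τ.im := by
      rcases hu with ⟨hu, hu1, hu2⟩ | ⟨hu, hu1, hu2⟩ <;>
      rcases hv with ⟨hv, hv1, hv2⟩ | ⟨hv, hv1, hv2⟩ <;> intro h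
      · rw [hu, hv] at h; norm_num at h
      · constructor <;> linarith
      · constructor <;> linarith
      · rw [hu, hv] at h; norm_num at h
    have h6 : u.re + v.re = 1 / 2 := by
      rcases hu with ⟨hu, -⟩ | ⟨hu, -⟩ <;> rcases hv with ⟨hv, -⟩ | ⟨hv, -⟩ <;>
        rw [hu, hv] at h1 ⊢
      · exfalso
        have h2 : ((2 * a : ℤ) : ℝ) = ((1 : ℤ) : ℝ) := by push_cast; linarith
        have := Int.cast_injective h2
        omega
      · norm_num
      · norm_num
      · exfalso
        have h2 : ((2 * a : ℤ) : ℝ) = ((3 : ℤ) : ℝ) := by push_cast; linarith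
        have := Int.cast_injective h2
        omega
    have h7 := h5 h6
    rw [h3] at h7
    have h8 : ((-1 : ℤ) : ℝ) < (2 * b + 1 : ℤ) := by
      push_cast; push_cast at h7; nlinarith
    have h9 : ((2 * b + 1 : ℤ) : ℝ) < (1 : ℤ) := by
      push_cast; push_cast at h7; nlinarith
    rw [Int.cast_lt] at h8 h9
    omega
  · obtain ⟨a, b, hab⟩ := exists_int_of_theta1_eq_zero hτ2 h
    have h1 := congrArg Complex.re hab
    have h2 := congrArg Complex.im hab
    simp [hre] at h1 h2
    have hb : |u.im - v.im| ≤ τ.im := by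
      rw [abs_le]
      rcases hu with ⟨-, hu1, hu2⟩ | ⟨-, hu1, hu2⟩ <;>
      rcases hv with ⟨-, hv1, hv2⟩ | ⟨-, hv1, hv2⟩ <;> constructor <;> linarith
    have ha : |u.re - v.re| ≤ 1 / 2 := by
      rw [abs_le]
      rcases hu with ⟨hu, -⟩ | ⟨hu, -⟩ <;> rcases hv with ⟨hv, -⟩ | ⟨hv, -⟩ <;>
        rw [hu, hv] <;> norm_num
    rw [h1, abs_le] at ha
    rw [h2, abs_le] at hb
    have a1 : ((-1 : ℤ) : ℝ) < a := by push_cast; linarith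
    have a2 : (a : ℝ) < (1 : ℤ) := by push_cast; linarith
    have b1 : ((-1 : ℤ) : ℝ) < b := by push_cast; nlinarith
    have b2 : (b : ℝ) < (1 : ℤ) := by push_cast; nlinarith
    rw [Int.cast_lt] at a1 a2 b1 b2
    obtain rfl : a = 0 := by omega
    obtain rfl : b = 0 := by omega
    simp at h1 h2
    exact Complex.ext (by linarith) (by linarith)

omit hre hτ in
lemma conj_add_quarter {u : ℂ} (hu : u.re = 0 ∨ u.re = 1 / 2) :
    conj (u + 1 / 4) = -(u - 1 / 4) ∨ conj (u + 1 / 4) = -(u - 1 / 4) + 1 := by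
  rcases hu with h | h
  · left; apply Complex.ext <;> simp [h]
  · right; apply Complex.ext <;> simp [h]; norm_num

/-- On the two lines `-(u - 1/4)` is the conjugate of `u + 1/4` modulo `1`, so numerator and
denominator have the same modulus. -/
lemma norm_thetaRatio {u : ℂ} (hu : u.re = 0 ∨ u.re = 1 / 2) : ‖thetaRatio τ u‖ = 1 := by
  obtain ⟨h1, -⟩ := theta_ne_zero_of_re hre hτ hu
  have : ‖theta1 τ (u - 1 / 4)‖ = ‖theta1 τ (u + 1 / 4)‖ := by
    rw [← Complex.norm_conj (theta1 τ (u + 1 / 4)), ← theta1_conj hre]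
    rcases conj_add_quarter hu with h | h <;> rw [h]
    · rw [theta1_neg, norm_neg]
    · rw [theta1_add_one, theta1_neg, norm_neg, norm_neg]
  rw [thetaRatio, norm_div, this, div_self (norm_ne_zero_iff.mpr h1)]

lemma norm_theta3_quotient {u : ℂ} (hu : u.re = 0 ∨ u.re = 1 / 2) :
    ‖theta3 τ (u + 1 / 4) / theta3 τ (u - 1 / 4)‖ = 1 := by
  obtain ⟨-, -, h3, -⟩ := theta_ne_zero_of_re hre hτ hu
  have : ‖theta3 τ (u - 1 / 4)‖ = ‖theta3 τ (u + 1 / 4)‖ := by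
    rw [← Complex.norm_conj (theta3 τ (u + 1 / 4)), ← theta3_conj hre hτ]
    rcases conj_add_quarter hu with h | h <;> rw [h]
    · rw [theta3_neg]
    · rw [theta3_add_one, theta3_neg]
  rw [norm_div, this, div_self (norm_ne_zero_iff.mpr h3)]

/-- Keeps the quotient off the cut of the principal square root. The value `-1` would give `θ₃² =
θ₄²` at `u + 1/4`, that is `θ₂(2u + 1/2 | 2τ) = 0`; within the domain this leaves `u = 0` and `u =
1/2`, where the quotient is `1`. -/
lemma theta3_quotient_ne_neg_one {u : ℂ} (hu : u ∈ rootLines τ) :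
    theta3 τ (u + 1 / 4) / theta3 τ (u - 1 / 4) ≠ -1 := by
  have hτ2 : 0 < (2 * τ).im := by simpa using hτ
  obtain ⟨-, -, h3, h4⟩ := theta_ne_zero_of_re hre hτ hu.2
  intro h
  have h' := h
  rw [theta3_quotient_eq, div_eq_iff h4] at h
  have hs : theta3 τ (u + 1 / 4) * theta3 τ (u + 1 / 4)
      = theta4 τ (u + 1 / 4) * theta4 τ (u + 1 / 4) := by rw [h]; ring
  rw [theta3_mul_theta3 hτ, theta4_mul_theta4 hτ] at hs
  have h0 : theta2 (2 * τ) (u + 1 / 4 + (u + 1 / 4)) * theta2 (2 * τ) 0 = 0 := by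
    rw [sub_self] at hs
    linear_combination hs / 2
  rw [mul_eq_zero, or_iff_left (theta2_zero_ne_zero hτ2)] at h0
  obtain ⟨a, b, hab⟩ := exists_int_of_theta2_eq_zero hτ2 h0
  have h2 := congrArg Complex.im hab
  simp [hre] at h2
  have hb : |u.im| ≤ τ.im / 2 := by
    rw [mem_rootLines_iff] at hu
    rw [abs_le]
    rcases hu with ⟨-, hu1, hu2⟩ | ⟨-, hu1, hu2⟩ <;> constructor <;> linarith
  rw [abs_le] at hb
  have b1 : ((-1 : ℤ) : ℝ) < b := by push_cast; nlinarith
  have b2 : (b : ℝ) < (1 : ℤ) := by push_cast; nlinarith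
  rw [Int.cast_lt] at b1 b2
  obtain rfl : b = 0 := by omega
  have hi : u.im = 0 := by simpa using h2
  have key : theta3 τ (u + 1 / 4) / theta3 τ (u - 1 / 4) = 1 := by
    rcases hu.2 with hr | hr
    · have : u = 0 := Complex.ext (by simpa using hr) (by simpa using hi)
      rw [this] at h3 ⊢
      rw [zero_sub, theta3_neg, zero_add] at *
      exact div_self h3
    · have : u = 1 / 2 := Complex.ext (by simpa using hr) (by simpa using hi)
      rw [this] at h3 ⊢
      rw [show (1 / 2 - 1 / 4 : ℂ) = -(1 / 2 + 1 / 4) + 1 by norm_num, theta3_add_one, theta3_neg,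
        div_self h3]
  rw [key] at h'
  norm_num at h'

lemma thetaRatio_zero : thetaRatio τ 0 = -1 := by
  obtain ⟨h1, -⟩ := theta_ne_zero_of_re hre hτ (u := 0) (Or.inl (by simp))
  rw [zero_add] at h1
  rw [thetaRatio, zero_add, zero_sub, theta1_neg, div_neg, div_self h1]

lemma thetaRatio_half_tau : thetaRatio τ (τ / 2) = -I := by
  obtain ⟨-, -, -, h4⟩ := theta_ne_zero_of_re hre hτ (u := 0) (Or.inl (by simp))
  rw [zero_add] at h4
  rw [thetaRatio, show τ / 2 + 1 / 4 = 1 / 4 + τ / 2 by ring,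
    show τ / 2 - 1 / 4 = -(1 / 4) + τ / 2 by ring, theta1_add_half_tau hτ, theta1_add_half_tau hτ,
    theta4_neg, mul_div_mul_right _ _ h4, ← Complex.exp_sub, ← Complex.exp_neg_pi_div_two_mul_I]
  congr 1; ring

omit hre hτ in
lemma thetaRatio_neg (u : ℂ) : thetaRatio τ (-u) = (thetaRatio τ u)⁻¹ := by
  rw [thetaRatio, thetaRatio, inv_div, show -u + 1 / 4 = -(u - 1 / 4) by ring,
    show -u - 1 / 4 = -(u + 1 / 4) by ring, theta1_neg, theta1_neg, neg_div_neg_eq]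

lemma continuous_thetaRatio_mul_I : Continuous fun y : ℝ => thetaRatio τ (y * I) := by
  have h1 := (differentiable_theta1 hτ).continuous
  simp only [thetaRatio]
  refine Continuous.div (by fun_prop) (by fun_prop) fun y => ?_
  obtain ⟨-, h2, -⟩ := theta_ne_zero_of_re hre hτ (u := (y : ℂ) * I) (Or.inl (by simp))
  rw [show (y : ℂ) * I - 1 / 4 = y * I + 1 / 4 - 1 / 2 by ring, theta1_sub_half]
  exact neg_ne_zero.mpr h2

/-- The ratio is `-1` at `0`. A change of sign would make it `±I` at an interior point of the
segment, but these values are already taken at `τ/2` and `1/2 - τ/2`, against injectivity. -/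
lemma re_thetaRatio_neg {y : ℝ} (hy : y ∈ Set.Ioo (-(τ.im / 2)) (τ.im / 2)) :
    (thetaRatio τ (y * I)).re < 0 := by
  by_contra! hge
  have hc := (continuous_thetaRatio_mul_I hre hτ)
  have h0 : (0 : ℝ) ∈ Set.Ioo (-(τ.im / 2)) (τ.im / 2) := ⟨by linarith, by linarith⟩
  obtain ⟨z, hz, hz0⟩ := (isPreconnected_Ioo.intermediate_value h0 hy
    (f := fun y : ℝ => (thetaRatio τ (y * I)).re) (Complex.continuous_re.comp hc).continuousOn)
    (show (0 : ℝ) ∈ _ from ⟨by simp [thetaRatio_zero hre hτ], hge⟩)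
  have hzl : (z * I : ℂ) ∈ rootLines τ := by
    rw [mem_rootLines_iff]; left
    simp only [Complex.mul_re, Complex.mul_im, Complex.ofReal_re, Complex.ofReal_im, Complex.I_re,
      Complex.I_im]
    exact ⟨by ring, by linarith [hz.1], by linarith [hz.2]⟩
  have hn := norm_thetaRatio hre hτ hzl.2
  have hsq : (thetaRatio τ (z * I)).im ^ 2 = 1 := by
    have := Complex.sq_norm (thetaRatio τ (z * I))
    rw [hn, Complex.normSq_apply] at this
    simp only at hz0
    rw [hz0] at this
    linarith
  have htl : τ / 2 ∈ rootLines τ := by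
    rw [mem_rootLines_iff]; left
    simp [hre]; linarith
  rcases sq_eq_one_iff.mp hsq with h | h
  · have e : thetaRatio τ (z * I) = thetaRatio τ (1 / 2 - τ / 2) := by
      rw [thetaRatio_half_sub, thetaRatio_half_tau hre hτ, neg_neg]
      exact Complex.ext (by simpa using hz0) (by simpa using h)
    have := congrArg Complex.re (thetaRatio_injOn hre hτ hzl (half_sub_mem_rootLines htl) e)
    simp [hre] at this
  · have e : thetaRatio τ (z * I) = thetaRatio τ (τ / 2) := by
      rw [thetaRatio_half_tau hre hτ]
      exact Complex.ext (by simpa using hz0) (by simpa using h)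
    have := congrArg Complex.im (thetaRatio_injOn hre hτ hzl htl e)
    simp at this
    linarith [hz.2]

/-- Along the imaginary segment the ratio runs from `I` to `-I` with negative real part inside,
hence over the open left half of the circle. The reflection `u ↦ 1/2 - u` supplies the right half.
-/
lemma exists_thetaRatio_eq {w : ℂ} (hw : ‖w‖ = 1) : ∃ u ∈ rootLines τ, thetaRatio τ u = w := by
  have hneg : ∀ w, (∃ u ∈ rootLines τ, thetaRatio τ u = -w) →
      ∃ u ∈ rootLines τ, thetaRatio τ u = w := by
    rintro w ⟨u, hu, h⟩
    exact ⟨1 / 2 - u, half_sub_mem_rootLines hu, by rw [thetaRatio_half_sub, h, neg_neg]⟩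
  have htl : τ / 2 ∈ rootLines τ := by
    rw [mem_rootLines_iff]; left
    simp [hre]; linarith
  have hsum : ∀ w : ℂ, ‖w‖ = 1 → w.re ^ 2 + w.im ^ 2 = 1 := by
    intro w hw
    have := Complex.sq_norm w
    rw [hw, Complex.normSq_apply] at this
    linarith
  have hlt : ∀ w : ℂ, ‖w‖ = 1 → w.re < 0 → ∃ u ∈ rootLines τ, thetaRatio τ u = w := by
    intro w hw hwr
    have hs := hsum w hw
    have hwi : |w.im| < 1 := by
      rw [← sq_lt_one_iff_abs_lt_one]; nlinarith
    rw [abs_lt] at hwi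
    have ht2 : (τ.im / 2 : ℝ) * I = τ / 2 := by
      apply Complex.ext <;> simp [hre]
    have e1 : (thetaRatio τ ((τ.im / 2 : ℝ) * I)).im = -1 := by
      rw [ht2, thetaRatio_half_tau hre hτ]; simp
    have e2 : (thetaRatio τ ((-(τ.im / 2) : ℝ) * I)).im = 1 := by
      rw [Complex.ofReal_neg, neg_mul, ht2, thetaRatio_neg, thetaRatio_half_tau hre hτ]; simp
    have hc := (continuous_thetaRatio_mul_I hre hτ)
    obtain ⟨y, hy, hyw⟩ := intermediate_value_Icc' (a := -(τ.im / 2)) (b := τ.im / 2)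
      (by linarith) (f := fun y : ℝ => (thetaRatio τ (y * I)).im)
      (Complex.continuous_im.comp hc).continuousOn
      (show w.im ∈ _ from ⟨by rw [e1]; exact hwi.1.le, by rw [e2]; exact hwi.2.le⟩)
    simp only at hyw
    have y1 : y ≠ τ.im / 2 := by
      rintro rfl; rw [e1] at hyw; linarith
    have y2 : y ≠ -(τ.im / 2) := by
      rintro rfl; rw [e2] at hyw; linarith
    have hyo : y ∈ Set.Ioo (-(τ.im / 2)) (τ.im / 2) :=
      ⟨lt_of_le_of_ne hy.1 y2.symm, lt_of_le_of_ne hy.2 y1⟩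
    have hyl : (y * I : ℂ) ∈ rootLines τ := by
      rw [mem_rootLines_iff]; left
      simp only [Complex.mul_re, Complex.mul_im, Complex.ofReal_re, Complex.ofReal_im, Complex.I_re,
        Complex.I_im]
      exact ⟨by ring, by linarith [hyo.1], by linarith [hyo.2]⟩
    refine ⟨y * I, hyl, Complex.ext ?_ hyw⟩
    have hs' := hsum _ (norm_thetaRatio hre hτ hyl.2)
    have hr := re_thetaRatio_neg hre hτ hyo
    rw [hyw] at hs'
    nlinarith
  rcases lt_trichotomy w.re 0 with h | h | h
  · exact hlt w hw h
  · have hs := hsum w hw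
    rw [h] at hs
    have hs2 : w.im ^ 2 = 1 := by linarith
    rcases sq_eq_one_iff.mp hs2 with h1 | h1
    · apply hneg
      refine ⟨_, htl, ?_⟩
      rw [thetaRatio_half_tau hre hτ]
      apply Complex.ext <;> simp [h, h1]
    · refine ⟨_, htl, ?_⟩
      rw [thetaRatio_half_tau hre hτ]
      apply Complex.ext <;> simp [h, h1]
  · exact hneg w (hlt _ (by rwa [norm_neg]) (by simpa using h))

end imaginary
/-! ### One-kink amplitudes -/

/-- The principal square root of `θ₃(u + 1/4) / θ₃(u - 1/4)`. -/
noncomputable def rootPhase (τ u : ℂ) : ℂ :=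
  (theta3 τ (u + 1 / 4) / theta3 τ (u - 1 / 4)) ^ (1 / 2 : ℂ)

lemma rootPhase_half_sub (τ u : ℂ) : rootPhase τ (1 / 2 - u) = rootPhase τ u := by
  rw [rootPhase, rootPhase, theta3_quotient_half_sub]

lemma rootPhase_sq (τ u : ℂ) :
    rootPhase τ u ^ 2 = theta3 τ (u + 1 / 4) / theta3 τ (u - 1 / 4) := by
  rw [rootPhase, ← Complex.cpow_nat_mul]
  norm_num

lemma kinkAmplitude_even (τ u : ℂ) {n : ℕ} (hn : Even n) :
    kinkAmplitude τ n u = thetaRatio τ u ^ n * rootPhase τ u := by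
  rw [kinkAmplitude, rootPhase, hn.neg_one_pow]

section imaginary
variable {τ : ℂ} (hre : τ.re = 0) (hτ : 0 < τ.im) {u : ℂ} (hu : u ∈ rootLines τ)
include hre hτ hu

lemma norm_rootPhase : ‖rootPhase τ u‖ = 1 := by
  have h := congrArg norm (rootPhase_sq τ u)
  rw [norm_pow, norm_theta3_quotient hre hτ hu.2] at h
  exact (pow_eq_one_iff_of_nonneg (norm_nonneg _) two_ne_zero).mp h

/-- At odd sites the quotient is inverted. The principal square root commutes with inversion away
from argument `π`, so both parities use one phase. -/
lemma kinkAmplitude_odd {n : ℕ} (hn : Odd n) :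
    kinkAmplitude τ n u = thetaRatio τ u ^ n * (rootPhase τ u)⁻¹ := by
  have harg : (theta3 τ (u + 1 / 4) / theta3 τ (u - 1 / 4)).arg ≠ Real.pi := by
    intro h
    have h2 := Complex.norm_mul_exp_arg_mul_I (theta3 τ (u + 1 / 4) / theta3 τ (u - 1 / 4))
    rw [h, norm_theta3_quotient hre hτ hu.2, Complex.ofReal_one, one_mul, Complex.exp_pi_mul_I] at h2
    exact theta3_quotient_ne_neg_one hre hτ hu h2.symm
  rw [kinkAmplitude, rootPhase, hn.neg_one_pow, ← Complex.inv_cpow _ _ harg, inv_div]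
  congr 3
  · ring_nf
  · ring_nf

lemma kinkAmplitude_hop_even {p : ℕ} (hp : Odd p) :
    2 * (couplingX τ * kinkAmplitude τ p u + couplingY τ * kinkAmplitude τ (p + 2) u)
      = rootEnergy τ u * kinkAmplitude τ (p + 1) u := by
  obtain ⟨h1, h2, -, h4⟩ := theta_ne_zero_of_re hre hτ hu.2
  have hr : thetaRatio τ u ≠ 0 := by
    rw [← norm_ne_zero_iff, norm_thetaRatio hre hτ hu.2]; exact one_ne_zero
  have hs : rootPhase τ u ≠ 0 := by
    rw [← norm_ne_zero_iff, norm_rootPhase hre hτ hu]; exact one_ne_zero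
  have h := hopping_even hτ h1 h2 h4
  rw [← theta3_quotient_eq, ← rootPhase_sq] at h
  rw [kinkAmplitude_odd hre hτ hu hp, kinkAmplitude_odd hre hτ hu (hp.add_even even_two),
    kinkAmplitude_even τ u hp.add_one]
  field_simp at h ⊢
  linear_combination thetaRatio τ u ^ p * h

lemma kinkAmplitude_hop_odd {p : ℕ} (hp : Even p) :
    2 * (couplingY τ * kinkAmplitude τ p u + couplingX τ * kinkAmplitude τ (p + 2) u)
      = rootEnergy τ u * kinkAmplitude τ (p + 1) u := by
  obtain ⟨h1, h2, h3, h4⟩ := theta_ne_zero_of_re hre hτ hu.2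
  have hr : thetaRatio τ u ≠ 0 := by
    rw [← norm_ne_zero_iff, norm_thetaRatio hre hτ hu.2]; exact one_ne_zero
  have hs : rootPhase τ u ≠ 0 := by
    rw [← norm_ne_zero_iff, norm_rootPhase hre hτ hu]; exact one_ne_zero
  have h := hopping_odd hτ h1 h2 h3
  rw [← theta3_quotient_eq, ← rootPhase_sq] at h
  rw [kinkAmplitude_even τ u hp, kinkAmplitude_even τ u (hp.add even_two),
    kinkAmplitude_odd hre hτ hu hp.add_one]
  field_simp at h ⊢
  linear_combination thetaRatio τ u ^ p * h

omit hu in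
/-- Orthogonality of the one-kink amplitudes over one period. -/
lemma sum_conj_kinkAmplitude_mul {N : ℕ} (hN : Even N) {c : ℂ} (hc : c ≠ 0) {u v : ℂ}
    (hu : u ∈ rootLines τ) (hv : v ∈ rootLines τ) (hur : thetaRatio τ u ^ N = c)
    (hvr : thetaRatio τ v ^ N = c) [Decidable (u = v)] :
    ∑ i : Fin N, conj (kinkAmplitude τ (siteNumber i) u) * kinkAmplitude τ (siteNumber i) v
      = if u = v then (N : ℂ) else 0 := by
  have hconj : ∀ z : ℂ, ‖z‖ = 1 → conj z = z⁻¹ := by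
    intro z hz
    rw [Complex.inv_def, Complex.normSq_eq_norm_sq, hz]; simp
  have hru := norm_thetaRatio hre hτ hu.2
  have hsu := norm_rootPhase hre hτ hu
  have hru0 : thetaRatio τ u ≠ 0 := by
    rw [← norm_ne_zero_iff, hru]; exact one_ne_zero
  have hsu0 : rootPhase τ u ≠ 0 := by
    rw [← norm_ne_zero_iff, hsu]; exact one_ne_zero
  set z := thetaRatio τ v / thetaRatio τ u with hz
  set g := rootPhase τ v / rootPhase τ u with hg
  have ev : ∀ n, Even n → conj (kinkAmplitude τ n u) * kinkAmplitude τ n v = z ^ n * g := by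
    intro n hn
    rw [kinkAmplitude_even τ u hn, kinkAmplitude_even τ v hn, map_mul, map_pow, hconj _ hru,
      hconj _ hsu, hz, hg, div_pow, inv_pow]
    field_simp
  have od : ∀ n, Odd n → conj (kinkAmplitude τ n u) * kinkAmplitude τ n v = z ^ n * g⁻¹ := by
    intro n hn
    rw [kinkAmplitude_odd hre hτ hu hn, kinkAmplitude_odd hre hτ hv hn, map_mul, map_pow,
      map_inv₀, hconj _ hru, hconj _ hsu, hz, hg, div_pow, inv_pow]
    field_simp
  -- Sites are grouped in odd–even pairs, giving a geometric sum in `z²`. If `z² ≠ 1` it vanishes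
  -- because `z ^ N = 1`.
  have hsum : ∀ K : ℕ, ∑ i ∈ Finset.range (2 * K),
      conj (kinkAmplitude τ (i + 1) u) * kinkAmplitude τ (i + 1) v
      = (z * g⁻¹ + z ^ 2 * g) * ∑ k ∈ Finset.range K, (z ^ 2) ^ k := by
    intro K
    induction K with
    | zero => simp
    | succ K ih =>
      rw [show 2 * (K + 1) = 2 * K + 1 + 1 by ring, Finset.sum_range_succ, Finset.sum_range_succ, ih,
        od (2 * K + 1) ⟨K, rfl⟩, ev (2 * K + 1 + 1) ⟨K + 1, by ring⟩, Finset.sum_range_succ]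
      ring
  obtain ⟨K, hK⟩ := hN
  have hK2 : N = 2 * K := by omega
  have hzN : (z ^ 2) ^ K = 1 := by
    rw [← pow_mul, ← hK2, hz, div_pow, hur, hvr, div_self hc]
  have e : ∑ i : Fin N, conj (kinkAmplitude τ (siteNumber i) u) * kinkAmplitude τ (siteNumber i) v
      = (z * g⁻¹ + z ^ 2 * g) * ∑ k ∈ Finset.range K, (z ^ 2) ^ k := by
    rw [← hsum, ← hK2]
    exact Fin.sum_univ_eq_sum_range
      (fun i => conj (kinkAmplitude τ (i + 1) u) * kinkAmplitude τ (i + 1) v) N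
  rw [e]
  split_ifs with huv
  · have hz1 : z = 1 := by rw [hz, ← huv, div_self hru0]
    have hg1 : g = 1 := by rw [hg, ← huv, div_self hsu0]
    rw [hz1, hg1, hK2]
    norm_num
  · by_cases hz1 : z ^ 2 = 1
    · rcases sq_eq_one_iff.mp hz1 with h | h
      · exfalso
        rw [hz, div_eq_one_iff_eq hru0] at h
        exact huv (thetaRatio_injOn hre hτ hv hu h).symm
      -- Here the geometric sum does not vanish. The reflected root has the same phase, so `g = 1`
      -- and the prefactor `z g⁻¹ + z² g` is `-1 + 1 = 0`.
      · have hv' : v = 1 / 2 - u := by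
          apply thetaRatio_injOn hre hτ hv (half_sub_mem_rootLines hu)
          rw [thetaRatio_half_sub, ← neg_one_mul, ← h, hz, div_mul_cancel₀ _ hru0]
        have hg1 : g = 1 := by rw [hg, hv', rootPhase_half_sub, div_self hsu0]
        rw [h, hg1]; norm_num
    · rw [geom_sum_eq hz1, hzN, sub_self, zero_div, mul_zero]

end imaginary

/-! ### Bethe roots -/

/-- The Bethe roots of sector `ξ`. -/
def IsBetheRoot (N : ℕ) (τ : ℂ) (ξ : ℕ) (u : ℂ) : Prop :=
  u ∈ rootDomain τ ∧ thetaRatio τ u ^ N = (-1) ^ (ξ + 1)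

section roots
variable {τ : ℂ} (hre : τ.re = 0) (hτ : 0 < τ.im) {N : ℕ} (hN0 : 0 < N) (ξ : ℕ)

include hre hτ hN0

lemma IsBetheRoot.mem_rootLines {ξ : ℕ} {u : ℂ} (hu : IsBetheRoot N τ ξ u) : u ∈ rootLines τ := by
  refine mem_rootLines_of_norm_eq_one hre hτ hu.1 ?_
  have := congrArg norm hu.2
  rw [norm_pow, norm_pow, norm_neg, norm_one, one_pow] at this
  exact (pow_eq_one_iff_of_nonneg (norm_nonneg _) hN0.ne').mp this

/-- The `N` distinct `N`-th roots of `(-1) ^ (ξ + 1)` lie on the unit circle and each is a value of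
the ratio. -/
lemma exists_betheRoots : ∃ f : Fin N → ℂ, Function.Injective f ∧ ∀ k, IsBetheRoot N τ ξ (f k) := by
  obtain ⟨z, hz⟩ := IsAlgClosed.exists_pow_nat_eq ((-1 : ℂ) ^ (ξ + 1)) hN0
  have hprim := Complex.isPrimitiveRoot_exp N hN0.ne'
  set ζ := cexp (2 * Real.pi * I / N) with hζ
  have hz0 : z ≠ 0 := by
    rintro rfl
    rw [zero_pow hN0.ne'] at hz
    exact pow_ne_zero _ (by norm_num) hz.symm
  have hpow : ∀ k : ℕ, (z * ζ ^ k) ^ N = (-1) ^ (ξ + 1) := by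
    intro k
    rw [mul_pow, hz, ← pow_mul, mul_comm k N, pow_mul, hprim.pow_eq_one, one_pow, mul_one]
  have hnorm : ∀ k : ℕ, ‖z * ζ ^ k‖ = 1 := by
    intro k
    have := congrArg norm (hpow k)
    rw [norm_pow, norm_pow, norm_neg, norm_one, one_pow] at this
    exact (pow_eq_one_iff_of_nonneg (norm_nonneg _) hN0.ne').mp this
  choose f hf1 hf2 using fun k : Fin N => exists_thetaRatio_eq hre hτ (hnorm k)
  refine ⟨f, fun i j hij => ?_, fun k => ⟨(hf1 k).1, by rw [hf2, hpow]⟩⟩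
  have h : thetaRatio τ (f i) = thetaRatio τ (f j) := by rw [hij]
  rw [hf2, hf2] at h
  exact Fin.ext (hprim.pow_inj i.2 j.2 (mul_left_cancel₀ hz0 h))

lemma kinkAmplitude_add_period {ξ : ℕ} (hN : Even N) {u : ℂ} (hu : IsBetheRoot N τ ξ u) (n : ℕ) :
    kinkAmplitude τ (n + N) u = (-1) ^ (ξ + 1) * kinkAmplitude τ n u := by
  rcases Nat.even_or_odd n with hn | hn
  · rw [kinkAmplitude_even τ u hn, kinkAmplitude_even τ u (hn.add hN), pow_add, hu.2]; ring
  · have hl := hu.mem_rootLines hre hτ hN0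
    rw [kinkAmplitude_odd hre hτ hl hn, kinkAmplitude_odd hre hτ hl (hn.add_even hN), pow_add,
      hu.2]
    ring

end roots
/-! ### The Hamiltonian on products of qubit states -/

section chain
variable {N : ℕ}

lemma siteOp_pureTensor (A : Matrix (Fin 2) (Fin 2) ℂ) (n : Fin N) (φ : Fin N → Fin 2 → ℂ) :
    siteOp A n (pureTensor φ) = pureTensor (Function.update φ n (A.mulVec (φ n))) := by
  have split : ∀ (χ : Fin N → Fin 2 → ℂ) (s : Fin N → Fin 2),
      ∏ l, χ l (s l) = χ n (s n) * ∏ l ∈ Finset.univ.erase n, χ l (s l) :=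
    fun χ s => (Finset.mul_prod_erase _ _ (Finset.mem_univ n)).symm
  ext s
  simp only [siteOp, pureTensor, LinearMap.coe_mk, AddHom.coe_mk]
  rw [split, Function.update_self, Matrix.mulVec, dotProduct, Finset.sum_mul]
  refine Finset.sum_congr rfl fun t _ => ?_
  rw [split, Function.update_self, mul_assoc]
  congr 2
  refine Finset.prod_congr rfl fun l hl => ?_
  rw [Function.update_of_ne (Finset.ne_of_mem_erase hl),
    Function.update_of_ne (Finset.ne_of_mem_erase hl)]

lemma pureTensor_update_smul (φ : Fin N → Fin 2 → ℂ) (n : Fin N) (c : ℂ) (v : Fin 2 → ℂ) :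
    pureTensor (Function.update φ n (c • v)) = c • pureTensor (Function.update φ n v) := by
  ext s
  simp only [pureTensor, PiLp.smul_apply, smul_eq_mul]
  rw [← Finset.mul_prod_erase _ _ (Finset.mem_univ n),
    ← Finset.mul_prod_erase Finset.univ _ (Finset.mem_univ n), Function.update_self,
    Function.update_self, Pi.smul_apply, smul_eq_mul, mul_assoc]
  congr 2
  refine Finset.prod_congr rfl fun l hl => ?_
  rw [Function.update_of_ne (Finset.ne_of_mem_erase hl),
    Function.update_of_ne (Finset.ne_of_mem_erase hl)]

lemma stateSpace_inner_eq (v w : StateSpace N) : inner ℂ v w = ∑ s, conj (v s) * w s := by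
  rw [PiLp.inner_apply]
  refine Finset.sum_congr rfl fun s _ => ?_
  rw [RCLike.inner_apply, mul_comm]

lemma inner_siteOp {A : Matrix (Fin 2) (Fin 2) ℂ} (hA : ∀ i j, conj (A i j) = A j i) (n : Fin N)
    (v w : StateSpace N) : inner ℂ v (siteOp A n w) = inner ℂ (siteOp A n v) w := by
  rw [stateSpace_inner_eq, stateSpace_inner_eq]
  simp only [siteOp, LinearMap.coe_mk, AddHom.coe_mk, map_sum, Finset.mul_sum, Finset.sum_mul,
    ← Finset.sum_product']
  refine Finset.sum_nbij' (fun p => (Function.update p.1 n p.2, p.1 n))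
    (fun p => (Function.update p.1 n p.2, p.1 n)) ?_ ?_ ?_ ?_ ?_
  · simp
  · simp
  · rintro ⟨s, t⟩ _; simp
  · rintro ⟨s, t⟩ _; simp
  · rintro ⟨s, t⟩ _
    simp only [Function.update_self, Function.update_idem, Function.update_eq_self, map_mul, hA]
    ring

lemma pauliX_hermitian (i j : Fin 2) : conj (pauliX i j) = pauliX j i := by
  fin_cases i <;> fin_cases j <;> simp [pauliX]

lemma pauliY_hermitian (i j : Fin 2) : conj (pauliY i j) = pauliY j i := by
  fin_cases i <;> fin_cases j <;> simp [pauliY]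

lemma I_zpow_congr {a b : ℤ} (h : a ≡ b [ZMOD 4]) : (I : ℂ) ^ a = I ^ b := by
  obtain ⟨c, hc⟩ := h.symm.dvd
  rw [show a = b + 4 * c by omega, zpow_add₀ I_ne_zero, zpow_mul]
  have : (I : ℂ) ^ (4 : ℤ) = 1 := by exact_mod_cast I_pow_four
  rw [this, one_zpow, mul_one]

lemma qubit_congr {a b : ℤ} (h : a ≡ b [ZMOD 4]) : qubit a = qubit b := by
  rw [qubit, qubit, I_zpow_congr h]

lemma pauliX_mulVec_qubit (k : ℤ) : pauliX.mulVec (qubit k) = I ^ k • qubit (-k) := by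
  ext i
  have := zpow_ne_zero k I_ne_zero
  fin_cases i <;> simp [pauliX, qubit, Matrix.mulVec, dotProduct, Fin.sum_univ_two] <;> field_simp

lemma pauliY_mulVec_qubit (k : ℤ) : pauliY.mulVec (qubit k) = I ^ (k - 1) • qubit (2 - k) := by
  have h0 := zpow_ne_zero k I_ne_zero
  have h2 : (I : ℂ) ^ (2 : ℤ) = -1 := by exact_mod_cast I_sq
  ext i
  fin_cases i
  · simp [pauliY, qubit, Matrix.mulVec, dotProduct, Fin.sum_univ_two, zpow_sub₀ I_ne_zero]
    ring
  · simp [pauliY, qubit, Matrix.mulVec, dotProduct, Fin.sum_univ_two, zpow_sub₀ I_ne_zero, h2]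
    field_simp

/-- The product of the qubit states `ψ(a l)`. -/
noncomputable def qubitProduct (a : Fin N → ℤ) : StateSpace N := pureTensor fun l => qubit (a l)

lemma qubitProduct_congr {a b : Fin N → ℤ} (h : ∀ l, a l ≡ b l [ZMOD 4]) :
    qubitProduct a = qubitProduct b := by
  rw [qubitProduct, qubitProduct]
  congr 1
  ext1 l
  exact qubit_congr (h l)

/-- Reversal of the qubit at the site `m`. -/
def flip (m : Fin N) (a : Fin N → ℤ) : Fin N → ℤ := Function.update a m (a m + 2)

lemma siteOp_qubitProduct {A : Matrix (Fin 2) (Fin 2) ℂ} {m : Fin N} {a : Fin N → ℤ} {c : ℂ} {k : ℤ}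
    (h : A.mulVec (qubit (a m)) = c • qubit k) :
    siteOp A m (qubitProduct a) = c • qubitProduct (Function.update a m k) := by
  rw [qubitProduct, siteOp_pureTensor, h, pureTensor_update_smul, qubitProduct]
  congr 2
  ext1 l
  rcases eq_or_ne l m with rfl | hl
  · simp
  · rw [Function.update_of_ne hl, Function.update_of_ne hl]

lemma qubitProduct_update_congr {m : Fin N} {a : Fin N → ℤ} {j k : ℤ} (h : j ≡ k [ZMOD 4]) :
    qubitProduct (Function.update a m j) = qubitProduct (Function.update a m k) :=
  qubitProduct_congr fun l => by
    rcases eq_or_ne l m with rfl | hl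
    · simpa using h
    · rw [Function.update_of_ne hl, Function.update_of_ne hl]

lemma siteOp_pauliX_even {m : Fin N} {a : Fin N → ℤ} (h : Even (a m)) :
    siteOp pauliX m (qubitProduct a) = I ^ (a m) • qubitProduct a := by
  rw [siteOp_qubitProduct (pauliX_mulVec_qubit _)]
  congr 1
  conv_rhs => rw [← Function.update_eq_self m a]
  obtain ⟨c, hc⟩ := h
  exact qubitProduct_update_congr (Int.modEq_iff_dvd.mpr ⟨c, by omega⟩)

lemma siteOp_pauliX_odd {m : Fin N} {a : Fin N → ℤ} (h : Odd (a m)) :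
    siteOp pauliX m (qubitProduct a) = I ^ (a m) • qubitProduct (flip m a) := by
  rw [siteOp_qubitProduct (pauliX_mulVec_qubit _)]
  congr 1
  obtain ⟨c, hc⟩ := h
  exact qubitProduct_update_congr (Int.modEq_iff_dvd.mpr ⟨c + 1, by omega⟩)

lemma siteOp_pauliY_even {m : Fin N} {a : Fin N → ℤ} (h : Even (a m)) :
    siteOp pauliY m (qubitProduct a) = I ^ (a m - 1) • qubitProduct (flip m a) := by
  rw [siteOp_qubitProduct (pauliY_mulVec_qubit _)]
  congr 1
  obtain ⟨c, hc⟩ := h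
  exact qubitProduct_update_congr (Int.modEq_iff_dvd.mpr ⟨c, by omega⟩)

lemma siteOp_pauliY_odd {m : Fin N} {a : Fin N → ℤ} (h : Odd (a m)) :
    siteOp pauliY m (qubitProduct a) = I ^ (a m - 1) • qubitProduct a := by
  rw [siteOp_qubitProduct (pauliY_mulVec_qubit _)]
  congr 1
  conv_rhs => rw [← Function.update_eq_self m a]
  obtain ⟨c, hc⟩ := h
  exact qubitProduct_update_congr (Int.modEq_iff_dvd.mpr ⟨c, by omega⟩)

/-- The signed coupling multiplying the reversal of a qubit. -/
noncomputable def flipCoupling (Jx Jy : ℂ) (k : ℤ) : ℂ := if Even k then -Jy else Jx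

/-- The `σˣσˣ` term reverses the qubit with odd label, the `σʸσʸ` term the one with even label. The
sign in `flipCoupling` comes from the two shifts in `I ^ (k - 1)`. -/
lemma bond_qubitProduct (Jx Jy : ℂ) {l m : Fin N} (hlm : l ≠ m) {a : Fin N → ℤ}
    (hpar : Even (a l) ↔ Odd (a m)) :
    Jx • siteOp pauliX m (siteOp pauliX l (qubitProduct a))
      + Jy • siteOp pauliY m (siteOp pauliY l (qubitProduct a))
    = (flipCoupling Jx Jy (a l) * I ^ (a l + a m)) • qubitProduct (flip l a)
      + (flipCoupling Jx Jy (a m) * I ^ (a l + a m)) • qubitProduct (flip m a) := by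
  have hf : flip l a m = a m := Function.update_of_ne hlm.symm _ _
  have h2 : (I : ℂ) ^ (a l - 1) * I ^ (a m - 1) = -I ^ (a l + a m) := by
    have : (I : ℂ) ^ (2 : ℤ) = -1 := by exact_mod_cast I_sq
    rw [← zpow_add₀ I_ne_zero, show a l - 1 + (a m - 1) = a l + a m - 2 by ring,
      zpow_sub₀ I_ne_zero, this, div_neg, div_one]
  rcases Int.even_or_odd (a l) with h | h
  · have h' := hpar.mp h
    rw [siteOp_pauliX_even h, siteOp_pauliY_even h, map_smul, map_smul, siteOp_pauliX_odd h',
      siteOp_pauliY_odd (by rwa [hf]), hf, flipCoupling, flipCoupling, if_pos h,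
      if_neg (Int.not_even_iff_odd.mpr h'), smul_smul, smul_smul, smul_smul, smul_smul, mul_assoc,
      mul_assoc, h2,
      ← zpow_add₀ I_ne_zero, add_comm]
    simp
  · have h' : Even (a m) := by
      rw [← Int.not_odd_iff_even, ← hpar, Int.not_even_iff_odd]; exact h
    rw [siteOp_pauliX_odd h, siteOp_pauliY_odd h, map_smul, map_smul, siteOp_pauliY_even h',
      siteOp_pauliX_even (by rwa [hf]), hf, flipCoupling, flipCoupling, if_pos h',
      if_neg (Int.not_even_iff_odd.mpr h), smul_smul, smul_smul, smul_smul, smul_smul, mul_assoc,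
      mul_assoc, h2,
      ← zpow_add₀ I_ne_zero]
    simp

/-- Taking adjoints reverses the order of the two factors of each bond, so their commutation is not
needed. -/
lemma inner_hamiltonianXY (Jx Jy : ℂ) (hJx : conj Jx = Jx) (hJy : conj Jy = Jy)
    (v w : StateSpace N) : inner ℂ v (hamiltonianXY N Jx Jy w)
      = inner ℂ (∑ n : Fin N, (Jx • siteOp pauliX (finRotate N n) (siteOp pauliX n v)
        + Jy • siteOp pauliY (finRotate N n) (siteOp pauliY n v))) w := by
  simp only [hamiltonianXY, LinearMap.sum_apply, LinearMap.add_apply, LinearMap.smul_apply,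
    LinearMap.comp_apply, inner_sum, sum_inner, inner_add_left, inner_add_right, inner_smul_left,
    inner_smul_right, hJx, hJy, inner_siteOp pauliX_hermitian, inner_siteOp pauliY_hermitian]

lemma finRotate_ne_self (hN : Even N) (n : Fin N) : n ≠ finRotate N n := by
  obtain ⟨k, hk⟩ := hN
  obtain ⟨M, rfl⟩ : ∃ M, N = M + 1 := ⟨N - 1, by have := n.2; omega⟩
  intro h
  rw [finRotate_apply] at h
  have h1 := congrArg Fin.val h
  rw [Fin.val_add_one] at h1
  split_ifs at h1 with h2
  · rw [h2] at h1; simp at h1; omega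
  · omega

lemma inner_qubitProduct_hamiltonianXY (hN : Even N) (Jx Jy : ℂ) (hJx : conj Jx = Jx)
    (hJy : conj Jy = Jy) {a : Fin N → ℤ} (ha : ∀ l, Even (a l) ↔ Odd (a (finRotate N l)))
    (w : StateSpace N) : inner ℂ (qubitProduct a) (hamiltonianXY N Jx Jy w)
      = ∑ m, flipCoupling Jx Jy (a m) * (I ^ (-(a m + a (finRotate N m)))
        + I ^ (-(a ((finRotate N).symm m) + a m))) * inner ℂ (qubitProduct (flip m a)) w := by
  have hc : ∀ k : ℤ, conj (flipCoupling Jx Jy k) = flipCoupling Jx Jy k := by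
    intro k
    rw [flipCoupling]; split_ifs <;> simp [hJx, hJy]
  have hI : ∀ k : ℤ, conj ((I : ℂ) ^ k) = I ^ (-k) := by
    intro k
    rw [map_zpow₀, conj_I, ← Complex.inv_I, inv_zpow, zpow_neg]
  rw [inner_hamiltonianXY _ _ hJx hJy]
  simp only [fun n => bond_qubitProduct Jx Jy (finRotate_ne_self hN n) (ha n), sum_inner,
    inner_add_left, inner_smul_left, map_mul, hc, hI, Finset.sum_add_distrib]
  -- Regrouping by the reversed site `m` instead of by bonds: `m` belongs to the bonds towards its
  -- successor and from its predecessor.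
  have e := Equiv.sum_comp (finRotate N) (fun m => flipCoupling Jx Jy (a m)
    * I ^ (-(a ((finRotate N).symm m) + a m)) * inner ℂ (qubitProduct (flip m a)) w)
  simp only [Equiv.symm_apply_apply] at e
  rw [e, ← Finset.sum_add_distrib]
  refine Finset.sum_congr rfl fun m _ => ?_
  ring

end chain
/-! ### Orthonormality of the chiral states -/

section chiral
variable {N M : ℕ}

/-- The exponents of the qubit states in a chiral state. -/
def chiralLabel (κ : ℤ) (n : Fin M → Fin N) (l : Fin N) : ℤ :=
  (siteNumber l : ℤ) - 2 * (kinksBefore n l : ℤ) - κ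

lemma chiralState_eq (κ : ℤ) (n : Fin M → Fin N) :
    chiralState κ n = (-I) ^ (∑ j, siteNumber (n j)) • qubitProduct (chiralLabel κ n) := rfl

lemma card_filter_le_eq {n : Fin M → Fin N} (hn : Function.Injective n) (l : Fin N)
    [Decidable (l ∈ Set.range n)] :
    (Finset.univ.filter fun j => n j ≤ l).card
      = kinksBefore n l + if l ∈ Set.range n then 1 else 0 := by
  have h1 : (Finset.univ.filter fun j => n j ≤ l)
      = (Finset.univ.filter fun j => n j < l) ∪ (Finset.univ.filter fun j => n j = l) := by
    ext j; simp [le_iff_lt_or_eq]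
  have h2 : Disjoint (Finset.univ.filter fun j => n j < l) (Finset.univ.filter fun j => n j = l) := by
    rw [Finset.disjoint_filter]
    intro j _ h h'
    exact h.ne h'
  rw [h1, Finset.card_union_of_disjoint h2, kinksBefore]
  congr 1
  split_ifs with h
  · obtain ⟨j, rfl⟩ := h
    rw [Finset.card_eq_one]
    exact ⟨j, by ext i; simp [hn.eq_iff]⟩
  · rw [Finset.card_eq_zero, Finset.filter_eq_empty_iff]
    intro j _ hj
    exact h ⟨j, hj⟩

lemma kinksBefore_of_val_eq_succ (n : Fin M → Fin N) {l m : Fin N} (h : (m : ℕ) = l + 1) :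
    kinksBefore n m = (Finset.univ.filter fun j => n j ≤ l).card := by
  rw [kinksBefore]
  congr 1
  ext j
  simp only [Finset.mem_filter, Finset.mem_univ, true_and, Fin.lt_def, Fin.le_def]
  omega

lemma kinksBefore_of_val_eq_zero (n : Fin M → Fin N) {l : Fin N} (h : (l : ℕ) = 0) :
    kinksBefore n l = 0 := by
  rw [kinksBefore, Finset.card_eq_zero, Finset.filter_eq_empty_iff]
  intro j _
  rw [Fin.lt_def]; omega

lemma card_filter_le_last (n : Fin M → Fin N) {l : Fin N} (h : (l : ℕ) + 1 = N) :
    (Finset.univ.filter fun j => n j ≤ l).card = M := by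
  rw [Finset.filter_true_of_mem, Finset.card_univ, Fintype.card_fin]
  intro j _
  have := (n j).2
  rw [Fin.le_def]; omega

lemma finRotate_val_cases (l : Fin N) : ((finRotate N l : Fin N) : ℕ) = l + 1 ∨
    (((finRotate N l : Fin N) : ℕ) = 0 ∧ (l : ℕ) + 1 = N) := by
  obtain ⟨K, rfl⟩ : ∃ K, N = K + 1 := ⟨N - 1, by have := l.2; omega⟩
  rw [finRotate_apply, Fin.val_add_one]
  split_ifs with h
  · right; exact ⟨rfl, by rw [h]; simp⟩
  · left; rfl

/-- The label goes up by one past an empty site and down by one past a kink. Across the boundary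
this requires `N ≡ 2M` mod 4, which is admissibility of `M`. -/
lemma chiralLabel_finRotate {n : Fin M → Fin N} (hn : Function.Injective n) (hN : Even N)
    (hM : M % 2 = (N / 2) % 2) (κ : ℤ) (l : Fin N) [Decidable (l ∈ Set.range n)] :
    chiralLabel κ n (finRotate N l)
      ≡ chiralLabel κ n l + 1 - 2 * (if l ∈ Set.range n then 1 else 0) [ZMOD 4] := by
  have h := card_filter_le_eq hn l
  obtain ⟨K, hK⟩ := hN
  rw [Int.modEq_iff_dvd, chiralLabel, chiralLabel, siteNumber, siteNumber]
  rcases finRotate_val_cases l with h1 | ⟨h1, h2⟩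
  · rw [kinksBefore_of_val_eq_succ n h1, h, h1]
    refine ⟨0, ?_⟩
    split_ifs <;> push_cast <;> ring
  · rw [card_filter_le_last n h2] at h
    rw [kinksBefore_of_val_eq_zero n h1, h1]
    have : (N : ℤ) = l + 1 := by exact_mod_cast h2.symm
    split_ifs at h ⊢ <;> omega

lemma chiralLabel_even_iff {κ : ℤ} (hκ : κ = 1 ∨ κ = -1) (n : Fin M → Fin N) (l : Fin N) :
    Even (chiralLabel κ n l) ↔ Odd (siteNumber l) := by
  rw [chiralLabel, Int.even_iff, Nat.odd_iff]
  rcases hκ with rfl | rfl <;> omega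

lemma siteNumber_finRotate_odd_iff (hN : Even N) (l : Fin N) :
    Odd (siteNumber (finRotate N l)) ↔ Even (siteNumber l) := by
  rw [siteNumber, siteNumber, Nat.odd_iff, Nat.even_iff]
  obtain ⟨K, hK⟩ := hN
  rcases finRotate_val_cases l with h1 | ⟨h1, h2⟩ <;> omega

lemma inner_qubitProduct (a b : Fin N → ℤ) :
    inner ℂ (qubitProduct a) (qubitProduct b) = ∏ l, (1 + I ^ (b l - a l)) / 2 := by
  rw [stateSpace_inner_eq]
  simp only [qubitProduct, pureTensor, map_prod, ← Finset.prod_mul_distrib]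
  have e := Finset.prod_univ_sum (fun _ : Fin N => (Finset.univ : Finset (Fin 2)))
    (fun l t => conj (qubit (a l) t) * qubit (b l) t)
  rw [Fintype.piFinset_univ] at e
  rw [← e]
  refine Finset.prod_congr rfl fun l _ => ?_
  have hI : conj ((I : ℂ) ^ (a l)) = I ^ (-(a l)) := by
    rw [map_zpow₀, conj_I, ← Complex.inv_I, inv_zpow, zpow_neg]
  have h2 : ((Real.sqrt 2 : ℝ) : ℂ) * (Real.sqrt 2 : ℝ) = 2 := by
    rw [← Complex.ofReal_mul, Real.mul_self_sqrt (by norm_num)]; norm_num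
  rw [Fin.sum_univ_two]
  simp only [qubit, Matrix.cons_val_zero, Matrix.cons_val_one, map_div₀, map_one,
    Complex.conj_ofReal, hI, div_mul_div_comm, h2]
  rw [← zpow_add₀ I_ne_zero]
  ring_nf

lemma inner_qubitProduct_self (a : Fin N → ℤ) :
    inner ℂ (qubitProduct a) (qubitProduct a) = 1 := by
  rw [inner_qubitProduct]
  refine Finset.prod_eq_one fun l _ => ?_
  simp

lemma inner_chiralState_left (κ : ℤ) (n : Fin M → Fin N) (w : StateSpace N) :
    inner ℂ (chiralState κ n) w
      = I ^ (∑ j, siteNumber (n j)) * inner ℂ (qubitProduct (chiralLabel κ n)) w := by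
  rw [chiralState_eq, inner_smul_left, map_pow, map_neg, conj_I, neg_neg]

lemma inner_chiralState_self (κ : ℤ) (n : Fin M → Fin N) :
    inner ℂ (chiralState κ n) (chiralState κ n) = 1 := by
  rw [inner_chiralState_left, chiralState_eq, inner_smul_right, inner_qubitProduct_self, mul_one,
    ← mul_pow, mul_neg, I_mul_I, neg_neg, one_pow]

/-- Labels at a site agree in parity, so each factor of the overlap is `1` or `0` according to their
difference mod 4. If no factor vanishes, the first site, with no kinks before it, determines `κ`;
the parities of the kink counts before each site, together with the parity of the total, then
determine the kink set. -/
lemma inner_chiralState_eq_zero {M' : ℕ} {n : Fin M → Fin N} {n' : Fin M' → Fin N}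
    (hn : Function.Injective n) (hn' : Function.Injective n') (hM : M % 2 = M' % 2) (hN0 : 0 < N)
    {κ κ' : ℤ} (hκ : κ = 1 ∨ κ = -1) (hκ' : κ' = 1 ∨ κ' = -1)
    (h : ¬(κ = κ' ∧ Set.range n = Set.range n')) :
    inner ℂ (chiralState κ n) (chiralState κ' n') = 0 := by
  classical
  contrapose! h
  rw [inner_chiralState_left, chiralState_eq, inner_smul_right, inner_qubitProduct] at h
  have hp := right_ne_zero_of_mul (right_ne_zero_of_mul h)
  rw [Finset.prod_ne_zero_iff] at hp
  have h4 : ∀ l, (4 : ℤ) ∣ chiralLabel κ' n' l - chiralLabel κ n l := by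
    intro l
    have hl := hp l (Finset.mem_univ l)
    by_contra hd
    apply hl
    have hk : chiralLabel κ' n' l - chiralLabel κ n l ≡ 2 [ZMOD 4] := by
      rw [chiralLabel, chiralLabel] at hd ⊢
      rw [Int.ModEq]
      rcases hκ with rfl | rfl <;> rcases hκ' with rfl | rfl <;> omega
    have h2 : (I : ℂ) ^ (2 : ℤ) = -1 := by exact_mod_cast I_sq
    rw [I_zpow_congr hk, h2]; norm_num
  have hk : κ = κ' := by
    have := h4 ⟨0, hN0⟩
    rw [chiralLabel, chiralLabel, kinksBefore_of_val_eq_zero n rfl,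
      kinksBefore_of_val_eq_zero n' rfl] at this
    rcases hκ with rfl | rfl <;> rcases hκ' with rfl | rfl <;> omega
  subst hk
  refine ⟨rfl, ?_⟩
  have hkb : ∀ l, kinksBefore n l % 2 = kinksBefore n' l % 2 := by
    intro l
    have := h4 l
    rw [chiralLabel, chiralLabel] at this
    omega
  ext l
  have e1 := card_filter_le_eq hn l
  have e2 := card_filter_le_eq hn' l
  have e0 := hkb l
  have e3 : (Finset.univ.filter fun j => n j ≤ l).card % 2
      = (Finset.univ.filter fun j => n' j ≤ l).card % 2 := by
    rcases finRotate_val_cases l with h1 | ⟨h1, h2⟩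
    · rw [← kinksBefore_of_val_eq_succ n h1, ← kinksBefore_of_val_eq_succ n' h1]
      exact hkb _
    · rw [card_filter_le_last n h2, card_filter_le_last n' h2]; exact hM
  by_cases m1 : l ∈ Set.range n <;> by_cases m2 : l ∈ Set.range n' <;>
    simp only [m1, m2, if_true, if_false, iff_self, iff_false, iff_true, not_true] at e1 e2 ⊢ <;> omega

lemma card_eq_of_range_eq {M' : ℕ} {n : Fin M → Fin N} {n' : Fin M' → Fin N}
    (hn : Function.Injective n) (hn' : Function.Injective n') (h : Set.range n = Set.range n') :
    M = M' := by
  have := congrArg Set.ncard h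
  rwa [Set.ncard_range_of_injective hn, Set.ncard_range_of_injective hn', Nat.card_fin,
    Nat.card_fin] at this

/-- The overlap of a chiral state with a Bethe state. -/
lemma inner_chiralState_betheState {n : Fin M → Fin N} (hn : StrictMono n) (hN0 : 0 < N) {κ : ℤ}
    (hκ : κ = 1 ∨ κ = -1) (τ : ℂ) (ξ : ℕ) (u : Fin M → ℂ) :
    inner ℂ (chiralState κ n) (betheState τ ξ u : StateSpace N)
      = chiralAmplitude τ u n * (κ : ℂ) ^ ξ := by
  classical
  rw [betheState, inner_sum, Finset.sum_eq_single n]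
  · rw [inner_sum, Finset.sum_eq_single κ]
    · rw [inner_smul_right, inner_chiralState_self, mul_one]
    · intro κ' hκ' hne
      rw [inner_smul_right, inner_chiralState_eq_zero hn.injective hn.injective rfl hN0 hκ
        (by simpa using hκ') (fun h => hne h.1.symm), mul_zero]
    · intro h; exact absurd (by simpa using hκ) h
  · intro n' hn' hne
    rw [Finset.mem_filter] at hn'
    rw [inner_sum]
    refine Finset.sum_eq_zero fun κ' hκ' => ?_
    rw [inner_smul_right, inner_chiralState_eq_zero hn.injective hn'.2.injective rfl hN0 hκ
        (by simpa using hκ') (fun h => hne (hn'.2.range_inj hn |>.mp h.2.symm)), mul_zero]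
  · intro h; exact absurd (by simpa using hn) h

lemma inner_chiralState_betheState_of_ne {M' : ℕ} {n : Fin M → Fin N} (hn : StrictMono n)
    (hN0 : 0 < N) {κ : ℤ} (hκ : κ = 1 ∨ κ = -1) (τ : ℂ) (ξ : ℕ) (u : Fin M' → ℂ)
    (hM : M % 2 = M' % 2) (hne : M ≠ M') :
    inner ℂ (chiralState κ n) (betheState τ ξ u : StateSpace N) = 0 := by
  rw [betheState, inner_sum]
  refine Finset.sum_eq_zero fun n' hn' => ?_
  rw [Finset.mem_filter] at hn'
  rw [inner_sum]
  refine Finset.sum_eq_zero fun κ' hκ' => ?_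
  rw [inner_smul_right, inner_chiralState_eq_zero hn.injective hn'.2.injective hM hN0 hκ
    (by simpa using hκ') (fun h => hne (card_eq_of_range_eq hn.injective hn'.2.injective h.2)),
    mul_zero]

end chiral
/-! ### Hopping of kinks -/

section hopping
variable {N M : ℕ}

lemma kinksBefore_comp_perm (v : Fin M → Fin N) (π : Equiv.Perm (Fin M)) (l : Fin N) :
    kinksBefore (v ∘ π) l = kinksBefore v l := by
  rw [kinksBefore, kinksBefore, Finset.card_filter, Finset.card_filter]
  exact Equiv.sum_comp π fun j => if v j < l then 1 else 0

lemma kinksBefore_update (n : Fin M → Fin N) (j : Fin M) (y l : Fin N) :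
    kinksBefore (Function.update n j y) l + (if n j < l then 1 else 0)
      = kinksBefore n l + if y < l then 1 else 0 := by
  rw [kinksBefore, kinksBefore, Finset.card_filter, Finset.card_filter,
    ← Finset.add_sum_erase _ _ (Finset.mem_univ j),
    ← Finset.add_sum_erase Finset.univ (fun i => if n i < l then 1 else 0) (Finset.mem_univ j),
    Function.update_self]
  have : ∑ x ∈ Finset.univ.erase j, (if Function.update n j y x < l then 1 else 0)
      = ∑ x ∈ Finset.univ.erase j, if n x < l then 1 else 0 :=
    Finset.sum_congr rfl fun i hi => by
      rw [Function.update_of_ne (Finset.ne_of_mem_erase hi)]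
  rw [this]; ring

lemma sum_siteNumber_update (n : Fin M → Fin N) (j : Fin M) (y : Fin N) :
    ∑ i, siteNumber (Function.update n j y i) + siteNumber (n j)
      = ∑ i, siteNumber (n i) + siteNumber y := by
  rw [← Finset.add_sum_erase _ _ (Finset.mem_univ j),
    ← Finset.add_sum_erase Finset.univ (fun i => siteNumber (n i)) (Finset.mem_univ j),
    Function.update_self]
  have : ∑ x ∈ Finset.univ.erase j, siteNumber (Function.update n j y x)
      = ∑ x ∈ Finset.univ.erase j, siteNumber (n x) :=
    Finset.sum_congr rfl fun i hi => by
      rw [Function.update_of_ne (Finset.ne_of_mem_erase hi)]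
  rw [this]; ring

lemma flip_apply (m : Fin N) (a : Fin N → ℤ) (l : Fin N) :
    flip m a l = a l + if l = m then 2 else 0 := by
  rw [flip, Function.update_apply]
  split_ifs with h
  · rw [h]
  · rw [add_zero]

/-- Moving a kink across `m` changes the kink count before `m` by one and no other count, and one
kink is worth `2` in the label. -/
lemma flip_chiralLabel_bulk (κ : ℤ) (n : Fin M → Fin N) (j : Fin M) {m y : Fin N}
    (h : ((n j : ℕ) = m ∧ (y : ℕ) + 1 = m) ∨ ((n j : ℕ) + 1 = m ∧ (y : ℕ) = m)) (l : Fin N) :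
    flip m (chiralLabel κ n) l ≡ chiralLabel κ (Function.update n j y) l [ZMOD 4] := by
  have hk := kinksBefore_update n j y l
  rw [flip_apply, chiralLabel, chiralLabel, Int.modEq_iff_dvd]
  simp only [Fin.lt_def, Fin.ext_iff] at hk ⊢
  split_ifs at hk ⊢ <;> omega

/-- Moving a kink between the first and the last site changes the labels by `2` mod 4 everywhere
except at the first site. Replacing `κ` by `-κ` changes all labels by `2`, so only the first qubit
is reversed. -/
lemma flip_chiralLabel_wrap {κ : ℤ} (hκ : κ = 1 ∨ κ = -1) (n : Fin M → Fin N) (j : Fin M)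
    {m y : Fin N} (hm : (m : ℕ) = 0)
    (h : (n j = m ∧ (y : ℕ) + 1 = N) ∨ ((n j : ℕ) + 1 = N ∧ y = m)) (l : Fin N) :
    flip m (chiralLabel κ n) l ≡ chiralLabel (-κ) (Function.update n j y) l [ZMOD 4] := by
  have hk := kinksBefore_update n j y l
  rw [flip_apply, chiralLabel, chiralLabel, Int.modEq_iff_dvd]
  simp only [Fin.lt_def, Fin.ext_iff] at hk h ⊢
  have := l.2
  split_ifs at hk ⊢ <;> rcases hκ with rfl | rfl <;> omega

lemma strictMono_update {n : Fin M → Fin N} (hn : StrictMono n) {j : Fin M} {y : Fin N}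
    (hy : y ∉ Set.range n) (h : (n j : ℕ) = y + 1 ∨ (y : ℕ) = n j + 1) :
    StrictMono (Function.update n j y) := by
  have hne : ∀ i, (n i : ℕ) ≠ y := fun i hi => hy ⟨i, Fin.ext hi⟩
  intro i k hik
  have hik' := Fin.lt_def.mp (hn hik)
  rw [Fin.lt_def]
  by_cases hi : i = j
  · subst hi
    rw [Function.update_self, Function.update_of_ne hik.ne']
    have := hne k
    omega
  · rw [Function.update_of_ne hi]
    by_cases hk : k = j
    · subst hk
      rw [Function.update_self]
      have := hne i
      omega
    · rwa [Function.update_of_ne hk]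

/-- The moved kink passes all the others; the `M`-cycle that sorts the list again has sign `(-1) ^
(M - 1)`. -/
lemma exists_perm_strictMono_wrap_down {n : Fin M → Fin N} (hn : StrictMono n) {j : Fin M} {y : Fin N}
    (hy : y ∉ Set.range n) (hj : (n j : ℕ) = 0) (hy' : (y : ℕ) + 1 = N) :
    ∃ π : Equiv.Perm (Fin M), StrictMono (Function.update n j y ∘ π) ∧
      ((Equiv.Perm.sign π : ℤ) : ℂ) = -(-1) ^ M := by
  obtain ⟨K, rfl⟩ : ∃ K, M = K + 1 := ⟨M - 1, by have := j.2; omega⟩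
  have hj0 : j = 0 := by
    by_contra hne
    have := Fin.lt_def.mp (hn (Fin.pos_iff_ne_zero.mpr hne))
    omega
  subst hj0
  refine ⟨finRotate (K + 1), ?_, by rw [sign_finRotate]; push_cast; ring⟩
  have hlast : (Function.update n 0 y ∘ finRotate (K + 1)) (Fin.last K) = y := by
    rw [Function.comp_apply, finRotate_last, Function.update_self]
  have hcast : ∀ i : Fin K, (Function.update n 0 y ∘ finRotate (K + 1)) i.castSucc = n i.succ := by
    intro i
    rw [Function.comp_apply, finRotate_apply, Fin.coeSucc_eq_succ,
      Function.update_of_ne (Fin.succ_ne_zero i)]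
  intro i k hik
  induction k using Fin.lastCases with
  | last =>
    induction i using Fin.lastCases with
    | last => exact absurd hik (lt_irrefl _)
    | cast i =>
      rw [hlast, hcast, Fin.lt_def]
      have h1 := (n i.succ).2
      have h2 : (n i.succ : ℕ) ≠ y := fun h => hy ⟨_, Fin.ext h⟩
      omega
  | cast k =>
    induction i using Fin.lastCases with
    | last => exact absurd (hik.trans (Fin.castSucc_lt_last k)) (lt_irrefl _)
    | cast i =>
      rw [hcast, hcast]
      exact hn (Fin.succ_lt_succ_iff.mpr (Fin.castSucc_lt_castSucc_iff.mp hik))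

lemma exists_perm_strictMono_wrap_up {n : Fin M → Fin N} (hn : StrictMono n) {j : Fin M} {y : Fin N}
    (hy : y ∉ Set.range n) (hj : (n j : ℕ) + 1 = N) (hy' : (y : ℕ) = 0) :
    ∃ π : Equiv.Perm (Fin M), StrictMono (Function.update n j y ∘ π) ∧
      ((Equiv.Perm.sign π : ℤ) : ℂ) = -(-1) ^ M := by
  obtain ⟨K, rfl⟩ : ∃ K, M = K + 1 := ⟨M - 1, by have := j.2; omega⟩
  have hjl : j = Fin.last K := by
    by_contra hne
    have := Fin.lt_def.mp (hn (Fin.lt_last_iff_ne_last.mpr hne))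
    have := (n (Fin.last K)).2
    omega
  subst hjl
  refine ⟨(finRotate (K + 1)).symm, ?_, by
    rw [Equiv.Perm.sign_symm, sign_finRotate]; push_cast; ring⟩
  have hzero : (Function.update n (Fin.last K) y ∘ (finRotate (K + 1)).symm) 0 = y := by
    rw [Function.comp_apply, ← finRotate_last, Equiv.symm_apply_apply, Function.update_self]
  have hsucc : ∀ i : Fin K,
      (Function.update n (Fin.last K) y ∘ (finRotate (K + 1)).symm) i.succ = n i.castSucc := by
    intro i
    have : (finRotate (K + 1)).symm i.succ = i.castSucc := by
      rw [Equiv.symm_apply_eq, finRotate_apply, Fin.coeSucc_eq_succ]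
    rw [Function.comp_apply, this, Function.update_of_ne (Fin.castSucc_lt_last i).ne]
  intro i k hik
  induction i using Fin.cases with
  | zero =>
    induction k using Fin.cases with
    | zero => exact absurd hik (lt_irrefl _)
    | succ k =>
      rw [hzero, hsucc, Fin.lt_def]
      have h2 : (n k.castSucc : ℕ) ≠ y := fun h => hy ⟨_, Fin.ext h⟩
      omega
  | succ i =>
    induction k using Fin.cases with
    | zero => exact absurd hik (Fin.not_lt_zero _)
    | succ k =>
      rw [hsucc, hsucc]
      exact hn (Fin.castSucc_lt_castSucc_iff.mpr (Fin.succ_lt_succ_iff.mp hik))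

/-- The coupling of the bond to the left of site number `p`, as seen by a kink. -/
noncomputable def kinkCoupling (Jx Jy : ℂ) (p : ℕ) : ℂ := if Odd p then Jy else Jx

/-- The bond phases are `I ^ (-2a ∓ 1)`, the sign depending on whether a kink is present. The factor
`I ^ (-2a) = ±1` absorbs the sign of `flipCoupling`, so that only the parity of the site survives in
the coupling, and equal occupations of the two sites cancel. -/
lemma flip_coefficient {n : Fin M → Fin N} (hn : Function.Injective n) (hN : Even N)
    (hM : M % 2 = (N / 2) % 2) {κ : ℤ} (hκ : κ = 1 ∨ κ = -1) (Jx Jy : ℂ) (m : Fin N)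
    [Decidable (m ∈ Set.range n)] [Decidable ((finRotate N).symm m ∈ Set.range n)] :
    flipCoupling Jx Jy (chiralLabel κ n m) *
      (I ^ (-(chiralLabel κ n m + chiralLabel κ n (finRotate N m)))
        + I ^ (-(chiralLabel κ n ((finRotate N).symm m) + chiralLabel κ n m)))
    = 2 * kinkCoupling Jx Jy (siteNumber m) * I *
      ((if (finRotate N).symm m ∈ Set.range n then 1 else 0) - if m ∈ Set.range n then 1 else 0) := by
  have h1 := chiralLabel_finRotate hn hN hM κ m
  have h2 := chiralLabel_finRotate hn hN hM κ ((finRotate N).symm m)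
  rw [Equiv.apply_symm_apply] at h2
  have hpar := chiralLabel_even_iff hκ n m
  set a := chiralLabel κ n m
  set b := chiralLabel κ n (finRotate N m)
  set c := chiralLabel κ n ((finRotate N).symm m)
  have e1 : ((I : ℂ) ^ (-1 : ℤ)) = -I := by rw [zpow_neg_one, inv_I]
  have e2 : (I : ℂ) ^ (1 : ℤ) = I := zpow_one I
  rw [flipCoupling, kinkCoupling]
  rw [Int.modEq_iff_dvd] at h1 h2
  have key : ∀ k r : ℤ, (4 : ℤ) ∣ r - k → (I : ℂ) ^ k = I ^ r :=
    fun k r h => I_zpow_congr (Int.modEq_iff_dvd.mpr h)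
  by_cases ha : Even a
  · have hs := hpar.mp ha
    rw [if_pos ha, if_pos hs]
    obtain ⟨d, hd⟩ := ha
    split_ifs at h1 h2 ⊢
    · rw [key (-(a + b)) 1 (by omega), key (-(c + a)) (-1) (by omega), e1, e2]; ring
    · rw [key (-(a + b)) (-1) (by omega), key (-(c + a)) (-1) (by omega), e1]; ring
    · rw [key (-(a + b)) 1 (by omega), key (-(c + a)) 1 (by omega), e2]; ring
    · rw [key (-(a + b)) (-1) (by omega), key (-(c + a)) 1 (by omega), e1, e2]; ring
  · have hs := fun h => ha (hpar.mpr h)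
    rw [if_neg ha, if_neg hs]
    rw [Int.not_even_iff_odd] at ha
    obtain ⟨d, hd⟩ := ha
    split_ifs at h1 h2 ⊢
    · rw [key (-(a + b)) (-1) (by omega), key (-(c + a)) 1 (by omega), e1, e2]; ring
    · rw [key (-(a + b)) 1 (by omega), key (-(c + a)) 1 (by omega), e2]; ring
    · rw [key (-(a + b)) (-1) (by omega), key (-(c + a)) (-1) (by omega), e1]; ring
    · rw [key (-(a + b)) 1 (by omega), key (-(c + a)) (-1) (by omega), e1, e2]; ring

end hopping
-- Slater determinants and the many-kink eigenvalue equation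
-- This is why energies add: the left side is the derivative at `t = 0` of the determinant of `A`
-- with column `l` multiplied by `exp(t e_l)`. Expanding along the changed rows and summing over `j`
-- first gives the diagonal entries of `adjugate A * A`.
lemma sum_det_updateRow_mul {M : ℕ} (A : Matrix (Fin M) (Fin M) ℂ) (e : Fin M → ℂ) :
    ∑ j, (A.updateRow j fun l => e l * A j l).det = (∑ l, e l) * A.det := by
  have h : ∀ j, (A.updateRow j fun l => e l * A j l).det = ∑ l, e l * (A j l * A.adjugate l j) := by
    intro j
    rw [← Matrix.cramer_transpose_apply, Matrix.cramer_eq_adjugate_mulVec, Matrix.mulVec, dotProduct]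
    refine Finset.sum_congr rfl fun l _ => ?_
    rw [← Matrix.adjugate_transpose, Matrix.transpose_apply]
    ring
  rw [Finset.sum_congr rfl fun j _ => h j, Finset.sum_comm, Finset.sum_mul]
  refine Finset.sum_congr rfl fun l _ => ?_
  rw [← Finset.mul_sum]
  congr 1
  have := congrFun (congrFun (Matrix.adjugate_mul A) l) l
  rw [Matrix.mul_apply, Matrix.smul_apply, Matrix.one_apply_eq, smul_eq_mul, mul_one] at this
  rw [← this]
  exact Finset.sum_congr rfl fun j _ => mul_comm _ _

section eigen
variable {N M : ℕ} (hN : Even N) (hM : M % 2 = (N / 2) % 2) {ξ : ℕ} {B : ℕ → Fin M → ℂ}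
  (hB : ∀ p l, B (p + N) l = (-1) ^ (ξ + 1) * B p l) {w : StateSpace N} {g : ℂ}
  (hw : ∀ (n : Fin M → Fin N) (κ : ℤ), StrictMono n → (κ = 1 ∨ κ = -1) →
    inner ℂ (chiralState κ n) w
      = g * (κ : ℂ) ^ ξ * (Matrix.of fun j l => B (siteNumber (n j)) l).det)

include hw in
-- After a hop across the boundary the kinks are out of order. The labels do not see the order,
-- while the determinant acquires the sign of the sorting permutation.
lemma inner_qubitProduct_of_perm {v : Fin M → Fin N} {π : Equiv.Perm (Fin M)}
    (hv : StrictMono (v ∘ π)) {κ : ℤ} (hκ : κ = 1 ∨ κ = -1) :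
    I ^ (∑ i, siteNumber (v i)) * inner ℂ (qubitProduct (chiralLabel κ v)) w
      = g * (κ : ℂ) ^ ξ * ((Equiv.Perm.sign π : ℤ) *
        (Matrix.of fun j l => B (siteNumber (v j)) l).det) := by
  have h := hw _ κ hv hκ
  rw [inner_chiralState_left] at h
  have h1 : ∑ j, siteNumber ((v ∘ π) j) = ∑ i, siteNumber (v i) :=
    Equiv.sum_comp π fun i => siteNumber (v i)
  have h2 : chiralLabel κ (v ∘ π) = chiralLabel κ v := by
    ext l
    rw [chiralLabel, chiralLabel, kinksBefore_comp_perm]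
  have h3 := Matrix.det_permute π (Matrix.of fun j l => B (siteNumber (v j)) l)
  rw [h1, h2] at h
  rw [h, ← h3]
  rfl

include hw in
lemma inner_qubitProduct_flip {n : Fin M → Fin N} {j : Fin M} {y m : Fin N} {κ κ' : ℤ}
    (hκ' : κ' = 1 ∨ κ' = -1) {π : Equiv.Perm (Fin M)}
    (hflip : ∀ l, flip m (chiralLabel κ n) l ≡ chiralLabel κ' (Function.update n j y) l [ZMOD 4])
    (hπ : StrictMono (Function.update n j y ∘ π)) :
    I ^ (∑ i, siteNumber (Function.update n j y i)) *
        inner ℂ (qubitProduct (flip m (chiralLabel κ n))) w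
      = g * (κ' : ℂ) ^ ξ * ((Equiv.Perm.sign π : ℤ) *
        ((Matrix.of fun j l => B (siteNumber (n j)) l).updateRow j (B (siteNumber y))).det) := by
  have hmat : (Matrix.of fun j l => B (siteNumber (n j)) l).updateRow j (B (siteNumber y))
      = Matrix.of fun i l => B (siteNumber (Function.update n j y i)) l := by
    refine Matrix.ext fun i l => ?_
    by_cases hi : i = j
    · rw [hi, Matrix.updateRow_self, Matrix.of_apply, Function.update_self]
    · rw [Matrix.updateRow_ne hi, Matrix.of_apply, Matrix.of_apply, Function.update_of_ne hi]
  rw [qubitProduct_congr hflip, inner_qubitProduct_of_perm hw hπ hκ', hmat]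

include hN hM in
lemma I_pow_eq : (I : ℂ) ^ N = (-1) ^ M := by
  obtain ⟨K, hK⟩ := hN
  have h1 : N = 2 * K := by omega
  have h2 : (K : ℕ) % 2 = M % 2 := by omega
  rw [h1, pow_mul, I_sq, neg_one_pow_eq_pow_mod_two, h2, ← neg_one_pow_eq_pow_mod_two]

include hN hM hB hw

/-- The new row is taken at `(n j : ℕ)`, one less than the site number of the kink; at the first
site it is `0`, which stands for site `N`. In that case the signs `(-1) ^ ξ` from `κ`, `-(-1) ^ M`
from sorting, `(-1) ^ M` from `I ^ N` and `(-1) ^ (ξ + 1)` from periodicity multiply to `1`. -/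
lemma hop_down {n : Fin M → Fin N} (hn : StrictMono n) {κ : ℤ} (hκ : κ = 1 ∨ κ = -1) {j : Fin M}
    {y : Fin N} (hj : n j = finRotate N y) (hy : y ∉ Set.range n) :
    I ^ (∑ i, siteNumber (n i)) * (-I) *
        inner ℂ (qubitProduct (flip (n j) (chiralLabel κ n))) w
      = g * (κ : ℂ) ^ ξ *
        ((Matrix.of fun j l => B (siteNumber (n j)) l).updateRow j (B (n j : ℕ))).det := by
  have hs := sum_siteNumber_update n j y
  rcases finRotate_val_cases y with h | ⟨h, hyN⟩ <;> rw [← hj] at h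
  · have h1 := inner_qubitProduct_flip hw (π := 1) hκ
      (flip_chiralLabel_bulk κ n j (m := n j) (y := y) (Or.inl ⟨rfl, h.symm⟩))
      (strictMono_update hn hy (Or.inl h))
    simp only [siteNumber] at hs h1 ⊢
    rw [← h, Equiv.Perm.sign_one] at h1
    simp only [Units.val_one, Int.cast_one, one_mul] at h1
    rw [← h1, show ∑ i, ((n i : ℕ) + 1) = ∑ i, ((Function.update n j y i : ℕ) + 1) + 1 by omega,
      pow_succ]
    have := I_mul_I
    linear_combination (-(I ^ (∑ i, ((Function.update n j y i : ℕ) + 1))) *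
      inner ℂ (qubitProduct (flip (n j) (chiralLabel κ n))) w) * this
  · obtain ⟨π, hπ, hsgn⟩ := exists_perm_strictMono_wrap_down hn hy h hyN
    have h1 := inner_qubitProduct_flip hw (π := π) (κ' := -κ) (by omega)
      (flip_chiralLabel_wrap hκ n j (m := n j) (y := y) h (Or.inl ⟨rfl, hyN⟩)) hπ
    have hBN : B (siteNumber y) = ((-1) ^ (ξ + 1) : ℂ) • B (n j : ℕ) := by
      ext l
      rw [h, siteNumber, hyN, ← zero_add N, hB]; simp
    rw [hBN, Matrix.det_updateRow_smul, hsgn] at h1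
    have hpow : (I : ℂ) ^ (∑ i, siteNumber (n i)) * I ^ N
        = I ^ (∑ i, siteNumber (Function.update n j y i)) * I := by
      rw [← pow_add, ← pow_succ]
      congr 1
      simp only [siteNumber] at hs ⊢
      omega
    rw [I_pow_eq hN hM] at hpow
    push_cast at h1
    have s1 : ((-1 : ℂ) ^ M) * (-1) ^ M = 1 := by rw [← mul_pow]; norm_num
    have s2 : ((-1 : ℂ) ^ ξ) * (-1) ^ ξ = 1 := by rw [← mul_pow]; norm_num
    rw [neg_pow (κ : ℂ)] at h1
    have hI := I_mul_I
    rw [pow_succ] at h1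
    set P := (I : ℂ) ^ (∑ i, siteNumber (n i))
    set Q := (I : ℂ) ^ (∑ i, siteNumber (Function.update n j y i))
    set T : ℂ := inner ℂ (qubitProduct (flip (n j) (chiralLabel κ n))) w
    have hP : P = Q * I * (-1) ^ M := by
      rw [← hpow, mul_assoc, s1, mul_one]
    rw [hP]
    generalize (-1 : ℂ) ^ M = a at *
    generalize (-1 : ℂ) ^ ξ = b at *
    generalize ((Matrix.of fun j l => B (siteNumber (n j)) l).updateRow j (B (n j : ℕ))).det = D at *
    have s3 : Q * I * a * (-I) * T = a * (Q * T) := by linear_combination (-(Q * a * T)) * hI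
    rw [s3, h1]
    linear_combination (g * (κ : ℂ) ^ ξ * D * b * b) * s1 + (g * (κ : ℂ) ^ ξ * D) * s2

lemma hop_up {n : Fin M → Fin N} (hn : StrictMono n) {κ : ℤ} (hκ : κ = 1 ∨ κ = -1) {j : Fin M}
    (hy : finRotate N (n j) ∉ Set.range n) :
    I ^ (∑ i, siteNumber (n i)) * I *
        inner ℂ (qubitProduct (flip (finRotate N (n j)) (chiralLabel κ n))) w
      = g * (κ : ℂ) ^ ξ * ((Matrix.of fun j l => B (siteNumber (n j)) l).updateRow j
          (B (siteNumber (n j) + 1))).det := by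
  have hr := finRotate_val_cases (n j)
  generalize finRotate N (n j) = y at *
  have hs := sum_siteNumber_update n j y
  rcases hr with h | ⟨h, hyN⟩
  · have h1 := inner_qubitProduct_flip hw (π := 1) hκ
      (flip_chiralLabel_bulk κ n j (m := y) (y := y) (Or.inr ⟨h.symm, rfl⟩))
      (strictMono_update hn hy (Or.inr h))
    simp only [siteNumber] at hs h1 ⊢
    rw [h, Equiv.Perm.sign_one] at h1
    simp only [Units.val_one, Int.cast_one, one_mul] at h1
    rw [← h1, show ∑ i, ((Function.update n j y i : ℕ) + 1) = ∑ i, ((n i : ℕ) + 1) + 1 by omega,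
      pow_succ]
  · obtain ⟨π, hπ, hsgn⟩ := exists_perm_strictMono_wrap_up hn hy hyN h
    have h1 := inner_qubitProduct_flip hw (π := π) (κ' := -κ) (by omega)
      (flip_chiralLabel_wrap hκ n j (m := y) (y := y) h (Or.inr ⟨hyN, rfl⟩)) hπ
    have hBN : B (siteNumber y) = ((-1) ^ (ξ + 1) : ℂ) • B (siteNumber (n j) + 1) := by
      ext l
      rw [siteNumber, siteNumber, hyN, h, Pi.smul_apply, smul_eq_mul, add_comm N 1, hB, ← mul_assoc,
        ← mul_pow]
      norm_num
    rw [hBN, Matrix.det_updateRow_smul, hsgn] at h1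
    have hpow : (I : ℂ) ^ (∑ i, siteNumber (n i)) * I
        = I ^ (∑ i, siteNumber (Function.update n j y i)) * I ^ N := by
      rw [← pow_add, ← pow_succ]
      congr 1
      simp only [siteNumber] at hs ⊢
      omega
    rw [I_pow_eq hN hM] at hpow
    push_cast at h1
    have s1 : ((-1 : ℂ) ^ M) * (-1) ^ M = 1 := by rw [← mul_pow]; norm_num
    have s2 : ((-1 : ℂ) ^ ξ) * (-1) ^ ξ = 1 := by rw [← mul_pow]; norm_num
    rw [neg_pow (κ : ℂ), pow_succ] at h1
    rw [hpow]
    generalize (-1 : ℂ) ^ M = a at *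
    generalize (-1 : ℂ) ^ ξ = b at *
    generalize ((Matrix.of fun j l => B (siteNumber (n j)) l).updateRow j
      (B (siteNumber (n j) + 1))).det = D at *
    rw [mul_right_comm, h1]
    linear_combination (g * (κ : ℂ) ^ ξ * D * b * b) * s1 + (g * (κ : ℂ) ^ ξ * D) * s2

/-- The total contribution of the reversal of the qubit at the site `m`. -/
lemma flip_contribution {n : Fin M → Fin N} (hn : StrictMono n) {κ : ℤ} (hκ : κ = 1 ∨ κ = -1)
    (Jx Jy : ℂ) (m : Fin N) :
    I ^ (∑ i, siteNumber (n i)) * (flipCoupling Jx Jy (chiralLabel κ n m) *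
      (I ^ (-(chiralLabel κ n m + chiralLabel κ n (finRotate N m)))
        + I ^ (-(chiralLabel κ n ((finRotate N).symm m) + chiralLabel κ n m))) *
      inner ℂ (qubitProduct (flip m (chiralLabel κ n))) w)
    = 2 * kinkCoupling Jx Jy (siteNumber m) * (g * (κ : ℂ) ^ ξ) *
      ((∑ j, if n j = m then ((Matrix.of fun j l => B (siteNumber (n j)) l).updateRow j
          (B (n j : ℕ))).det else 0)
        + ∑ j, if n j = (finRotate N).symm m then
          ((Matrix.of fun j l => B (siteNumber (n j)) l).updateRow j
            (B (siteNumber (n j) + 1))).det else 0) := by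
  classical
  rw [flip_coefficient hn.injective hN hM hκ]
  have single : ∀ (j : Fin M) (D : Fin M → ℂ), (∑ i, if n i = n j then D i else 0) = D j := by
    intro j D
    simp only [hn.injective.eq_iff]
    simp
  have none : ∀ (x : Fin N) (D : Fin M → ℂ), x ∉ Set.range n →
      (∑ i, if n i = x then D i else 0) = 0 := by
    intro x D hx
    refine Finset.sum_eq_zero fun i _ => if_neg fun h => hx ⟨i, h⟩
  by_cases hp : m ∈ Set.range n
  · obtain ⟨j, rfl⟩ := hp
    rw [if_pos (Set.mem_range_self j), single]
    by_cases hq : (finRotate N).symm (n j) ∈ Set.range n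
    -- Exclusion: with both sites occupied the flip coefficient is zero, and each hop makes two rows
    -- of the determinant proportional.
    · obtain ⟨i, hi⟩ := hq
      rw [← hi, single, if_pos (Set.mem_range_self i), sub_self, mul_zero, zero_mul, mul_zero]
      have hi' : finRotate N (n i) = n j := by rw [hi, Equiv.apply_symm_apply]
      have hij : i ≠ j := by
        rintro rfl
        exact finRotate_ne_self hN _ hi'.symm
      have zero : ∀ (a b : Fin M) (c : ℂ), a ≠ b →
          ((Matrix.of fun j l => B (siteNumber (n j)) l).updateRow a
            (c • B (siteNumber (n b)))).det = 0 := by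
        intro a b c hab
        rw [Matrix.det_updateRow_smul, Matrix.det_zero_of_row_eq hab, mul_zero]
        rw [Matrix.updateRow_self, Matrix.updateRow_ne hab.symm]
        rfl
      have h1 : ∃ c : ℂ, B (n j : ℕ) = c • B (siteNumber (n i)) := by
        rcases finRotate_val_cases (n i) with h | ⟨h, h'⟩ <;> rw [hi'] at h
        · exact ⟨1, by rw [one_smul, h, siteNumber]⟩
        · refine ⟨(-1) ^ (ξ + 1), ?_⟩
          ext l
          rw [siteNumber, h', h, Pi.smul_apply, smul_eq_mul, ← zero_add N, hB, ← mul_assoc,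
            ← mul_pow]
          norm_num
      have h2 : ∃ c : ℂ, B (siteNumber (n i) + 1) = c • B (siteNumber (n j)) := by
        rcases finRotate_val_cases (n i) with h | ⟨h, h'⟩ <;> rw [hi'] at h
        · exact ⟨1, by rw [one_smul, siteNumber, siteNumber, h]⟩
        · refine ⟨(-1) ^ (ξ + 1), ?_⟩
          ext l
          rw [siteNumber, siteNumber, h', h, Pi.smul_apply, smul_eq_mul, add_comm N 1, hB, zero_add]
      obtain ⟨c1, h1⟩ := h1
      obtain ⟨c2, h2⟩ := h2
      rw [h1, h2, zero _ _ _ hij.symm, zero _ _ _ hij]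
      ring
    · rw [if_neg hq, none _ _ hq]
      have := hop_down hN hM hB hw hn hκ (j := j) (y := (finRotate N).symm (n j))
        (by rw [Equiv.apply_symm_apply]) hq
      linear_combination 2 * kinkCoupling Jx Jy (siteNumber (n j)) * this
  · rw [if_neg hp, none _ _ hp]
    by_cases hq : (finRotate N).symm m ∈ Set.range n
    · rw [if_pos hq]
      obtain ⟨i, hi⟩ := hq
      have hi' : finRotate N (n i) = m := by rw [hi, Equiv.apply_symm_apply]
      subst hi'
      rw [Equiv.symm_apply_apply, single]
      have := hop_up hN hM hB hw hn hκ hp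
      linear_combination 2 * kinkCoupling Jx Jy (siteNumber (finRotate N (n i))) * this
    · rw [if_neg hq, none _ _ hq]; ring

/-- A state whose amplitudes in the chiral basis are Slater determinants of solutions of the
one-kink equation satisfies the eigenvalue equation against the chiral states. -/
theorem inner_chiralState_hamiltonianXY {n : Fin M → Fin N} (hn : StrictMono n) {κ : ℤ}
    (hκ : κ = 1 ∨ κ = -1) {Jx Jy : ℂ} (hJx : conj Jx = Jx) (hJy : conj Jy = Jy) {e : Fin M → ℂ}
    (he : ∀ p l, 2 * (kinkCoupling Jx Jy (p + 1) * B p l + kinkCoupling Jx Jy (p + 2) * B (p + 2) l)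
      = e l * B (p + 1) l) :
    inner ℂ (chiralState κ n) (hamiltonianXY N Jx Jy w)
      = (∑ l, e l) * inner ℂ (chiralState κ n) w := by
  have hpar : ∀ l, Even (chiralLabel κ n l) ↔ Odd (chiralLabel κ n (finRotate N l)) := by
    intro l
    rw [chiralLabel_even_iff hκ, ← Int.not_even_iff_odd, chiralLabel_even_iff hκ,
      siteNumber_finRotate_odd_iff hN, Nat.not_even_iff_odd]
  rw [inner_chiralState_left, inner_qubitProduct_hamiltonianXY hN Jx Jy hJx hJy hpar,
    Finset.mul_sum, Finset.sum_congr rfl fun m _ => flip_contribution hN hM hB hw hn hκ Jx Jy m,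
    hw n κ hn hκ]
  set A : Matrix (Fin M) (Fin M) ℂ := Matrix.of fun j l => B (siteNumber (n j)) l
  simp only [mul_add, Finset.sum_add_distrib]
  -- The coupling sees only the parity of the site number, so for even `N` the boundary is invisible
  -- to it.
  have hrot : ∀ m : Fin N, kinkCoupling Jx Jy (siteNumber (finRotate N m))
      = kinkCoupling Jx Jy (siteNumber m + 1) := by
    intro m
    rw [kinkCoupling, kinkCoupling]
    simp only [siteNumber_finRotate_odd_iff hN, Nat.odd_add_one, Nat.not_odd_iff_even]
  have e1 : ∑ m, 2 * kinkCoupling Jx Jy (siteNumber m) * (g * (κ : ℂ) ^ ξ) *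
      (∑ j, if n j = m then (A.updateRow j (B (n j : ℕ))).det else 0)
      = g * (κ : ℂ) ^ ξ * ∑ j, 2 * kinkCoupling Jx Jy (siteNumber (n j)) *
        (A.updateRow j (B (n j : ℕ))).det := by
    simp only [Finset.mul_sum]
    rw [Finset.sum_comm]
    refine Finset.sum_congr rfl fun j _ => ?_
    simp only [mul_ite, mul_zero, Finset.sum_ite_eq, Finset.mem_univ, if_true]
    ring
  have e2 : ∑ m, 2 * kinkCoupling Jx Jy (siteNumber m) * (g * (κ : ℂ) ^ ξ) *
      (∑ j, if n j = (finRotate N).symm m then (A.updateRow j (B (siteNumber (n j) + 1))).det else 0)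
      = g * (κ : ℂ) ^ ξ * ∑ j, 2 * kinkCoupling Jx Jy (siteNumber (n j) + 1) *
        (A.updateRow j (B (siteNumber (n j) + 1))).det := by
    rw [← Equiv.sum_comp (finRotate N)]
    simp only [Equiv.symm_apply_apply, hrot, Finset.mul_sum]
    rw [Finset.sum_comm]
    refine Finset.sum_congr rfl fun j _ => ?_
    simp only [mul_ite, mul_zero, Finset.sum_ite_eq, Finset.mem_univ, if_true]
    ring
  rw [e1, e2, ← mul_add, ← Finset.sum_add_distrib, mul_left_comm, ← sum_det_updateRow_mul]
  congr 1
  refine Finset.sum_congr rfl fun j _ => ?_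
  rw [← Matrix.det_updateRow_smul, ← Matrix.det_updateRow_smul, ← Matrix.det_updateRow_add]
  congr 2
  ext l
  -- Index `p = (n j : ℕ)` is the site number minus one, so `he` is centred at the kink.
  have := he (n j : ℕ) l
  simp only [Pi.add_apply, Pi.smul_apply, smul_eq_mul, siteNumber, A, Matrix.of_apply]
  rw [← this]
  ring

end eigen
/-! ### The Cauchy–Binet formula and overlaps of Bethe states -/

section overlap
variable {N M : ℕ}

open Classical in
-- Multilinearity in the rows expands the right side over all maps `r`. Non-injective ones drop out,
-- and an injective `r` is uniquely an increasing `n` followed by a permutation; the sum over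
-- permutations rebuilds the determinant of `F`.
lemma cauchyBinet (F G : Fin N → Fin M → ℂ) :
    ∑ n : Fin M → Fin N with StrictMono n,
      (Matrix.of fun j l => F (n j) l).det * (Matrix.of fun j l => G (n j) l).det
    = (Matrix.of fun k l => ∑ i, F i k * G i l).det := by
  have h1 : (Matrix.of fun k l => ∑ i, F i k * G i l).det
      = ∑ r : Fin M → Fin N, (∏ k, F (r k) k) * (Matrix.of fun j l => G (r j) l).det := by
    have e : (Matrix.of fun k l => ∑ i, F i k * G i l : Matrix (Fin M) (Fin M) ℂ)
        = fun k => ∑ i, F i k • G i := by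
      funext k l
      simp [Finset.sum_apply]
    have h := (Matrix.detRowAlternating (n := Fin M) (R := ℂ)).toMultilinearMap.map_sum
      (fun (k : Fin M) (i : Fin N) => F i k • G i)
    rw [e]
    refine h.trans (Finset.sum_congr rfl fun r _ => ?_)
    exact (Matrix.detRowAlternating (n := Fin M) (R := ℂ)).toMultilinearMap.map_smul_univ
      (fun k => F (r k) k) (fun k => G (r k))
  have h2 : ∑ r : Fin M → Fin N, (∏ k, F (r k) k) * (Matrix.of fun j l => G (r j) l).det
      = ∑ r : Fin M → Fin N with Function.Injective r,
        (∏ k, F (r k) k) * (Matrix.of fun j l => G (r j) l).det := by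
    symm
    refine Finset.sum_subset (Finset.filter_subset _ _) fun r _ hr => ?_
    have hr' : ¬ Function.Injective r := fun h => hr (by simpa using h)
    simp only [Function.Injective, not_forall] at hr'
    obtain ⟨i, j, hij, hne⟩ := hr'
    rw [Matrix.det_zero_of_row_eq hne, mul_zero]
    ext l
    rw [Matrix.of_apply, Matrix.of_apply, hij]
  have h3 : ∀ n : Fin M → Fin N,
      (Matrix.of fun j l => F (n j) l).det * (Matrix.of fun j l => G (n j) l).det
      = ∑ π : Equiv.Perm (Fin M), (∏ k, F ((n ∘ π) k) k)
        * (Matrix.of fun j l => G ((n ∘ π) j) l).det := by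
    intro n
    rw [Matrix.det_apply', Finset.sum_mul]
    refine Finset.sum_congr rfl fun π _ => ?_
    have := Matrix.det_permute π (Matrix.of fun j l => G (n j) l)
    have e : (Matrix.of fun j l => G ((n ∘ π) j) l)
      = (Matrix.of fun j l => G (n j) l).submatrix π id := rfl
    rw [e, this]
    simp only [Matrix.of_apply, Function.comp_apply]
    ring
  rw [h1, h2, Finset.sum_congr rfl fun n _ => h3 n, ← Finset.sum_product']
  refine Finset.sum_bij (fun p _ => p.1 ∘ p.2) ?_ ?_ ?_ ?_
  · rintro ⟨n, π⟩ h
    simp only [Finset.mem_product, Finset.mem_filter, Finset.mem_univ, true_and, and_true] at h ⊢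
    exact h.injective.comp π.injective
  · rintro ⟨n, π⟩ h ⟨n', π'⟩ h' he
    simp only [Finset.mem_product, Finset.mem_filter, Finset.mem_univ, true_and, and_true] at h h' he
    have hr : Set.range n = Set.range n' := by
      rw [← π.surjective.range_comp n, he, π'.surjective.range_comp n']
    obtain rfl := (h.range_inj h').mp hr
    have : π = π' := Equiv.ext fun i => h.injective (congrFun he i)
    rw [this]
  · intro r hr
    simp only [Finset.mem_filter, Finset.mem_univ, true_and] at hr
    refine ⟨(r ∘ Tuple.sort r, (Tuple.sort r)⁻¹), ?_, ?_⟩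
    · simp only [Finset.mem_product, Finset.mem_filter, Finset.mem_univ, true_and, and_true]
      exact (Tuple.monotone_sort r).strictMono_of_injective
        (hr.comp (Tuple.sort r).injective)
    · ext k
      simp
  · rintro ⟨n, π⟩ h
    rfl

lemma sum_sign_pow_mul_sign_pow {ξ ξ' : Fin 2} :
    ∑ κ ∈ ({1, -1} : Finset ℤ), (κ : ℂ) ^ (ξ : ℕ) * (κ : ℂ) ^ (ξ' : ℕ)
      = if ξ = ξ' then 2 else 0 := by
  rw [Finset.sum_pair (by norm_num)]
  fin_cases ξ <;> fin_cases ξ' <;> norm_num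

lemma inner_betheState_of_card_ne (hN0 : 0 < N) (τ : ℂ) {M' : ℕ} (ξ ξ' : ℕ) (u : Fin M → ℂ) (u' : Fin M' → ℂ)
    (hM : M % 2 = M' % 2) (hne : M ≠ M') :
    inner ℂ (betheState τ ξ u : StateSpace N) (betheState τ ξ' u') = 0 := by
  rw [betheState, sum_inner]
  refine Finset.sum_eq_zero fun n hn => ?_
  rw [sum_inner]
  refine Finset.sum_eq_zero fun κ hκ => ?_
  rw [inner_smul_left, inner_chiralState_betheState_of_ne (by simpa using hn) hN0
    (by simpa using hκ) τ ξ' u' hM hne, mul_zero]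

lemma inner_betheState_same_card (hN0 : 0 < N) (τ : ℂ) (ξ ξ' : Fin 2) (u u' : Fin M → ℂ) :
    inner ℂ (betheState τ ξ u : StateSpace N) (betheState τ ξ' u')
      = (if ξ = ξ' then 1 else 0) * (Matrix.of fun k l => (N : ℂ)⁻¹ *
        ∑ i : Fin N, conj (kinkAmplitude τ (siteNumber i) (u k))
          * kinkAmplitude τ (siteNumber i) (u' l)).det := by
  classical
  have hsq : ((Real.sqrt (2 * (N : ℝ) ^ M) : ℝ) : ℂ) * (Real.sqrt (2 * (N : ℝ) ^ M) : ℝ)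
      = 2 * (N : ℂ) ^ M := by
    rw [← Complex.ofReal_mul, Real.mul_self_sqrt (by positivity)]; push_cast; rfl
  have hdet : (Matrix.of fun k l => (N : ℂ)⁻¹ *
        ∑ i : Fin N, conj (kinkAmplitude τ (siteNumber i) (u k))
          * kinkAmplitude τ (siteNumber i) (u' l)).det = ((N : ℂ)⁻¹) ^ M *
      ∑ n : Fin M → Fin N with StrictMono n,
      conj (Matrix.of fun j l => kinkAmplitude τ (siteNumber (n j)) (u l)).det *
        (Matrix.of fun j l => kinkAmplitude τ (siteNumber (n j)) (u' l)).det := by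
    have := Matrix.det_smul (Matrix.of fun k l =>
        ∑ i : Fin N, conj (kinkAmplitude τ (siteNumber i) (u k))
          * kinkAmplitude τ (siteNumber i) (u' l)) ((N : ℂ)⁻¹)
    rw [Fintype.card_fin, ← cauchyBinet (fun i k => conj (kinkAmplitude τ (siteNumber i) (u k)))
      (fun i k => kinkAmplitude τ (siteNumber i) (u' k))] at this
    refine this.trans ?_
    congr 1
    refine Finset.sum_congr rfl fun n _ => ?_
    rw [RingHom.map_det]
    rfl
  have hterm : ∀ n : Fin M → Fin N, StrictMono n →
      inner ℂ (∑ κ ∈ ({1, -1} : Finset ℤ),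
        (chiralAmplitude τ u n * (κ : ℂ) ^ (ξ : ℕ)) • chiralState κ n)
        (betheState τ ξ' u' : StateSpace N)
      = (if ξ = ξ' then 2 else 0) * (conj (chiralAmplitude τ u n) * chiralAmplitude τ u' n) := by
    intro n hn
    rw [sum_inner, ← sum_sign_pow_mul_sign_pow, Finset.sum_mul]
    refine Finset.sum_congr rfl fun κ hκ => ?_
    rw [inner_smul_left, inner_chiralState_betheState hn hN0 (by simpa using hκ), map_mul, map_pow,
      map_intCast]
    ring
  rw [hdet, betheState, sum_inner,
    Finset.sum_congr rfl fun n hn => hterm n (Finset.mem_filter.mp hn).2, ← Finset.mul_sum]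
  have hχ : ∀ n : Fin M → Fin N, conj (chiralAmplitude τ u n) * chiralAmplitude τ u' n
      = (2 * (N : ℂ) ^ M)⁻¹ *
        (conj (Matrix.of fun j l => kinkAmplitude τ (siteNumber (n j)) (u l)).det *
        (Matrix.of fun j l => kinkAmplitude τ (siteNumber (n j)) (u' l)).det) := by
    intro n
    rw [chiralAmplitude, chiralAmplitude, map_mul, map_div₀, map_one, Complex.conj_ofReal, ← hsq,
      mul_inv]
    ring
  rw [Finset.sum_congr rfl fun n _ => hχ n, ← Finset.mul_sum, mul_inv, inv_pow]
  split_ifs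
  · ring
  · ring

end overlap

lemma inner_betheState_of_roots {N M : ℕ} (hN : Even N) (hN0 : 0 < N) {τ : ℂ} (hre : τ.re = 0)
    (hτ : 0 < τ.im) (ξ : Fin 2) {u u' : Fin M → ℂ} (hu : ∀ j, IsBetheRoot N τ ξ (u j))
    (hu' : ∀ j, IsBetheRoot N τ ξ (u' j)) [∀ k l, Decidable (u k = u' l)] :
    inner ℂ (betheState τ ξ u : StateSpace N) (betheState τ ξ u')
      = (Matrix.of fun k l => if u k = u' l then (1 : ℂ) else 0).det := by
  rw [inner_betheState_same_card hN0, if_pos rfl, one_mul]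
  congr 2
  funext k l
  have hc : ((-1 : ℂ) ^ ((ξ : ℕ) + 1)) ≠ 0 := pow_ne_zero _ (by norm_num)
  have hNc : (N : ℂ) ≠ 0 := by exact_mod_cast hN0.ne'
  rw [sum_conj_kinkAmplitude_mul hre hτ hN hc ((hu k).mem_rootLines hre hτ hN0)
    ((hu' l).mem_rootLines hre hτ hN0) (hu k).2 (hu' l).2]
  split_ifs
  · exact inv_mul_cancel₀ hNc
  · exact mul_zero _

/-! ### Counting -/

/-- The alternating sum of `(-1) ^ |S|` over all subsets of a nonempty set is zero, so both parities
occur equally often. -/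
lemma card_finset_parity {N : ℕ} (hN0 : 0 < N) (c : ℕ) (hc : c < 2) :
    Fintype.card {S : Finset (Fin N) // S.card % 2 = c} = 2 ^ (N - 1) := by
  rw [Fintype.card_subtype]
  have h0 := Finset.sum_powerset_neg_one_pow_card_of_nonempty
    (x := (Finset.univ : Finset (Fin N))) ⟨⟨0, hN0⟩, Finset.mem_univ _⟩
  rw [Finset.powerset_univ] at h0
  have h1 : ∀ S : Finset (Fin N), ((-1 : ℤ) ^ S.card)
      = (-1) ^ c * (2 * (if S.card % 2 = c then 1 else 0) - 1) := by
    intro S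
    rw [neg_one_pow_eq_pow_mod_two]
    have : S.card % 2 < 2 := Nat.mod_lt _ two_pos
    interval_cases c <;> interval_cases S.card % 2 <;> norm_num
  rw [Finset.sum_congr rfl fun S _ => h1 S, ← Finset.mul_sum, Finset.sum_sub_distrib,
    ← Finset.mul_sum, Finset.sum_boole, mul_eq_zero, or_iff_right (pow_ne_zero _ (by norm_num))] at h0
  simp only [Finset.sum_const, Finset.card_univ, Fintype.card_finset, Fintype.card_fin, nsmul_eq_mul,
    mul_one] at h0
  obtain ⟨K, rfl⟩ : ∃ K, N = K + 1 := ⟨N - 1, by omega⟩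
  rw [Nat.add_sub_cancel]
  rw [pow_succ] at h0
  push_cast at h0
  have h2 : (((Finset.univ.filter fun S : Finset (Fin (K + 1)) => S.card % 2 = c).card : ℕ) : ℤ)
      = ((2 ^ K : ℕ) : ℤ) := by push_cast; linarith
  exact_mod_cast h2

lemma card_labels {N : ℕ} (hN0 : 0 < N) :
    Fintype.card (Fin 2 × {S : Finset (Fin N) // S.card % 2 = (N / 2) % 2})
      = Module.finrank ℂ (StateSpace N) := by
  rw [Fintype.card_prod, card_finset_parity hN0 _ (Nat.mod_lt _ two_pos), Fintype.card_fin,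
    finrank_euclideanSpace, Fintype.card_fun, Fintype.card_fin, Fintype.card_fin, ← pow_succ',
    Nat.sub_add_cancel hN0]

lemma span_eq_top_of_orthonormal {N : ℕ} (hN0 : 0 < N)
    {e : Fin 2 × {S : Finset (Fin N) // S.card % 2 = (N / 2) % 2} → StateSpace N}
    (he : Orthonormal ℂ e) : Submodule.span ℂ (Set.range e) = ⊤ := by
  have : Nonempty (Fin 2 × {S : Finset (Fin N) // S.card % 2 = (N / 2) % 2}) := by
    rw [← Fintype.card_pos_iff, card_labels hN0]
    exact Module.finrank_pos
  exact he.linearIndependent.span_eq_top_of_card_eq_finrank (card_labels hN0)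

/-- A vector is determined by its overlaps with the chiral states. -/
lemma eq_of_inner_chiralState {N : ℕ} (hN0 : 0 < N) {v w : StateSpace N}
    (h : ∀ (M : ℕ) (n : Fin M → Fin N) (κ : ℤ), StrictMono n → M % 2 = (N / 2) % 2 →
      (κ = 1 ∨ κ = -1) → inner ℂ (chiralState κ n) v = inner ℂ (chiralState κ n) w) : v = w := by
  let sgn : Fin 2 → ℤ := fun b => if b = 0 then 1 else -1
  have hsgn : ∀ b, sgn b = 1 ∨ sgn b = -1 := by
    intro b; fin_cases b <;> simp [sgn]
  -- Chiral states with an admissible number of kinks, indexed by sign and kink set, are `2 ^ N`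
  -- orthonormal vectors, hence a basis.
  let e : Fin 2 × {S : Finset (Fin N) // S.card % 2 = (N / 2) % 2} → StateSpace N :=
    fun p => chiralState (sgn p.1) (p.2.1.orderEmbOfFin rfl)
  have he : Orthonormal ℂ e := by
    classical
    rw [orthonormal_iff_ite]
    rintro ⟨b, S, hS⟩ ⟨b', S', hS'⟩
    split_ifs with heq
    · rw [heq]; exact inner_chiralState_self _ _
    · refine inner_chiralState_eq_zero (S.orderEmbOfFin rfl).injective
        (S'.orderEmbOfFin rfl).injective (hS.trans hS'.symm) hN0 (hsgn b) (hsgn b') ?_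
      rintro ⟨h1, h2⟩
      apply heq
      rw [Finset.range_orderEmbOfFin, Finset.range_orderEmbOfFin] at h2
      have hb : b = b' := by
        revert h1; fin_cases b <;> fin_cases b' <;> simp [sgn]
      obtain rfl := Finset.coe_injective h2
      rw [hb]
  have hspan := span_eq_top_of_orthonormal hN0 he
  have h0 : ∀ x ∈ Submodule.span ℂ (Set.range e), inner ℂ x v = inner ℂ x w := by
    intro x hx
    induction hx using Submodule.span_induction with
    | mem x hx =>
      obtain ⟨⟨b, S, hS⟩, rfl⟩ := hx
      exact h _ _ _ (S.orderEmbOfFin rfl).strictMono hS (hsgn b)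
    | zero => simp
    | add x y _ _ hx hy => rw [inner_add_left, inner_add_left, hx, hy]
    | smul c x _ hx => rw [inner_smul_left, inner_smul_left, hx]
  exact ext_inner_left ℂ fun x => h0 x (hspan ▸ Submodule.mem_top)

/-! ### The Bethe states -/

lemma couplings_real {τ : ℂ} (hre : τ.re = 0) (hτ : 0 < τ.im) :
    conj (couplingX τ) = couplingX τ ∧ conj (couplingY τ) = couplingY τ := by
  have h3 : conj (theta3 τ 0) = theta3 τ 0 := by
    rw [← theta3_conj hre hτ, map_zero]
  have h4 : conj (theta4 τ 0) = theta4 τ 0 := by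
    rw [theta4_eq_theta3, ← theta3_conj hre hτ]
    congr 1
    apply Complex.ext <;> simp
  rw [couplingX, couplingY, map_div₀, map_div₀, h3, h4]
  exact ⟨rfl, rfl⟩

lemma hamiltonianXY_betheState {N M : ℕ} (hN : Even N) (hN0 : 0 < N) {τ : ℂ} (hre : τ.re = 0)
    (hτ : 0 < τ.im) (hM : M % 2 = (N / 2) % 2) (ξ : ℕ) {u : Fin M → ℂ}
    (hu : ∀ j, IsBetheRoot N τ ξ (u j)) :
    hamiltonianXY N (couplingX τ) (couplingY τ) (betheState τ ξ u)
      = betheEnergy τ u • (betheState τ ξ u : StateSpace N) := by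
  obtain ⟨hJx, hJy⟩ := couplings_real hre hτ
  refine eq_of_inner_chiralState hN0 fun M' n κ hn hM' hκ => ?_
  rw [inner_smul_right]
  by_cases hMM : M' = M
  · subst hMM
    have hE : betheEnergy τ u = ∑ l, rootEnergy τ (u l) := by
      rw [betheEnergy, Finset.mul_sum]; rfl
    rw [hE]
    refine inner_chiralState_hamiltonianXY hN hM (ξ := ξ) (B := fun p l => kinkAmplitude τ p (u l))
      (g := 1 / (Real.sqrt (2 * (N : ℝ) ^ M') : ℂ)) ?_ ?_ hn hκ hJx hJy ?_
    · intro p l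
      exact kinkAmplitude_add_period hre hτ hN0 hN (hu l) p
    · intro n κ hn hκ
      rw [inner_chiralState_betheState hn hN0 hκ, chiralAmplitude]
      ring
    · intro p l
      have hl := (hu l).mem_rootLines hre hτ hN0
      rw [kinkCoupling, kinkCoupling]
      rcases Nat.even_or_odd p with hp | hp
      · rw [if_pos hp.add_one, if_neg (Nat.not_odd_iff_even.mpr (hp.add even_two))]
        exact kinkAmplitude_hop_odd hre hτ hl hp
      · rw [if_neg (Nat.not_odd_iff_even.mpr hp.add_one), if_pos (hp.add_even even_two)]
        exact kinkAmplitude_hop_even hre hτ hl hp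
  -- For another number of kinks both overlaps vanish: the Bethe state has zero amplitudes there,
  -- and the same theorem applied with `B = 0` shows that `H` does not create any.
  · have hz : ∀ (n : Fin M' → Fin N) (κ : ℤ), StrictMono n → (κ = 1 ∨ κ = -1) →
        inner ℂ (chiralState κ n) (betheState τ ξ u : StateSpace N) = 0 := fun n κ hn hκ =>
      inner_chiralState_betheState_of_ne hn hN0 hκ τ ξ u (hM'.trans hM.symm) hMM
    rw [hz n κ hn hκ, mul_zero, inner_chiralState_hamiltonianXY hN hM' (ξ := ξ)
      (B := fun _ _ => 0) (g := 0) (by simp) (fun n κ hn hκ => by rw [hz n κ hn hκ]; simp) hn hκ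
      hJx hJy (e := fun _ => 0) (by simp)]
    simp

section labels
variable {N : ℕ} {τ : ℂ} {lt : ℂ → ℂ → Prop}

lemma BetheLabel.isBetheRoot (b : BetheLabel N τ lt) (j : Fin b.M) :
    IsBetheRoot N τ b.ξ (b.u j) := ⟨b.mem_domain j, b.bethe_eq j⟩

lemma injective_of_ordered [IsStrictTotalOrder ℂ lt] {M : ℕ} {u : Fin M → ℂ}
    (hu : ∀ i j, i < j → lt (u i) (u j)) : Function.Injective u := by
  intro i j hij
  rcases lt_trichotomy i j with h | h | h
  · exact absurd (hij ▸ hu i j h) (irrefl_of lt _)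
  · exact h
  · exact absurd (hij ▸ hu j i h) (irrefl_of lt _)

lemma eq_of_range_eq_of_ordered [IsStrictTotalOrder ℂ lt] {M : ℕ} {u u' : Fin M → ℂ}
    (hu : ∀ i j, i < j → lt (u i) (u j)) (hu' : ∀ i j, i < j → lt (u' i) (u' j))
    (h : Set.range u = Set.range u') : u = u' := by
  classical
  let := linearOrderOfSTO lt
  have h1 : StrictMono u := fun i j => hu i j
  have h2 : StrictMono u' := fun i j => hu' i j
  exact (h1.range_inj h2).mp h

lemma orthonormal_betheState [IsStrictTotalOrder ℂ lt] (hN : Even N) (hN0 : 0 < N)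
    (hre : τ.re = 0) (hτ : 0 < τ.im) :
    Orthonormal ℂ (fun b : BetheLabel N τ lt => (betheState τ (b.ξ : ℕ) b.u : StateSpace N)) := by
  classical
  rw [orthonormal_iff_ite]
  intro b b'
  split_ifs with hb
  · subst hb
    rw [inner_betheState_of_roots hN hN0 hre hτ b.ξ b.isBetheRoot b.isBetheRoot]
    have : (Matrix.of fun k l => if b.u k = b.u l then (1 : ℂ) else 0) = 1 := by
      refine Matrix.ext fun k l => ?_
      rw [Matrix.of_apply, Matrix.one_apply]
      simp only [(injective_of_ordered b.ordered).eq_iff]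
    rw [this, Matrix.det_one]
  · by_cases hM : b.M = b'.M
    · have hr := b.isBetheRoot
      have hr' := b'.isBetheRoot
      revert hb hM hr hr'
      obtain ⟨M, ξ, u, ha, ho, _, _⟩ := b
      obtain ⟨M', ξ', u', ha', ho', _, _⟩ := b'
      intro hb hM hr hr'
      dsimp only at hM hr hr'
      subst hM
      by_cases hξ : ξ = ξ'
      · subst hξ
        dsimp only
        rw [inner_betheState_of_roots hN hN0 hre hτ ξ hr hr']
        have hne : u ≠ u' := by
          rintro rfl; exact hb rfl
        -- Two different root sets of equal size: some root of the first is missing from the second,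
        -- and its row in the overlap matrix is zero.
        obtain ⟨k, hk⟩ : ∃ k, u k ∉ Set.range u' := by
          by_contra! hall
          apply hne
          apply eq_of_range_eq_of_ordered ho ho'
          have hsub : Set.range u ⊆ Set.range u' := by
            rintro _ ⟨k, rfl⟩; exact hall k
          apply Set.eq_of_subset_of_ncard_le hsub _ (Set.finite_range _)
          rw [Set.ncard_range_of_injective (injective_of_ordered ho),
            Set.ncard_range_of_injective (injective_of_ordered ho')]
        refine Matrix.det_eq_zero_of_row_eq_zero k fun l => ?_
        rw [Matrix.of_apply, if_neg fun h => hk ⟨l, h.symm⟩]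
      · dsimp only
        rw [inner_betheState_same_card hN0, if_neg hξ, zero_mul]
    · exact inner_betheState_of_card_ne hN0 τ _ _ _ _ (b.admissible.2.trans b'.admissible.2.symm) hM

/-- An injection is enough: orthonormality turns it into a spanning set, so it need not be known
that the chosen `N` roots exhaust the sector. -/
lemma exists_injective_label [IsStrictTotalOrder ℂ lt] (hN0 : 0 < N) (hre : τ.re = 0)
    (hτ : 0 < τ.im) :
    ∃ f : Fin 2 × {S : Finset (Fin N) // S.card % 2 = (N / 2) % 2} → BetheLabel N τ lt,
      Function.Injective f := by
  classical
  choose r hr1 hr2 using fun ξ : Fin 2 => exists_betheRoots hre hτ hN0 (ξ : ℕ)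
  have hcard : ∀ (ξ : Fin 2) (S : Finset (Fin N)), (S.image (r ξ)).card = S.card := fun ξ S =>
    Finset.card_image_of_injective S (hr1 ξ)
  let := linearOrderOfSTO lt
  have hmem : ∀ (ξ : Fin 2) (S : Finset (Fin N)) (j : Fin S.card),
      IsBetheRoot N τ ξ ((S.image (r ξ)).orderEmbOfFin (hcard ξ S) j) := by
    intro ξ S j
    have := Finset.orderEmbOfFin_mem (S.image (r ξ)) (hcard ξ S) j
    obtain ⟨i, -, hi⟩ := Finset.mem_image.mp this
    rw [← hi]
    exact hr2 ξ i
  refine ⟨fun p => ⟨p.2.1.card, p.1, (p.2.1.image (r p.1)).orderEmbOfFin (hcard p.1 p.2.1),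
    ⟨?_, p.2.2⟩, fun i j hij => ((p.2.1.image (r p.1)).orderEmbOfFin (hcard p.1 p.2.1)).strictMono hij,
    fun j => (hmem _ _ j).1, fun j => (hmem _ _ j).2⟩, ?_⟩
  · simpa using Finset.card_le_univ p.2.1
  · rintro ⟨ξ, S, hS⟩ ⟨ξ', S', hS'⟩ h
    have h1 := congrArg BetheLabel.ξ h
    have h2 := congrArg (fun b : BetheLabel N τ lt => Set.range b.u) h
    dsimp only at h1 h2
    subst h1
    rw [Finset.range_orderEmbOfFin, Finset.range_orderEmbOfFin] at h2
    obtain rfl := Finset.image_injective (hr1 ξ) (Finset.coe_injective h2)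
    rfl

end labels
end XYChain

theorem theorem3 (N : ℕ) (hN : Even N) (hN0 : 0 < N)
    (τ : ℂ) (hτre : τ.re = 0) (hτim : 0 < τ.im)
    (lt : ℂ → ℂ → Prop) [IsStrictTotalOrder ℂ lt] :
    (∀ b : XYChain.BetheLabel N τ lt,
      XYChain.hamiltonianXY N (XYChain.couplingX τ) (XYChain.couplingY τ)
          (XYChain.betheState τ (b.ξ : ℕ) b.u : XYChain.StateSpace N) =
        XYChain.betheEnergy τ b.u •
          (XYChain.betheState τ (b.ξ : ℕ) b.u : XYChain.StateSpace N)) ∧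
    Orthonormal ℂ (fun b : XYChain.BetheLabel N τ lt =>
      (XYChain.betheState τ (b.ξ : ℕ) b.u : XYChain.StateSpace N)) ∧
    Submodule.span ℂ (Set.range (fun b : XYChain.BetheLabel N τ lt =>
      (XYChain.betheState τ (b.ξ : ℕ) b.u : XYChain.StateSpace N))) = ⊤ := by
  have hortho := XYChain.orthonormal_betheState (lt := lt) hN hN0 hτre hτim
  refine ⟨fun b => XYChain.hamiltonianXY_betheState hN hN0 hτre hτim b.admissible.2 b.ξ
    b.isBetheRoot, hortho, ?_⟩
  obtain ⟨f, hf⟩ := XYChain.exists_injective_label (lt := lt) hN0 hτre hτim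
  rw [eq_top_iff, ← XYChain.span_eq_top_of_orthonormal hN0 (hortho.comp f hf)]
  exact Submodule.span_mono (Set.range_comp_subset_range f _)
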